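/- Let $d\ge 1$ and let $\mathscr D=\bigcup_{k\in\mathbb Z}\mathscr D_k$ be a system of dyadic cubes in $\mathbb R^d$: each $\mathscr D_k$ is a partition of $\mathbb R^d$ into axes-parallel, left-closed, right-open cubes of side-length $2^{-k}$, and $\mathscr D_{k+1}$ refines $\mathscr D_k$. For locally integrable $f$ with values in a Banach space let $\langle f\rangle_Q=|Q|^{-1}\int_Q f$, $\mathbb E_k f=\sum_{Q\in\mathscr D_k}1_Q\langle f\rangle_Q$ and $\mathbb D_k f=\mathbb E_k f-\mathbb E_{k-1}f$. For a Banach space $F$, $\mathrm{BMO}_d(\mathbb R^d;F)$ is the space of $b\in L^1_{\mathrm{loc}}(\mathbb R^d;F)$ with $\|b\|_{\mathrm{BMO}_d}=\sup_{Q\in\mathscr D}|Q|^{-1}\int_Q\|b-\langle b\rangle_Q\|_F<\infty$, and $H^1_d(\mathbb R^d;F)$ is the space of $h\in L^1(\mathbb R^d;F)$ with $\|h\|_{H^1_d}=\big\|\sup_{k}\|\mathbb E_k h\|_F\big\|_{L^1(\mathbb R^d)}<\infty$. Let $X$ and $Y$ be (real or complex) UMD spaces, $1<p<\infty$, $\frac1p+\frac1{p'}=1$.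 The UMD constant $\beta_{p,X}$ is the least $\beta\ge0$ such that $\|\sum_{n=1}^N\epsilon_n(f_n-f_{n-1})\|_{L^p(S;X)}\le\beta\|\sum_{n=1}^N(f_n-f_{n-1})\|_{L^p(S;X)}$ for all finite martingales $(f_n)_{n=0}^N$ in $L^p(S;X)$ on $\sigma$-finite measure spaces $S$ (with $\sigma$-finite filtrations) and all signs $\epsilon_n\in\{-1,1\}$. Let $b\in\mathrm{BMO}_d(\mathbb R^d;\mathscr L(X,Y))$. The symmetrised dyadic paraproduct $\Lambda_b=\Pi_b+(\Pi_{b^*})^*$ (formally $\Pi_b f=\sum_k\mathbb D_k b\,\mathbb E_{k-1}f$) is defined by the pairing $$\langle\Lambda_b f,g\rangle=\int_{\mathbb R^d}\sum_{k\in\mathbb Z}\Big(\big\langle b(x)\,\mathbb E_{k-1}f(x),\mathbb D_k g(x)\big\rangle+\big\langle b(x)\,\mathbb D_k f(x),\mathbb E_{k-1}g(x)\big\rangle\Big)\,dx$$ for compactly supported $f\in L^p(\mathbb R^d;X)$ and $g\in L^{p'}(\mathbb R^d;Y^*)$ such that $\mathbb D_k f\ne0$ and $\mathbb D_k g\neq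 0$ for only finitely many $k$. Then $\Lambda_b$ extends to a bounded linear operator from $L^p(\mathbb R^d;X)$ to $L^p(\mathbb R^d;Y)$, and there are constants $c_d,c_d'$ depending only on $d$ such that $$\|\Lambda_b\|_{\mathscr L(L^p(\mathbb R^d;X),L^p(\mathbb R^d;Y))}\le c_d\,(pp'+\beta_{p,X}\beta_{p,Y})\,\|b\|_{\mathrm{BMO}_d}\le c_d'\,\beta_{p,X}\beta_{p,Y}\,\|b\|_{\mathrm{BMO}_d},$$ where the second inequality is for $X,Y\ne\{0\}$ (if $X$ or $Y$ is zero, the outer inequality holds trivially). Moreover, the first inequality holds for every $c_d \ge 0$ that is an admissible constant in the $H^1$–$\mathrm{BMO}$ duality, i.e. such that for all Banach spaces $E$, all $b\in\mathrm{BMO}_d(\mathbb R^d;E^*)$ and $h\in H^1_d(\mathbb R^d;E)$ the limit $\langle b,h\rangle=\lim_{N\to\infty}\int_{\mathbb R^d}\min\{1,N/\|b(x)\|_{E^*}\}\langle b(x),h(x)\rangle\,dx$ exists and satisfies $|\langle b,h\rangle|\le c_d\|b\|_{\mathrm{BMO}_d}\|h\|_{H^1_d}$. -/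

import Mathlib

open MeasureTheory Filter Topology
open scoped ENNReal

universe u v

noncomputable section

/-! ### Dyadic systems of cubes -/

/-- The axes-parallel, left-closed, right-open cube with lower corner `a` and side length `l`. -/
def halfOpenCube {d : ℕ} (a : EuclideanSpace ℝ (Fin d)) (l : ℝ) : Set (EuclideanSpace ℝ (Fin d)) :=
  {x | ∀ i, a i ≤ x i ∧ x i < a i + l}

/-- A system of dyadic cubes in `ℝ^d`: for every `k : ℤ`, `cubes k` is a partition of `ℝ^d` into
half-open cubes of side length `2^(-k)`, and `cubes (k + 1)` refines `cubes k`. -/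
structure DyadicSystem (d : ℕ) where
  cubes : ℤ → Set (Set (EuclideanSpace ℝ (Fin d)))
  isCube : ∀ k, ∀ Q ∈ cubes k, ∃ a, Q = halfOpenCube a ((2 : ℝ) ^ (-k))
  isPartition : ∀ k, Setoid.IsPartition (cubes k)
  refines : ∀ k, ∀ Q ∈ cubes (k + 1), ∃ R ∈ cubes k, Q ⊆ R

namespace DyadicSystem

/-- The cube of generation `k` that contains `x`. -/
def cubeAt {d : ℕ} (D : DyadicSystem d) (k : ℤ) (x : EuclideanSpace ℝ (Fin d)) :
    Set (EuclideanSpace ℝ (Fin d)) :=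
  {y | ∃ Q ∈ D.cubes k, x ∈ Q ∧ y ∈ Q}

theorem cubeAt_eq {d : ℕ} (D : DyadicSystem d) {k : ℤ} {x : EuclideanSpace ℝ (Fin d)}
    {Q : Set (EuclideanSpace ℝ (Fin d))} (hQ : Q ∈ D.cubes k) (hx : x ∈ Q) : D.cubeAt k x = Q := by
  ext y
  constructor
  · rintro ⟨R, hR, hxR, hy⟩
    rwa [((D.isPartition k).2 x).unique ⟨hQ, hx⟩ ⟨hR, hxR⟩]
  · exact fun hy => ⟨Q, hQ, hx, hy⟩

/-- The averaging operator `𝔼_k f = ∑_{Q ∈ 𝒟_k} 1_Q ⟨f⟩_Q`. -/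
def avg {d : ℕ} {F : Type*} [NormedAddCommGroup F] [NormedSpace ℝ F] (D : DyadicSystem d) (k : ℤ)
    (f : EuclideanSpace ℝ (Fin d) → F) : EuclideanSpace ℝ (Fin d) → F :=
  fun x => ⨍ y in D.cubeAt k x, f y

/-- The martingale difference operator `𝔻_k = 𝔼_k - 𝔼_{k-1}`. -/
def diff {d : ℕ} {F : Type*} [NormedAddCommGroup F] [NormedSpace ℝ F] (D : DyadicSystem d) (k : ℤ)
    (f : EuclideanSpace ℝ (Fin d) → F) : EuclideanSpace ℝ (Fin d) → F :=
  D.avg k f - D.avg (k - 1) f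

/-! ### Dyadic BMO and dyadic `H^1` -/

/-- The dyadic BMO norm: the supremum over `Q ∈ 𝒟` of the mean over `Q` of `‖b - ⟨b⟩_Q‖`. -/
def bmoNorm {d : ℕ} {F : Type*} [NormedAddCommGroup F] [NormedSpace ℝ F] (D : DyadicSystem d)
    (b : EuclideanSpace ℝ (Fin d) → F) : ℝ≥0∞ :=
  ⨆ (k : ℤ) (Q ∈ D.cubes k), (volume Q)⁻¹ * ∫⁻ x in Q, ‖b x - ⨍ y in Q, b y‖ₑ

/-- Membership in the dyadic space `BMO_d(ℝ^d; F)`. -/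
structure MemBMO {d : ℕ} {F : Type*} [NormedAddCommGroup F] [NormedSpace ℝ F] (D : DyadicSystem d)
    (b : EuclideanSpace ℝ (Fin d) → F) : Prop where
  locallyIntegrable : LocallyIntegrable b volume
  bmoNorm_lt_top : D.bmoNorm b < ∞

/-- The dyadic Hardy norm: the `L^1` norm of the cancellative maximal function `sup_k ‖𝔼_k h‖`. -/
def hardyNorm {d : ℕ} {E : Type*} [NormedAddCommGroup E] [NormedSpace ℝ E] (D : DyadicSystem d)
    (h : EuclideanSpace ℝ (Fin d) → E) : ℝ≥0∞ :=
  ∫⁻ x, ⨆ k : ℤ, ‖D.avg k h x‖ₑ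

/-- Membership in the dyadic Hardy space `H^1_d(ℝ^d; E)`. -/
structure MemHardy {d : ℕ} {E : Type*} [NormedAddCommGroup E] [NormedSpace ℝ E]
    (D : DyadicSystem d) (h : EuclideanSpace ℝ (Fin d) → E) : Prop where
  integrable : Integrable h volume
  hardyNorm_lt_top : D.hardyNorm h < ∞

/-- `c` is an admissible constant in the dyadic `H^1`-BMO duality: for every Banach space `E`,
`|⟨b, h⟩| ≤ c ‖b‖_{BMO_d(E*)} ‖h‖_{H^1_d(E)}`, where
`⟨b, h⟩ = lim_{N → ∞} ∫ min(1, N / ‖b(x)‖) ⟨b(x), h(x)⟩ dx`. (At points with `b(x) = 0` the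
integrand vanishes, whatever the value given to `N / 0`.) -/
def IsDualityConstant.{w} {d : ℕ} (𝕜 : Type) [RCLike 𝕜] (D : DyadicSystem d) (c : ℝ) : Prop :=
  0 ≤ c ∧
  ∀ (E : Type w) [NormedAddCommGroup E] [NormedSpace ℝ E] [NormedSpace 𝕜 E] [IsScalarTower ℝ 𝕜 E]
    [CompleteSpace E]
    (b : EuclideanSpace ℝ (Fin d) → StrongDual 𝕜 E) (h : EuclideanSpace ℝ (Fin d) → E),
    D.MemBMO b → D.MemHardy h →
    ∃ L : 𝕜,
      Tendsto (fun N : ℕ => ∫ x, (min 1 ((N : ℝ) / ‖b x‖)) • (b x) (h x)) atTop (𝓝 L) ∧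
      ‖L‖ ≤ c * (D.bmoNorm b).toReal * (D.hardyNorm h).toReal

/-! ### Symmetrised paraproducts -/

/-- `f ∈ L^p_c(ℝ^d; F)` (compact support) with a finite martingale difference expansion. -/
structure IsTestFunction {d : ℕ} {F : Type*} [NormedAddCommGroup F] [NormedSpace ℝ F]
    (D : DyadicSystem d) (p : ℝ≥0∞) (f : EuclideanSpace ℝ (Fin d) → F) : Prop where
  memLp : MemLp f p volume
  hasCompactSupport : HasCompactSupport f
  finite_expansion : {k : ℤ | D.diff k f ≠ 0}.Finite

/-- The pairing that defines the symmetrised paraproduct `Λ_b = Π_b + (Π_{b*})*`: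
`⟨Λ_b f, g⟩ = ⟨b, ∑_k (𝔼_{k-1} f ⊗ 𝔻_k g + 𝔻_k f ⊗ 𝔼_{k-1} g)⟩`,
with the pointwise pairing `⟨T, x ⊗ y*⟩ = y*(T x)` of operators with elementary tensors, integrated
over `ℝ^d`. For test functions `f` and `g` only finitely many terms are nonzero. -/
def symParaproduct {d : ℕ} {𝕜 : Type} [RCLike 𝕜]
    {X : Type*} [NormedAddCommGroup X] [NormedSpace ℝ X] [NormedSpace 𝕜 X] [IsScalarTower ℝ 𝕜 X]
    {Y : Type*} [NormedAddCommGroup Y] [NormedSpace ℝ Y] [NormedSpace 𝕜 Y] [IsScalarTower ℝ 𝕜 Y]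
    (D : DyadicSystem d) (b : EuclideanSpace ℝ (Fin d) → X →L[𝕜] Y)
    (f : EuclideanSpace ℝ (Fin d) → X) (g : EuclideanSpace ℝ (Fin d) → StrongDual 𝕜 Y) : 𝕜 :=
  ∫ x, ∑ᶠ k : ℤ, ((D.diff k g x) (b x (D.avg (k - 1) f x))
    + (D.avg (k - 1) g x) (b x (D.diff k f x)))

end DyadicSystem

/-! ### UMD spaces -/

/-- `β` is an admissible constant in the UMD inequality for the exponent `p`: for every `σ`-finite
measure space, every `σ`-finite filtration, every finite martingale `(f_n)_{n=0}^N` in `L^p` and all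
signs, `‖∑ ε_n (f_{n+1} - f_n)‖_p ≤ β ‖∑ (f_{n+1} - f_n)‖_p`. -/
def IsUMDBound (p : ℝ≥0∞) (X : Type*) [NormedAddCommGroup X] [NormedSpace ℝ X] [CompleteSpace X]
    (β : ℝ) : Prop :=
  0 ≤ β ∧
  ∀ (Ω : Type) (m : MeasurableSpace Ω) (μ : Measure Ω) [SigmaFinite μ]
    (ℱ : Filtration ℕ m) [SigmaFiniteFiltration μ ℱ] (f : ℕ → Ω → X) (N : ℕ) (ε : ℕ → ℝ),
    Martingale f ℱ μ → (∀ n ≤ N, MemLp (f n) p μ) → (∀ n, ε n = 1 ∨ ε n = -1) →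
    eLpNorm (∑ n ∈ Finset.range N, ε n • (f (n + 1) - f n)) p μ
      ≤ ENNReal.ofReal β * eLpNorm (∑ n ∈ Finset.range N, (f (n + 1) - f n)) p μ

/-- `X` is a UMD space. -/
def IsUMD (X : Type*) [NormedAddCommGroup X] [NormedSpace ℝ X] [CompleteSpace X] : Prop :=
  ∀ p : ℝ≥0∞, 1 < p → p < ∞ → ∃ β : ℝ, IsUMDBound p X β

/-- The UMD constant `β_{p,X}`: the least admissible constant. -/
def umdConst (p : ℝ≥0∞) (X : Type*) [NormedAddCommGroup X] [NormedSpace ℝ X] [CompleteSpace X] : ℝ :=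
  sInf {β : ℝ | IsUMDBound p X β}

end

/-! For test functions the pairing is `∫ h(x)(b(x)) dx`, where `h = ∑ (𝔼_{k-1} f ⊗ 𝔻_k g + 𝔻_k f ⊗
𝔼_{k-1} g)` takes values in the dual of `X →L[𝕜] Y`. It therefore suffices to bound `h` in dyadic
`H^1` by `(p q + β_{p,X} β_{p,Y}) ‖f‖_p ‖g‖_q` and to apply `H^1`-BMO duality.

The point of symmetrising is the product rule `paraTensor_eq`: the partial sums of `h` equal `𝔼_k f
⊗ 𝔼_k g` minus the partial sums of `∑ 𝔻_j f ⊗ 𝔻_j g`. These partial sums are also the dyadic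
averages of `h` (`avg_paraTensor`), so the maximal function of `h` splits into two pieces. The first
is at most the product of the maximal functions of `f` and `g`, and Doob's inequality with constants
`q` and `p` contributes `p q` (`eLpNorm_martMax_le`). The diagonal sum is an average over signs of
`(∑ ε_j 𝔻_j f) ⊗ (∑ ε_j 𝔻_j g)`; convexity absorbs the truncation, and Hölder and the UMD inequality
contribute `β_{p,X} β_{p,Y}` (`norm_sum_bilinear_le_signOn`). The transforms of `g` are controlled
by the constant of `Y` itself, since martingale transforms are self-adjoint
(`eLpNorm_sum_sign_martDiff_le_of_dual`). The two pieces meet in `hardyNorm_paraTensor_le`.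

Any admissible duality constant may now be inserted, with `b` regarded as a bidual-valued function.
That the constant `6 * 2 ^ d` works for step functions is proved in
`enorm_integral_pairing_le_bmoNorm_mul_hardyNorm`: stopping `h` at the levels `ε 2^i` decomposes it
into bounded pieces that are mean zero on their supporting cubes.

To obtain an operator into `L^p(Y)`, rather than into a dual space, `Λ_b f` is written down as `b f
- ∑ 𝔻_k (b 𝔻_k f)`. Its `L^p` norm is computed by testing with mean-zero step functions, which are
dense, and the operator extends.

The second inequality follows from `p, q ≤ 2 * 4 ^ d * β_{p,X}`, and likewise for `Y`
(`max_le_mul_umdConst`), which a martingale along one nested chain of cubes shows. -/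

namespace DyadicSystem

/-! ### Geometry and measure of dyadic cubes -/

section Cubes

variable {d : ℕ} (D : DyadicSystem d)

theorem exists_mem_cubes (k : ℤ) (x : EuclideanSpace ℝ (Fin d)) : ∃ Q ∈ D.cubes k, x ∈ Q :=
  let ⟨Q, h, _⟩ := (D.isPartition k).2 x
  ⟨Q, h.1, h.2⟩

theorem cubeAt_mem (k : ℤ) (x : EuclideanSpace ℝ (Fin d)) : D.cubeAt k x ∈ D.cubes k := by
  obtain ⟨Q, hQ, hx⟩ := D.exists_mem_cubes k x
  rwa [D.cubeAt_eq hQ hx]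

theorem mem_cubeAt_self (k : ℤ) (x : EuclideanSpace ℝ (Fin d)) : x ∈ D.cubeAt k x := by
  obtain ⟨Q, hQ, hx⟩ := D.exists_mem_cubes k x
  rwa [D.cubeAt_eq hQ hx]

theorem cubeAt_congr {k : ℤ} {x y : EuclideanSpace ℝ (Fin d)} (h : y ∈ D.cubeAt k x) :
    D.cubeAt k y = D.cubeAt k x :=
  D.cubeAt_eq (D.cubeAt_mem k x) h

theorem mem_cubeAt_comm {k : ℤ} {x y : EuclideanSpace ℝ (Fin d)} (h : y ∈ D.cubeAt k x) :
    x ∈ D.cubeAt k y := by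
  rw [D.cubeAt_congr h]
  exact D.mem_cubeAt_self k x

theorem cubeAt_succ_subset (k : ℤ) (x : EuclideanSpace ℝ (Fin d)) :
    D.cubeAt (k + 1) x ⊆ D.cubeAt k x := by
  obtain ⟨R, hR, h⟩ := D.refines k _ (D.cubeAt_mem (k + 1) x)
  rwa [D.cubeAt_eq hR (h (D.mem_cubeAt_self _ x))]

theorem cubeAt_anti {j k : ℤ} (h : j ≤ k) (x : EuclideanSpace ℝ (Fin d)) :
    D.cubeAt k x ⊆ D.cubeAt j x := by
  induction k, h using Int.leInduction with
  | base => exact subset_rfl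
  | succ k _ ih => exact (D.cubeAt_succ_subset k x).trans ih

theorem exists_cubeAt_eq (k : ℤ) (x : EuclideanSpace ℝ (Fin d)) :
    ∃ a, D.cubeAt k x = halfOpenCube a ((2 : ℝ) ^ (-k)) :=
  D.isCube k _ (D.cubeAt_mem k x)

end Cubes

theorem halfOpenCube_eq_preimage {d : ℕ} (a : EuclideanSpace ℝ (Fin d)) (l : ℝ) :
    halfOpenCube a l = WithLp.ofLp ⁻¹' (Set.univ.pi fun i => Set.Ico (a i) (a i + l)) := by
  ext x
  simp [halfOpenCube, Set.mem_pi]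

theorem measurableSet_halfOpenCube {d : ℕ} (a : EuclideanSpace ℝ (Fin d)) (l : ℝ) :
    MeasurableSet (halfOpenCube a l) := by
  rw [halfOpenCube_eq_preimage]
  exact (PiLp.volume_preserving_ofLp (Fin d)).measurable
    (MeasurableSet.univ_pi fun i => measurableSet_Ico)

theorem volume_halfOpenCube {d : ℕ} (a : EuclideanSpace ℝ (Fin d)) (l : ℝ) :
    volume (halfOpenCube a l) = ENNReal.ofReal l ^ d := by
  rw [halfOpenCube_eq_preimage, (PiLp.volume_preserving_ofLp (Fin d)).measure_preimage
    (MeasurableSet.univ_pi fun i => measurableSet_Ico).nullMeasurableSet, Real.volume_pi_Ico]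
  simp

theorem dist_le_of_mem_halfOpenCube {d : ℕ} {a : EuclideanSpace ℝ (Fin d)} {l : ℝ} (hl : 0 ≤ l)
    {x y : EuclideanSpace ℝ (Fin d)} (hx : x ∈ halfOpenCube a l) (hy : y ∈ halfOpenCube a l) :
    dist x y ≤ √d * l := by
  rw [EuclideanSpace.dist_eq, ← Real.sqrt_sq hl, ← Real.sqrt_mul (by positivity)]
  apply Real.sqrt_le_sqrt
  calc ∑ i, dist (x i) (y i) ^ 2 ≤ ∑ _i : Fin d, l ^ 2 := by
        refine Finset.sum_le_sum fun i _ => pow_le_pow_left₀ dist_nonneg ?_ 2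
        rw [Real.dist_eq, abs_le]
        have := hx i
        have := hy i
        constructor <;> linarith
    _ = d * l ^ 2 := by simp

theorem interior_halfOpenCube_nonempty {d : ℕ} (a : EuclideanSpace ℝ (Fin d)) {l : ℝ}
    (hl : 0 < l) : (interior (halfOpenCube a l)).Nonempty := by
  refine ⟨WithLp.toLp 2 fun i => a i + l / 2, ?_⟩
  have hU : IsOpen (WithLp.ofLp ⁻¹' (Set.univ.pi fun i => Set.Ioo (a i) (a i + l)) :
      Set (EuclideanSpace ℝ (Fin d))) :=
    (isOpen_set_pi Set.finite_univ fun i _ => isOpen_Ioo).preimage (PiLp.continuous_ofLp 2 _)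
  refine mem_interior.2 ⟨_, ?_, hU, ?_⟩
  · rw [halfOpenCube_eq_preimage]
    exact Set.preimage_mono (Set.pi_mono fun i _ => Set.Ioo_subset_Ico_self)
  · simp only [Set.mem_preimage, Set.mem_pi, Set.mem_univ, forall_true_left, Set.mem_Ioo]
    intro i
    constructor <;> linarith

section CubesMeasure

variable {d : ℕ} (D : DyadicSystem d)

theorem measurableSet_cubeAt (k : ℤ) (x : EuclideanSpace ℝ (Fin d)) :
    MeasurableSet (D.cubeAt k x) := by
  obtain ⟨a, ha⟩ := D.exists_cubeAt_eq k x
  exact ha ▸ measurableSet_halfOpenCube a _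

theorem volume_cubeAt (k : ℤ) (x : EuclideanSpace ℝ (Fin d)) :
    volume (D.cubeAt k x) = ENNReal.ofReal ((2 : ℝ) ^ (-k)) ^ d := by
  obtain ⟨a, ha⟩ := D.exists_cubeAt_eq k x
  rw [ha, volume_halfOpenCube]

theorem volume_real_cubeAt (k : ℤ) (x : EuclideanSpace ℝ (Fin d)) :
    volume.real (D.cubeAt k x) = ((2 : ℝ) ^ (-k)) ^ d := by
  rw [measureReal_def, volume_cubeAt, ENNReal.toReal_pow, ENNReal.toReal_ofReal (by positivity)]

theorem volume_cubeAt_ne_top (k : ℤ) (x : EuclideanSpace ℝ (Fin d)) :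
    volume (D.cubeAt k x) ≠ ∞ := by
  rw [volume_cubeAt]
  finiteness

theorem volume_cubeAt_ne_zero (k : ℤ) (x : EuclideanSpace ℝ (Fin d)) :
    volume (D.cubeAt k x) ≠ 0 := by
  rw [volume_cubeAt]
  refine pow_ne_zero _ (ENNReal.ofReal_pos.2 (by positivity)).ne'

theorem volume_cubeAt_eq_two_pow_mul (k : ℤ) (x y : EuclideanSpace ℝ (Fin d)) :
    volume (D.cubeAt k x) = 2 ^ d * volume (D.cubeAt (k + 1) y) := by
  rw [volume_cubeAt, volume_cubeAt, ← mul_pow, ← ENNReal.ofReal_ofNat 2,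
    ← ENNReal.ofReal_mul (by norm_num), neg_add, ← zpow_one_add₀ (by norm_num)]
  congr 3
  ring

theorem dist_le_of_mem_cubeAt {k : ℤ} {x y : EuclideanSpace ℝ (Fin d)} (h : y ∈ D.cubeAt k x) :
    dist y x ≤ √d * (2 : ℝ) ^ (-k) := by
  obtain ⟨a, ha⟩ := D.exists_cubeAt_eq k x
  have hx := D.mem_cubeAt_self k x
  rw [ha] at h hx
  exact dist_le_of_mem_halfOpenCube (by positivity) h hx

theorem isBounded_cubeAt (k : ℤ) (x : EuclideanSpace ℝ (Fin d)) :
    Bornology.IsBounded (D.cubeAt k x) :=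
  Metric.isBounded_closedBall.subset fun _ hy => D.dist_le_of_mem_cubeAt hy

theorem cubes_nonempty {k : ℤ} {Q : Set (EuclideanSpace ℝ (Fin d))} (hQ : Q ∈ D.cubes k) :
    Q.Nonempty :=
  Setoid.nonempty_of_mem_partition (D.isPartition k) hQ

theorem exists_eq_cubeAt {k : ℤ} {Q : Set (EuclideanSpace ℝ (Fin d))} (hQ : Q ∈ D.cubes k) :
    ∃ x, Q = D.cubeAt k x := by
  obtain ⟨x, hx⟩ := D.cubes_nonempty hQ
  exact ⟨x, (D.cubeAt_eq hQ hx).symm⟩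

theorem countable_cubes (k : ℤ) : (D.cubes k).Countable := by
  refine (D.isPartition k).pairwiseDisjoint.countable_of_nonempty_interior fun Q hQ => ?_
  obtain ⟨a, ha⟩ := D.isCube k Q hQ
  rw [id, ha]
  exact interior_halfOpenCube_nonempty a (by positivity)

instance (k : ℤ) : Countable (D.cubes k) := (D.countable_cubes k).to_subtype

/-- `S` is a union of cubes of generation `k`. -/
def IsUnionOfCubes (k : ℤ) (S : Set (EuclideanSpace ℝ (Fin d))) : Prop :=
  ∀ x ∈ S, D.cubeAt k x ⊆ S

variable {D}

theorem IsUnionOfCubes.univ (k : ℤ) : D.IsUnionOfCubes k Set.univ := fun _ _ => Set.subset_univ _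

theorem IsUnionOfCubes.mono {j k : ℤ} {S : Set (EuclideanSpace ℝ (Fin d))}
    (hS : D.IsUnionOfCubes j S) (h : j ≤ k) : D.IsUnionOfCubes k S :=
  fun _ hx => (D.cubeAt_anti h _).trans (hS _ hx)

theorem isUnionOfCubes_cubeAt (k : ℤ) (x : EuclideanSpace ℝ (Fin d)) :
    D.IsUnionOfCubes k (D.cubeAt k x) := fun _ hy => (D.cubeAt_congr hy).subset

theorem IsUnionOfCubes.compl {k : ℤ} {S : Set (EuclideanSpace ℝ (Fin d))}
    (hS : D.IsUnionOfCubes k S) : D.IsUnionOfCubes k Sᶜ :=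
  fun _ hx y hy hyS => hx (hS y hyS (D.mem_cubeAt_comm hy))

theorem IsUnionOfCubes.iUnion_eq {k : ℤ} {S : Set (EuclideanSpace ℝ (Fin d))}
    (hS : D.IsUnionOfCubes k S) :
    ⋃ Q : {Q : D.cubes k // Q.1 ⊆ S}, Q.1.1 = S := by
  refine Set.Subset.antisymm (Set.iUnion_subset fun Q => Q.2) fun x hx => ?_
  exact Set.mem_iUnion.2 ⟨⟨⟨_, D.cubeAt_mem k x⟩, hS x hx⟩, D.mem_cubeAt_self k x⟩

theorem measurableSet_of_mem_cubes {k : ℤ} {Q : Set (EuclideanSpace ℝ (Fin d))}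
    (hQ : Q ∈ D.cubes k) : MeasurableSet Q := by
  obtain ⟨x, rfl⟩ := D.exists_eq_cubeAt hQ
  exact D.measurableSet_cubeAt k x

theorem IsUnionOfCubes.measurableSet {k : ℤ} {S : Set (EuclideanSpace ℝ (Fin d))}
    (hS : D.IsUnionOfCubes k S) : MeasurableSet S := by
  rw [← hS.iUnion_eq]
  exact MeasurableSet.iUnion fun Q => measurableSet_of_mem_cubes Q.1.2

theorem pairwise_disjoint_cubes (k : ℤ) (S : Set (EuclideanSpace ℝ (Fin d))) :
    Pairwise (Function.onFun Disjoint fun Q : {Q : D.cubes k // Q.1 ⊆ S} => Q.1.1) :=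
  fun Q R h => (D.isPartition k).pairwiseDisjoint Q.1.2 R.1.2
    fun h' => h (Subtype.ext (Subtype.ext h'))

theorem IsUnionOfCubes.setLIntegral_eq {k : ℤ} {S : Set (EuclideanSpace ℝ (Fin d))}
    (hS : D.IsUnionOfCubes k S) (f : EuclideanSpace ℝ (Fin d) → ℝ≥0∞) :
    ∫⁻ x in S, f x = ∑' Q : {Q : D.cubes k // Q.1 ⊆ S}, ∫⁻ x in Q.1.1, f x := by
  conv_lhs => rw [← hS.iUnion_eq]
  exact lintegral_iUnion (fun Q => measurableSet_of_mem_cubes Q.1.2)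
    (pairwise_disjoint_cubes k S) f

/-- Countable additivity over the cubes: a comparison of integrals that holds cube by cube holds on
any union of cubes. No measurability of the integrands enters. -/
theorem IsUnionOfCubes.setLIntegral_le {k : ℤ} {S : Set (EuclideanSpace ℝ (Fin d))}
    (hS : D.IsUnionOfCubes k S) {f g : EuclideanSpace ℝ (Fin d) → ℝ≥0∞}
    (h : ∀ x ∈ S, ∫⁻ y in D.cubeAt k x, f y ≤ ∫⁻ y in D.cubeAt k x, g y) :
    ∫⁻ x in S, f x ≤ ∫⁻ x in S, g x := by
  rw [hS.setLIntegral_eq, hS.setLIntegral_eq]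
  refine ENNReal.tsum_le_tsum fun Q => ?_
  obtain ⟨x, hx⟩ := D.exists_eq_cubeAt Q.1.2
  have h2 := Q.2
  rw [hx] at h2 ⊢
  exact h x (h2 (D.mem_cubeAt_self k x))

theorem IsUnionOfCubes.setIntegral_eq {F : Type*} [NormedAddCommGroup F] [NormedSpace ℝ F]
    {k : ℤ} {S : Set (EuclideanSpace ℝ (Fin d))} (hS : D.IsUnionOfCubes k S)
    {f : EuclideanSpace ℝ (Fin d) → F} (hf : IntegrableOn f S) :
    ∫ x in S, f x = ∑' Q : {Q : D.cubes k // Q.1 ⊆ S}, ∫ x in Q.1.1, f x := by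
  conv_lhs => rw [← hS.iUnion_eq]
  exact integral_iUnion (fun Q => measurableSet_of_mem_cubes Q.1.2)
    (pairwise_disjoint_cubes k S) (by rwa [hS.iUnion_eq])

theorem IsUnionOfCubes.setIntegral_congr {F : Type*} [NormedAddCommGroup F] [NormedSpace ℝ F]
    {k : ℤ} {S : Set (EuclideanSpace ℝ (Fin d))} (hS : D.IsUnionOfCubes k S)
    {f g : EuclideanSpace ℝ (Fin d) → F} (hf : IntegrableOn f S) (hg : IntegrableOn g S)
    (h : ∀ x ∈ S, ∫ y in D.cubeAt k x, f y = ∫ y in D.cubeAt k x, g y) :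
    ∫ x in S, f x = ∫ x in S, g x := by
  rw [hS.setIntegral_eq hf, hS.setIntegral_eq hg]
  refine tsum_congr fun Q => ?_
  obtain ⟨x, hx⟩ := D.exists_eq_cubeAt Q.1.2
  have h2 := Q.2
  rw [hx] at h2 ⊢
  exact h x (h2 (D.mem_cubeAt_self k x))

end CubesMeasure

end DyadicSystem

/-! ### Dyadic averages as conditional expectations -/

namespace DyadicSystem

theorem integrableOn_of_isBounded {d : ℕ} {F : Type*} [NormedAddCommGroup F]
    {f : EuclideanSpace ℝ (Fin d) → F}
    (hf : LocallyIntegrable f) {S : Set (EuclideanSpace ℝ (Fin d))} (hS : Bornology.IsBounded S) :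
    IntegrableOn f S :=
  (hf.integrableOn_isCompact hS.isCompact_closure).mono_set subset_closure

section Averages

variable {d : ℕ} {D : DyadicSystem d} {F G : Type*} [NormedAddCommGroup F] [NormedSpace ℝ F]
  [NormedAddCommGroup G] [NormedSpace ℝ G]

theorem avg_eq (D : DyadicSystem d) (k : ℤ) (f : EuclideanSpace ℝ (Fin d) → F)
    (x : EuclideanSpace ℝ (Fin d)) :
    D.avg k f x = (volume.real (D.cubeAt k x))⁻¹ • ∫ y in D.cubeAt k x, f y :=
  setAverage_eq _ _ _

theorem volume_real_cubeAt_pos (D : DyadicSystem d) (k : ℤ) (x : EuclideanSpace ℝ (Fin d)) :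
    0 < volume.real (D.cubeAt k x) := by
  rw [volume_real_cubeAt]
  positivity

theorem avg_congr_on_cube {k : ℤ} {f g : EuclideanSpace ℝ (Fin d) → F}
    {x : EuclideanSpace ℝ (Fin d)} (h : ∀ y ∈ D.cubeAt k x, f y = g y) :
    D.avg k f x = D.avg k g x := by
  rw [avg_eq, avg_eq, setIntegral_congr_fun (D.measurableSet_cubeAt k x) h]

theorem avg_congr_ae (k : ℤ) {f g : EuclideanSpace ℝ (Fin d) → F} (h : f =ᵐ[volume] g) :
    D.avg k f = D.avg k g := by
  ext x
  rw [avg_eq, avg_eq, setIntegral_congr_ae (D.measurableSet_cubeAt k x) (h.mono fun _ h _ => h)]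

theorem diff_congr_ae (k : ℤ) {f g : EuclideanSpace ℝ (Fin d) → F} (h : f =ᵐ[volume] g) :
    D.diff k f = D.diff k g := by
  rw [diff, diff, avg_congr_ae k h, avg_congr_ae _ h]

omit [NormedSpace ℝ F] in
theorem integrableOn_cubeAt {f : EuclideanSpace ℝ (Fin d) → F} (hf : LocallyIntegrable f) (k : ℤ)
    (x : EuclideanSpace ℝ (Fin d)) : IntegrableOn f (D.cubeAt k x) :=
  integrableOn_of_isBounded hf (D.isBounded_cubeAt k x)

theorem avg_add (k : ℤ) {f g : EuclideanSpace ℝ (Fin d) → F} (hf : LocallyIntegrable f)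
    (hg : LocallyIntegrable g) : D.avg k (f + g) = D.avg k f + D.avg k g := by
  ext x
  simp only [Pi.add_apply, avg_eq]
  rw [integral_add (integrableOn_cubeAt hf k x) (integrableOn_cubeAt hg k x), smul_add]

theorem avg_sub (k : ℤ) {f g : EuclideanSpace ℝ (Fin d) → F} (hf : LocallyIntegrable f)
    (hg : LocallyIntegrable g) : D.avg k (f - g) = D.avg k f - D.avg k g := by
  ext x
  simp only [Pi.sub_apply, avg_eq]
  rw [integral_sub (integrableOn_cubeAt hf k x) (integrableOn_cubeAt hg k x), smul_sub]

theorem avg_zero (k : ℤ) : D.avg k (0 : EuclideanSpace ℝ (Fin d) → F) = 0 := by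
  ext x
  simp [avg_eq]

/-- `f` is constant on the cubes of generation `k`. -/
def IsCubewiseConst {A : Type*} (D : DyadicSystem d) (k : ℤ) (f : EuclideanSpace ℝ (Fin d) → A) :
    Prop :=
  ∀ x, ∀ y ∈ D.cubeAt k x, f y = f x

theorem IsCubewiseConst.mono {A : Type*} {j k : ℤ} {f : EuclideanSpace ℝ (Fin d) → A}
    (hf : D.IsCubewiseConst j f) (h : j ≤ k) : D.IsCubewiseConst k f :=
  fun x y hy => hf x y (D.cubeAt_anti h x hy)

theorem isCubewiseConst_avg (k : ℤ) (f : EuclideanSpace ℝ (Fin d) → F) :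
    D.IsCubewiseConst k (D.avg k f) := fun x y hy => by
  rw [avg, avg, D.cubeAt_congr hy]

theorem IsCubewiseConst.avg_eq_self [CompleteSpace F] {k : ℤ} {f : EuclideanSpace ℝ (Fin d) → F}
    (hf : D.IsCubewiseConst k f) : D.avg k f = f := by
  ext x
  rw [avg_congr_on_cube (g := fun _ => f x) (hf x), avg,
    setAverage_const (D.volume_cubeAt_ne_zero k x) (D.volume_cubeAt_ne_top k x)]

/-- The `σ`-algebra of unions of cubes of generation `k`. -/
@[reducible] def cubeSigma (D : DyadicSystem d) (k : ℤ) :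
    MeasurableSpace (EuclideanSpace ℝ (Fin d)) where
  MeasurableSet' := D.IsUnionOfCubes k
  measurableSet_empty := fun _ h => h.elim
  measurableSet_compl _ := IsUnionOfCubes.compl
  measurableSet_iUnion s hs x hx := by
    obtain ⟨i, hi⟩ := Set.mem_iUnion.1 hx
    exact (hs i x hi).trans (Set.subset_iUnion s i)

/-- Such a function factors through the countable discrete set of cubes, on which every map is
strongly measurable. -/
theorem IsCubewiseConst.stronglyMeasurable_cubeSigma {A : Type*} [TopologicalSpace A] {k : ℤ}
    {f : EuclideanSpace ℝ (Fin d) → A} (hf : D.IsCubewiseConst k f) :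
    StronglyMeasurable[D.cubeSigma k] f := by
  let _ : MeasurableSpace (D.cubes k) := ⊤
  let c : EuclideanSpace ℝ (Fin d) → D.cubes k := fun x => ⟨_, D.cubeAt_mem k x⟩
  let φ : D.cubes k → A := fun Q => f (D.cubes_nonempty Q.2).some
  have hc : @Measurable _ _ (D.cubeSigma k) _ c := fun s _ x hx y hy => by
    rw [Set.mem_preimage] at hx ⊢
    convert! hx using 1
    exact Subtype.ext (D.cubeAt_congr hy)
  have hφ : f = φ ∘ c := by
    ext x
    exact (hf x _ (D.cubes_nonempty (c x).2).some_mem).symm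
  rw [hφ]
  exact (StronglyMeasurable.of_discrete (f := φ)).comp_measurable hc

theorem cubeSigma_le (k : ℤ) : D.cubeSigma k ≤ (inferInstance : MeasurableSpace (EuclideanSpace ℝ (Fin d))) :=
  fun _ h => IsUnionOfCubes.measurableSet h

theorem IsCubewiseConst.stronglyMeasurable {A : Type*} [TopologicalSpace A] {k : ℤ}
    {f : EuclideanSpace ℝ (Fin d) → A} (hf : D.IsCubewiseConst k f) : StronglyMeasurable f :=
  hf.stronglyMeasurable_cubeSigma.mono (cubeSigma_le k)

/-- The union of the cubes of generation `k` that meet `S`. -/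
def cubeHull (D : DyadicSystem d) (k : ℤ) (S : Set (EuclideanSpace ℝ (Fin d))) :
    Set (EuclideanSpace ℝ (Fin d)) :=
  {x | (D.cubeAt k x ∩ S).Nonempty}

theorem isUnionOfCubes_cubeHull (k : ℤ) (S : Set (EuclideanSpace ℝ (Fin d))) :
    D.IsUnionOfCubes k (D.cubeHull k S) := fun x hx y hy => by
  rwa [cubeHull, Set.mem_ofPred_eq, D.cubeAt_congr hy]

theorem subset_cubeHull (k : ℤ) (S : Set (EuclideanSpace ℝ (Fin d))) : S ⊆ D.cubeHull k S :=
  fun x hx => ⟨x, D.mem_cubeAt_self k x, hx⟩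

theorem isBounded_cubeHull (k : ℤ) {S : Set (EuclideanSpace ℝ (Fin d))}
    (hS : Bornology.IsBounded S) : Bornology.IsBounded (D.cubeHull k S) := by
  refine (hS.cthickening (δ := √d * (2 : ℝ) ^ (-k))).subset fun x ⟨y, hy, hyS⟩ => ?_
  exact Metric.mem_cthickening_of_dist_le x y _ _ hyS
    (by rw [dist_comm]; exact D.dist_le_of_mem_cubeAt hy)

theorem support_avg_subset (k : ℤ) (f : EuclideanSpace ℝ (Fin d) → F) :
    Function.support (D.avg k f) ⊆ D.cubeHull k (Function.support f) := by
  intro x hx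
  by_contra h
  refine hx ?_
  rw [avg_congr_on_cube (g := 0) fun y hy => ?_, avg_zero, Pi.zero_apply]
  by_contra hy'
  exact h ⟨y, hy, hy'⟩

/-- The `L^1` contractivity on one cube. Integrability is not needed, because the Bochner integral
of a non-integrable function is zero. -/
theorem setLIntegral_enorm_avg_cubeAt_le (k : ℤ) (f : EuclideanSpace ℝ (Fin d) → F)
    (x : EuclideanSpace ℝ (Fin d)) :
    ∫⁻ y in D.cubeAt k x, ‖D.avg k f y‖ₑ ≤ ∫⁻ y in D.cubeAt k x, ‖f y‖ₑ := by
  rw [setLIntegral_congr_fun (g := fun _ => ‖D.avg k f x‖ₑ) (D.measurableSet_cubeAt k x)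
    fun y hy => by simp only [isCubewiseConst_avg k f x y hy], setLIntegral_const, avg_eq,
    enorm_smul, mul_right_comm, Real.enorm_of_nonneg (inv_nonneg.2 measureReal_nonneg),
    ENNReal.ofReal_inv_of_pos (D.volume_real_cubeAt_pos k x),
    ofReal_measureReal (D.volume_cubeAt_ne_top k x),
    ENNReal.inv_mul_cancel (D.volume_cubeAt_ne_zero k x) (D.volume_cubeAt_ne_top k x), one_mul]
  exact enorm_integral_le_lintegral_enorm _

theorem setLIntegral_enorm_avg_le (f : EuclideanSpace ℝ (Fin d) → F) {k : ℤ}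
    {S : Set (EuclideanSpace ℝ (Fin d))} (hS : D.IsUnionOfCubes k S) :
    ∫⁻ y in S, ‖D.avg k f y‖ₑ ≤ ∫⁻ y in S, ‖f y‖ₑ :=
  hS.setLIntegral_le fun x _ => setLIntegral_enorm_avg_cubeAt_le k f x

theorem integrableOn_avg {f : EuclideanSpace ℝ (Fin d) → F} {k : ℤ}
    {S : Set (EuclideanSpace ℝ (Fin d))} (hS : D.IsUnionOfCubes k S) (hf : IntegrableOn f S) :
    IntegrableOn (D.avg k f) S :=
  ⟨(isCubewiseConst_avg k f).stronglyMeasurable.aestronglyMeasurable,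
    (setLIntegral_enorm_avg_le f hS).trans_lt hf.2⟩

theorem locallyIntegrable_avg {f : EuclideanSpace ℝ (Fin d) → F} (hf : LocallyIntegrable f)
    (k : ℤ) : LocallyIntegrable (D.avg k f) := by
  refine locallyIntegrable_iff.2 fun K hK => ?_
  exact (integrableOn_avg (isUnionOfCubes_cubeHull k K) (integrableOn_of_isBounded hf
    (isBounded_cubeHull k hK.isBounded))).mono_set (subset_cubeHull k K)

theorem integrable_avg {f : EuclideanSpace ℝ (Fin d) → F} (hf : Integrable f) (k : ℤ) :
    Integrable (D.avg k f) := by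
  rw [← integrableOn_univ] at hf ⊢
  exact integrableOn_avg (IsUnionOfCubes.univ k) hf

theorem setIntegral_cubeAt_avg [CompleteSpace F] (f : EuclideanSpace ℝ (Fin d) → F) (k : ℤ)
    (x : EuclideanSpace ℝ (Fin d)) :
    ∫ y in D.cubeAt k x, D.avg k f y = ∫ y in D.cubeAt k x, f y := by
  rw [setIntegral_congr_fun (g := fun _ => D.avg k f x) (D.measurableSet_cubeAt k x)
    (isCubewiseConst_avg k f x), setIntegral_const, avg_eq,
    smul_inv_smul₀ (D.volume_real_cubeAt_pos k x).ne']

theorem setIntegral_avg [CompleteSpace F] {f : EuclideanSpace ℝ (Fin d) → F} {k : ℤ}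
    {S : Set (EuclideanSpace ℝ (Fin d))} (hS : D.IsUnionOfCubes k S) (hf : IntegrableOn f S) :
    ∫ y in S, D.avg k f y = ∫ y in S, f y :=
  hS.setIntegral_congr (integrableOn_avg hS hf) hf fun x _ => setIntegral_cubeAt_avg f k x

theorem integral_avg [CompleteSpace F] {f : EuclideanSpace ℝ (Fin d) → F} (hf : Integrable f)
    (k : ℤ) : ∫ y, D.avg k f y = ∫ y, f y := by
  rw [← setIntegral_univ, setIntegral_avg (IsUnionOfCubes.univ k) hf.integrableOn, setIntegral_univ]

theorem avg_avg_of_le [CompleteSpace F] {f : EuclideanSpace ℝ (Fin d) → F}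
    (hf : LocallyIntegrable f) {j k : ℤ} (h : j ≤ k) : D.avg j (D.avg k f) = D.avg j f := by
  ext x
  rw [avg_eq, avg_eq, setIntegral_avg ((isUnionOfCubes_cubeAt j x).mono h)
    (integrableOn_cubeAt hf j x)]

theorem avg_avg_of_ge [CompleteSpace F] (f : EuclideanSpace ℝ (Fin d) → F) {j k : ℤ} (h : k ≤ j) :
    D.avg j (D.avg k f) = D.avg k f :=
  ((isCubewiseConst_avg k f).mono h).avg_eq_self

section PullOut

variable {𝕜 : Type*} [RCLike 𝕜] [NormedSpace 𝕜 F] [NormedSpace 𝕜 G] [CompleteSpace F]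
  [CompleteSpace G]

/-- The pull-out property of conditional expectations, for operator-valued factors: on each cube the
factor is a single continuous linear map, and this commutes with the integral. -/
theorem avg_clm_apply {k : ℤ} {φ : EuclideanSpace ℝ (Fin d) → F →L[𝕜] G}
    (hφ : D.IsCubewiseConst k φ) {w : EuclideanSpace ℝ (Fin d) → F} (hw : LocallyIntegrable w) :
    D.avg k (fun x => φ x (w x)) = fun x => φ x (D.avg k w x) := by
  ext x
  rw [avg_congr_on_cube (g := fun y => φ x (w y)) fun y hy => by rw [hφ x y hy], avg_eq, avg_eq,
    (φ x).integral_comp_comm (integrableOn_cubeAt hw k x)]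
  exact (map_real_smul (φ x) (φ x).continuous _ _).symm

end PullOut

theorem norm_avg_le {f : EuclideanSpace ℝ (Fin d) → F} (hf : Integrable f) (k : ℤ)
    (x : EuclideanSpace ℝ (Fin d)) :
    ‖D.avg k f x‖ ≤ (((2 : ℝ) ^ (-k)) ^ d)⁻¹ * ∫ y, ‖f y‖ := by
  rw [avg_eq, volume_real_cubeAt, norm_smul, Real.norm_of_nonneg (by positivity)]
  gcongr
  exact (norm_integral_le_integral_norm _).trans
    (setIntegral_le_integral hf.norm (Eventually.of_forall fun _ => norm_nonneg _))

theorem norm_avg_le_avg_norm (f : EuclideanSpace ℝ (Fin d) → F) (k : ℤ)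
    (x : EuclideanSpace ℝ (Fin d)) :
    ‖D.avg k f x‖ ≤ D.avg k (fun y => ‖f y‖) x := by
  rw [avg_eq, avg_eq, norm_smul, Real.norm_of_nonneg (by positivity), smul_eq_mul]
  gcongr
  exact norm_integral_le_integral_norm _

end Averages

/-! ### Dyadic step functions -/

/-- `f` is constant on the cubes of generation `k` and has bounded support. -/
structure IsStep {d : ℕ} {A : Type*} [Zero A] (D : DyadicSystem d) (k : ℤ)
    (f : EuclideanSpace ℝ (Fin d) → A) : Prop where
  const : D.IsCubewiseConst k f
  bounded : Bornology.IsBounded (Function.support f)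

section Step

variable {d : ℕ} {D : DyadicSystem d} {F G H : Type*} [NormedAddCommGroup F]
  [NormedAddCommGroup G] [NormedAddCommGroup H] {k : ℤ}

theorem IsStep.mono {A : Type*} [Zero A] {f : EuclideanSpace ℝ (Fin d) → A} {j : ℤ}
    (hf : D.IsStep j f) (h : j ≤ k) : D.IsStep k f := ⟨hf.const.mono h, hf.bounded⟩

theorem IsStep.comp {A B : Type*} [Zero A] [Zero B] {f : EuclideanSpace ℝ (Fin d) → A}
    (hf : D.IsStep k f) (φ : A → B) (hφ : φ 0 = 0) :
    D.IsStep k (fun x => φ (f x)) := by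
  refine ⟨fun x y hy => by rw [hf.const x y hy], hf.bounded.subset fun x hx h => hx ?_⟩
  simp only [h, hφ]

theorem IsStep.comp₂ {A B C : Type*} [Zero A] [Zero B] [Zero C]
    {f : EuclideanSpace ℝ (Fin d) → A} {g : EuclideanSpace ℝ (Fin d) → B} (hf : D.IsStep k f)
    (hg : D.IsStep k g) (φ : A → B → C) (hφ : φ 0 0 = 0) :
    D.IsStep k (fun x => φ (f x) (g x)) := by
  refine ⟨fun x y hy => by rw [hf.const x y hy, hg.const x y hy],
    (hf.bounded.union hg.bounded).subset fun x hx => ?_⟩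
  by_contra h
  simp only [Set.mem_union, Function.mem_support, not_or, not_not] at h
  exact hx (by simp only [h.1, h.2, hφ])

theorem IsStep.zero {A : Type*} [Zero A] : D.IsStep k (0 : EuclideanSpace ℝ (Fin d) → A) :=
  ⟨fun _ _ _ => rfl, by simp⟩

theorem IsStep.add {f g : EuclideanSpace ℝ (Fin d) → F} (hf : D.IsStep k f) (hg : D.IsStep k g) :
    D.IsStep k (f + g) := hf.comp₂ hg (· + ·) (add_zero 0)

theorem IsStep.sub {f g : EuclideanSpace ℝ (Fin d) → F} (hf : D.IsStep k f) (hg : D.IsStep k g) :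
    D.IsStep k (f - g) := hf.comp₂ hg (· - ·) (sub_zero 0)

theorem IsStep.norm {f : EuclideanSpace ℝ (Fin d) → F} (hf : D.IsStep k f) :
    D.IsStep k (fun x => ‖f x‖) := hf.comp _ norm_zero

theorem IsStep.sum {ι : Type*} (s : Finset ι) {f : ι → EuclideanSpace ℝ (Fin d) → F}
    (hf : ∀ i ∈ s, D.IsStep k (f i)) : D.IsStep k (∑ i ∈ s, f i) :=
  Finset.sum_induction _ _ (fun _ _ => IsStep.add) IsStep.zero hf

/-- Cubes of one generation are disjoint and have the same positive volume, so only finitely many of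
them fit into a bounded set. -/
theorem IsStep.finite_range {A : Type*} [Zero A] {f : EuclideanSpace ℝ (Fin d) → A}
    (hf : D.IsStep k f) : (Set.range f).Finite := by
  set S := D.cubeHull k (Function.support f)
  have hfin : Finite {Q : D.cubes k // Q.1 ⊆ S} := by
    rcases isEmpty_or_nonempty {Q : D.cubes k // Q.1 ⊆ S} with h | ⟨⟨Q₀⟩⟩
    · infer_instance
    obtain ⟨x₀, hx₀⟩ := D.exists_eq_cubeAt Q₀.1.2
    have := Measure.finite_const_le_meas_of_disjoint_iUnion volume
      (ε := volume (D.cubeAt k x₀)) (pos_iff_ne_zero.2 (D.volume_cubeAt_ne_zero k x₀))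
      (fun Q : {Q : D.cubes k // Q.1 ⊆ S} => measurableSet_of_mem_cubes Q.1.2)
      (pairwise_disjoint_cubes k S)
      (by
        rw [(isUnionOfCubes_cubeHull k _).iUnion_eq]
        exact (isBounded_cubeHull k hf.bounded).measure_lt_top.ne)
    refine Set.finite_univ_iff.1 (this.subset fun Q _ => ?_)
    obtain ⟨x, hx⟩ := D.exists_eq_cubeAt Q.1.2
    rw [Set.mem_ofPred_eq, hx, volume_cubeAt, volume_cubeAt]
  refine ((Set.finite_singleton (0 : A)).union (Set.finite_range
    fun Q : {Q : D.cubes k // Q.1 ⊆ S} => f (D.cubes_nonempty Q.1.2).some)).subset ?_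
  rintro _ ⟨x, rfl⟩
  by_cases hx : f x = 0
  · exact Or.inl hx
  · refine Or.inr ⟨⟨⟨_, D.cubeAt_mem k x⟩,
      isUnionOfCubes_cubeHull k _ x (subset_cubeHull k _ hx)⟩, ?_⟩
    exact hf.const x _ (D.cubes_nonempty (D.cubeAt_mem k x)).some_mem

theorem IsStep.exists_bound {f : EuclideanSpace ℝ (Fin d) → F} (hf : D.IsStep k f) :
    ∃ C, 0 ≤ C ∧ ∀ x, ‖f x‖ ≤ C := by
  obtain ⟨C, hC⟩ := hf.finite_range.isBounded.exists_norm_le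
  exact ⟨C, (norm_nonneg _).trans (hC _ ⟨0, rfl⟩), fun x => hC _ ⟨x, rfl⟩⟩

theorem memLp_of_bound_of_isBounded_support {f : EuclideanSpace ℝ (Fin d) → F}
    (hf : AEStronglyMeasurable f) (hb : Bornology.IsBounded (Function.support f)) {C : ℝ}
    (hC : ∀ x, ‖f x‖ ≤ C) (p : ℝ≥0∞) : MemLp f p := by
  obtain ⟨R, hR⟩ := hb.subset_closedBall 0
  rw [← Set.indicator_eq_self.2 hR, memLp_indicator_iff_restrict Metric.isClosed_closedBall.measurableSet]
  have : IsFiniteMeasure (volume.restrict (Metric.closedBall (0 : EuclideanSpace ℝ (Fin d)) R)) :=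
    ⟨by simpa using Metric.isBounded_closedBall.measure_lt_top⟩
  exact MemLp.of_bound hf.restrict C (Eventually.of_forall hC)

theorem IsStep.stronglyMeasurable {f : EuclideanSpace ℝ (Fin d) → F} (hf : D.IsStep k f) :
    StronglyMeasurable f := hf.const.stronglyMeasurable

theorem IsStep.memLp {f : EuclideanSpace ℝ (Fin d) → F} (hf : D.IsStep k f) (p : ℝ≥0∞) :
    MemLp f p := by
  obtain ⟨C, -, hC⟩ := hf.exists_bound
  exact memLp_of_bound_of_isBounded_support hf.stronglyMeasurable.aestronglyMeasurable hf.bounded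
    hC p

theorem IsStep.integrable {f : EuclideanSpace ℝ (Fin d) → F} (hf : D.IsStep k f) :
    Integrable f := memLp_one_iff_integrable.1 (hf.memLp 1)

theorem IsStep.locallyIntegrable {f : EuclideanSpace ℝ (Fin d) → F} (hf : D.IsStep k f) :
    LocallyIntegrable f := hf.integrable.locallyIntegrable

theorem IsStep.avg [NormedSpace ℝ F] {f : EuclideanSpace ℝ (Fin d) → F} {j : ℤ}
    (hf : Bornology.IsBounded (Function.support f)) : D.IsStep j (D.avg j f) :=
  ⟨isCubewiseConst_avg j f, (isBounded_cubeHull j hf).subset (support_avg_subset j f)⟩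

theorem integral_avg_mul_of_const {k : ℤ} {f g : EuclideanSpace ℝ (Fin d) → ℝ}
    (hg : D.IsCubewiseConst k g) (hf : LocallyIntegrable f)
    (hfg : Integrable fun x => g x * f x) : ∫ x, g x * D.avg k f x = ∫ x, g x * f x := by
  have := avg_clm_apply (D := D) (k := k) (𝕜 := ℝ)
    (φ := fun x => g x • ContinuousLinearMap.id ℝ ℝ)
    (fun x y hy => by simp only [hg x y hy]) hf
  simp only [_root_.smul_apply, ContinuousLinearMap.id_apply, smul_eq_mul] at this
  rw [← this, integral_avg hfg]

variable {𝕜 : Type*} [RCLike 𝕜] [NormedSpace 𝕜 F] [NormedSpace 𝕜 G]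

theorem IsStep.integrable_clm_apply {φ : EuclideanSpace ℝ (Fin d) → F →L[𝕜] G}
    (hφ : D.IsStep k φ) {w : EuclideanSpace ℝ (Fin d) → F} (hw : LocallyIntegrable w) :
    Integrable fun x => φ x (w x) := by
  obtain ⟨C, hC0, hC⟩ := hφ.exists_bound
  obtain ⟨R, hR⟩ := hφ.bounded.subset_closedBall 0
  have hsupp : Function.support (fun x => φ x (w x)) ⊆ Metric.closedBall 0 R :=
    fun x hx => hR fun h => hx (by simp [h])
  rw [← integrableOn_iff_integrable_of_support_subset hsupp]
  have hw' : IntegrableOn w (Metric.closedBall 0 R) :=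
    integrableOn_of_isBounded hw Metric.isBounded_closedBall
  refine Integrable.mono' (hw'.norm.const_mul C) ?_ (Eventually.of_forall fun x => ?_)
  · exact (ContinuousLinearMap.id 𝕜 (F →L[𝕜] G)).aestronglyMeasurable_comp₂
      hφ.stronglyMeasurable.aestronglyMeasurable.restrict hw'.1
  · exact ((φ x).le_opNorm _).trans (by gcongr; exact hC x)

theorem IsStep.integral_clm_apply_avg [NormedSpace ℝ F] [NormedSpace ℝ G] [CompleteSpace F]
    [CompleteSpace G] {φ : EuclideanSpace ℝ (Fin d) → F →L[𝕜] G}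
    (hφ : D.IsStep k φ) {w : EuclideanSpace ℝ (Fin d) → F} (hw : LocallyIntegrable w) :
    ∫ x, φ x (D.avg k w x) = ∫ x, φ x (w x) := by
  rw [← avg_clm_apply hφ.const hw, integral_avg (hφ.integrable_clm_apply hw)]

end Step

end DyadicSystem

/-! ### Limits of averages at fine and coarse scales -/

theorem eLpNorm_ofReal_eq_lintegral_rpow {α F : Type*} [MeasurableSpace α] {μ : Measure α}
    [NormedAddCommGroup F] (f : α → F) {p : ℝ} (hp : 0 < p) :
    eLpNorm f (ENNReal.ofReal p) μ = (∫⁻ x, ‖f x‖ₑ ^ p ∂μ) ^ (1 / p) := by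
  rw [eLpNorm_eq_lintegral_rpow_enorm_toReal (ENNReal.ofReal_pos.2 hp).ne' ENNReal.ofReal_ne_top,
    ENNReal.toReal_ofReal hp.le]

theorem eLpNorm_ofReal_rpow {α F : Type*} [MeasurableSpace α] {μ : Measure α}
    [NormedAddCommGroup F] (f : α → F) {p : ℝ} (hp : 0 < p) :
    eLpNorm f (ENNReal.ofReal p) μ ^ p = ∫⁻ x, ‖f x‖ₑ ^ p ∂μ := by
  rw [eLpNorm_ofReal_eq_lintegral_rpow f hp, one_div, ENNReal.rpow_inv_rpow hp.ne']

theorem tendsto_eLpNorm_zero_of_lintegral {α F : Type*} [MeasurableSpace α] {μ : Measure α}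
    [NormedAddCommGroup F] {f : ℕ → α → F} {p : ℝ} (hp : 0 < p)
    (h : Tendsto (fun n => ∫⁻ x, ‖f n x‖ₑ ^ p ∂μ) atTop (𝓝 0)) :
    Tendsto (fun n => eLpNorm (f n) (ENNReal.ofReal p) μ) atTop (𝓝 0) := by
  simp_rw [fun n => eLpNorm_ofReal_eq_lintegral_rpow (μ := μ) (f n) hp]
  have := (ENNReal.continuous_rpow_const (y := 1 / p)).tendsto 0
  rw [ENNReal.zero_rpow_of_pos (by positivity)] at this
  exact this.comp h

namespace DyadicSystem

section Limits

variable {d : ℕ} {D : DyadicSystem d} {F : Type*} [NormedAddCommGroup F] [NormedSpace ℝ F]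

/-- Lebesgue differentiation: the cube of generation `n` around `x` lies in a ball around `x` whose
volume is a fixed multiple of that of the cube, so the cube mean of `‖f - f x‖` is at most a
constant times its ball mean. -/
theorem ae_tendsto_avg [CompleteSpace F] (hd : 0 < d) {f : EuclideanSpace ℝ (Fin d) → F}
    (hf : LocallyIntegrable f) :
    ∀ᵐ x, Tendsto (fun n : ℕ => D.avg n f x) atTop (𝓝 (f x)) := by
  filter_upwards [IsUnifLocDoublingMeasure.ae_tendsto_average_norm_sub volume hf 1] with x hx
  set r : ℕ → ℝ := fun n => √d * (2 : ℝ) ^ (-(n : ℤ)) with hr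
  have hr0 : ∀ n, 0 < r n := fun n => by positivity
  have hrlim : Tendsto r atTop (𝓝[>] 0) := by
    refine tendsto_nhdsWithin_iff.2 ⟨?_, Eventually.of_forall hr0⟩
    have := (tendsto_pow_atTop_nhds_zero_of_lt_one (r := (1 / 2 : ℝ)) (by norm_num)
      (by norm_num)).const_mul (√d)
    rw [mul_zero] at this
    refine this.congr fun n => ?_
    simp [hr]
  have h0 := hx (fun _ => x) r hrlim (Eventually.of_forall fun n => by
    simpa using (hr0 n).le)
  -- The volume ratio of the ball of radius `√d 2^{-n}` to the cube of side `2^{-n}`, which is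
  -- independent of `n`.
  set c : ℝ := √d ^ d * volume.real (Metric.ball (0 : EuclideanSpace ℝ (Fin d)) 1) with hc
  have h1 := h0.const_mul c
  rw [mul_zero] at h1
  rw [tendsto_iff_norm_sub_tendsto_zero]
  refine squeeze_zero (fun _ => norm_nonneg _) (fun n => ?_) h1
  have hint : IntegrableOn (fun y => f y - f x) (D.cubeAt n x) :=
    (integrableOn_cubeAt hf n x).sub (integrableOn_const (D.volume_cubeAt_ne_top n x))
  have hint' : IntegrableOn (fun y => ‖f y - f x‖) (Metric.closedBall x (r n)) :=
    ((integrableOn_of_isBounded hf Metric.isBounded_closedBall).sub (integrableOn_const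
      Metric.isBounded_closedBall.measure_lt_top.ne)).norm
  have hvol : volume.real (Metric.closedBall x (r n)) = c * volume.real (D.cubeAt n x) := by
    rw [measureReal_def, Measure.addHaar_closedBall _ _ (hr0 n).le, volume_real_cubeAt, hc, hr,
      ENNReal.toReal_mul, ENNReal.toReal_ofReal (by positivity), finrank_euclideanSpace_fin,
      measureReal_def]
    ring
  have hcpos : 0 < c := by
    have : 0 < volume.real (Metric.closedBall x (r n)) :=
      ENNReal.toReal_pos (Metric.measure_closedBall_pos volume x (hr0 n)).ne'
        Metric.isBounded_closedBall.measure_lt_top.ne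
    rw [hvol] at this
    exact (pos_iff_pos_of_mul_pos this).2 (D.volume_real_cubeAt_pos n x)
  have hV := D.volume_real_cubeAt_pos n x
  have heq : D.avg n f x - f x = D.avg n (fun y => f y - f x) x := by
    rw [avg_eq, avg_eq, integral_sub (integrableOn_cubeAt hf n x)
      (integrableOn_const (D.volume_cubeAt_ne_top n x)), setIntegral_const, smul_sub,
      inv_smul_smul₀ hV.ne']
  calc ‖D.avg n f x - f x‖ ≤ D.avg n (fun y => ‖f y - f x‖) x := by
        rw [heq]
        exact norm_avg_le_avg_norm _ _ _
    _ ≤ c * ⨍ y in Metric.closedBall x (r n), ‖f y - f x‖ := by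
        rw [avg_eq, setAverage_eq, hvol, smul_eq_mul, smul_eq_mul, mul_inv, ← mul_assoc,
          ← mul_assoc, mul_inv_cancel₀ hcpos.ne', one_mul]
        gcongr
        · exact Eventually.of_forall fun _ => norm_nonneg _
        · exact fun y hy => D.dist_le_of_mem_cubeAt hy

theorem tendsto_inv_volume_atBot (hd : 0 < d) (m : ℤ) :
    Tendsto (fun n : ℕ => (((2 : ℝ) ^ (-(m - n))) ^ d)⁻¹) atTop (𝓝 0) := by
  have h := (tendsto_pow_atTop_nhds_zero_of_lt_one (r := (1 / 2 : ℝ) ^ d) (by positivity)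
      (pow_lt_one₀ (by norm_num) (by norm_num) hd.ne')).const_mul ((((2 : ℝ) ^ (-m)) ^ d)⁻¹)
  rw [mul_zero] at h
  refine h.congr fun n => ?_
  rw [neg_sub, sub_eq_neg_add, zpow_add₀ (by norm_num), mul_pow, mul_inv, zpow_natCast, ← pow_mul,
    ← pow_mul, mul_comm d n]
  simp

omit [NormedSpace ℝ F] in
theorem tendsto_norm_avg_bound (hd : 0 < d) (f : EuclideanSpace ℝ (Fin d) → F) (m : ℤ) :
    Tendsto (fun n : ℕ => (((2 : ℝ) ^ (-(m - n))) ^ d)⁻¹ * ∫ y, ‖f y‖) atTop (𝓝 0) := by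
  simpa using (tendsto_inv_volume_atBot hd m).mul_const (∫ y, ‖f y‖)

/-- Interpolation: `‖𝔼_k f‖_p^p ≤ ‖𝔼_k f‖_∞^{p-1} ‖f‖_1`, and the supremum is at most `‖f‖_1`
divided by the cube volume. It is here that `p > 1` matters. -/
theorem tendsto_eLpNorm_avg_atBot (hd : 0 < d) {f : EuclideanSpace ℝ (Fin d) → F}
    (hf : Integrable f) {p : ℝ} (hp : 1 < p) (m : ℤ) :
    Tendsto (fun n : ℕ => eLpNorm (D.avg (m - n) f) (ENNReal.ofReal p) volume) atTop (𝓝 0) := by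
  refine tendsto_eLpNorm_zero_of_lintegral (by linarith) ?_
  set c : ℕ → ℝ := fun n => (((2 : ℝ) ^ (-(m - n))) ^ d)⁻¹ * ∫ y, ‖f y‖
  have hc : Tendsto (fun n => ENNReal.ofReal (c n) ^ (p - 1) * ∫⁻ y, ‖f y‖ₑ) atTop (𝓝 0) := by
    have h1 := (ENNReal.tendsto_ofReal (tendsto_norm_avg_bound hd f m))
    have h2 := ((ENNReal.continuous_rpow_const (y := p - 1)).tendsto _).comp h1
    rw [ENNReal.ofReal_zero, ENNReal.zero_rpow_of_pos (by linarith)] at h2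
    have h3 := ENNReal.Tendsto.mul_const h2 (Or.inr hf.2.ne)
    rw [zero_mul] at h3
    exact h3
  refine tendsto_of_tendsto_of_tendsto_of_le_of_le tendsto_const_nhds hc (fun _ => zero_le) fun n => ?_
  calc ∫⁻ x, ‖D.avg (m - n) f x‖ₑ ^ p
      ≤ ∫⁻ x, ENNReal.ofReal (c n) ^ (p - 1) * ‖D.avg (m - n) f x‖ₑ := by
        refine lintegral_mono fun x => ?_
        have h : ‖D.avg (m - n) f x‖ₑ ≤ ENNReal.ofReal (c n) := by
          rw [← ofReal_norm]
          exact ENNReal.ofReal_le_ofReal (norm_avg_le hf _ _)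
        calc ‖D.avg (m - n) f x‖ₑ ^ p
            = ‖D.avg (m - n) f x‖ₑ ^ (p - 1) * ‖D.avg (m - n) f x‖ₑ := by
              conv_rhs => rw [← ENNReal.rpow_one (‖D.avg (m - n) f x‖ₑ), ← ENNReal.rpow_mul,
                ← ENNReal.rpow_add_of_nonneg _ _ (by linarith) zero_le_one]
              congr 1
              ring
          _ ≤ _ := by gcongr
    _ ≤ ENNReal.ofReal (c n) ^ (p - 1) * ∫⁻ y, ‖f y‖ₑ := by
        rw [lintegral_const_mul' _ _ (by finiteness)]
        refine mul_le_mul' le_rfl ?_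
        have := setLIntegral_enorm_avg_le f (IsUnionOfCubes.univ (D := D) (m - n))
        simpa using this

end Limits

/-! ### Test functions as mean-zero step functions; density -/

section TestFunctions

variable {d : ℕ} {D : DyadicSystem d} {F : Type*} [NormedAddCommGroup F] [NormedSpace ℝ F]
  [CompleteSpace F]

theorem avg_eq_zero_of_le {f : EuclideanSpace ℝ (Fin d) → F} (hf : LocallyIntegrable f) {m : ℤ}
    (h0 : D.avg m f = 0) {j : ℤ} (hj : j ≤ m) : D.avg j f = 0 := by
  rw [← avg_avg_of_le hf hj, h0, avg_zero]

theorem IsStep.isTestFunction {f : EuclideanSpace ℝ (Fin d) → F} {k m : ℤ} (hf : D.IsStep k f)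
    (h0 : D.avg m f = 0) (p : ℝ≥0∞) : D.IsTestFunction p f where
  memLp := hf.memLp p
  hasCompactSupport := hf.bounded.isCompact_closure
  finite_expansion := by
    refine (Set.finite_Ioc m k).subset fun j hj => ?_
    by_contra h
    refine hj ?_
    rw [Set.mem_Ioc, not_and_or, not_lt, not_le] at h
    rw [diff]
    rcases h with h | h
    · rw [avg_eq_zero_of_le hf.locallyIntegrable h0 h,
        avg_eq_zero_of_le hf.locallyIntegrable h0 (by lia), sub_zero]
    · rw [(hf.const.mono h.le).avg_eq_self, (hf.const.mono (by lia : k ≤ j - 1)).avg_eq_self,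
        sub_self]

omit [NormedSpace ℝ F] [CompleteSpace F] in
theorem integrable_of_memLp_of_isBounded_support {f : EuclideanSpace ℝ (Fin d) → F} {p : ℝ≥0∞}
    (hp : 1 ≤ p) (hf : MemLp f p) (hb : Bornology.IsBounded (Function.support f)) :
    Integrable f := by
  rw [← integrableOn_iff_integrable_of_support_subset subset_rfl]
  exact integrableOn_of_isBounded (hf.locallyIntegrable hp) hb

omit [CompleteSpace F] in
theorem IsTestFunction.integrable {f : EuclideanSpace ℝ (Fin d) → F} {p : ℝ≥0∞}
    (hf : D.IsTestFunction p f) (hp : 1 ≤ p) : Integrable f :=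
  integrable_of_memLp_of_isBounded_support hp hf.memLp
    (hf.hasCompactSupport.isBounded.subset (subset_tsupport f))

/-- Since only finitely many differences are nonzero, the averages are eventually constant in `k` in
both directions. Their value at coarse scales is zero because the cube volumes tend to infinity, and
their value at fine scales is `f` almost everywhere by differentiation. Test functions are thus, up
to null sets, mean-zero step functions. -/
theorem IsTestFunction.exists_levels (hd : 0 < d) {f : EuclideanSpace ℝ (Fin d) → F} {p : ℝ≥0∞}
    (hf : D.IsTestFunction p f) (hp : 1 ≤ p) :
    ∃ m N : ℤ, (∀ j ≤ m, D.avg j f = 0) ∧ ∀ j, N ≤ j → f =ᵐ[volume] D.avg j f := by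
  have hint := hf.integrable hp
  obtain ⟨N, hN⟩ := hf.finite_expansion.bddAbove
  obtain ⟨m, hm⟩ := hf.finite_expansion.bddBelow
  have hstep : ∀ j, D.diff j f = 0 → D.avg j f = D.avg (j - 1) f := fun j h => sub_eq_zero.1 h
  have hup : ∀ j, N ≤ j → D.avg j f = D.avg N f := fun j hj => by
    induction j, hj using Int.leInduction with
    | base => rfl
    | succ j hj ih =>
      rw [hstep (j + 1) (by_contra fun h => absurd (hN h) (by lia)), add_sub_cancel_right, ih]
  have hdown : ∀ n : ℕ, D.avg (m - 1 - n) f = D.avg (m - 1) f := fun n => by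
    induction n with
    | zero => simp
    | succ n ih =>
      rw [← ih, hstep (m - 1 - n) (by_contra fun h => absurd (hm h) (by lia))]
      congr 1
      push_cast
      ring
  refine ⟨m - 1, N, fun j hj => avg_eq_zero_of_le hint.locallyIntegrable ?_ hj, fun j hj => ?_⟩
  · ext x
    have := ge_of_tendsto' (b := ‖D.avg (m - 1) f x‖) (tendsto_norm_avg_bound hd f (m - 1))
      fun n => by
      rw [← hdown n]
      exact norm_avg_le hint _ x
    simpa using this
  · rw [hup j hj]
    filter_upwards [ae_tendsto_avg (D := D) hd hint.locallyIntegrable] with x hx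
    refine tendsto_nhds_unique hx (tendsto_const_nhds.congr' ?_)
    filter_upwards [eventually_ge_atTop N.toNat] with n hn
    rw [hup n (by lia)]

omit [CompleteSpace F] in
theorem norm_avg_le_of_bound {f : EuclideanSpace ℝ (Fin d) → F} {C : ℝ} (hC : ∀ x, ‖f x‖ ≤ C)
    (k : ℤ) (x : EuclideanSpace ℝ (Fin d)) : ‖D.avg k f x‖ ≤ C := by
  rw [avg_eq, norm_smul, norm_inv, Real.norm_of_nonneg measureReal_nonneg,
    inv_mul_le_iff₀ (D.volume_real_cubeAt_pos k x), mul_comm]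
  exact norm_setIntegral_le_of_norm_le_const (D.volume_cubeAt_ne_top k x).lt_top fun y _ => hC y

/-- Three errors of `ε / 3`: approximate by a continuous compactly supported `g`, replace `g` by
`𝔼_n g` for large `n`, and subtract a very coarse average, which makes the mean zero and is small in
`L^p`. -/
theorem exists_step_eLpNorm_sub_le (hd : 0 < d) {p : ℝ} (hp : 1 < p)
    {f : EuclideanSpace ℝ (Fin d) → F} (hf : MemLp f (ENNReal.ofReal p)) {ε : ℝ≥0∞} (hε : ε ≠ 0) :
    ∃ (s : EuclideanSpace ℝ (Fin d) → F) (k m : ℤ), D.IsStep k s ∧ D.avg m s = 0 ∧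
      eLpNorm (f - s) (ENNReal.ofReal p) volume ≤ ε := by
  have hp1 : 1 ≤ ENNReal.ofReal p := by simpa using ENNReal.ofReal_le_ofReal hp.le
  have hε3 : ε / 3 ≠ 0 := by simpa using hε
  obtain ⟨g, hgc, hfg, hgcont, hgp⟩ :=
    hf.exists_hasCompactSupport_eLpNorm_sub_le ENNReal.ofReal_ne_top hε3
  obtain ⟨C, hC⟩ := hgc.exists_bound_of_continuous hgcont
  have hC0 : 0 ≤ C := (norm_nonneg _).trans (hC 0)
  have hgb : Bornology.IsBounded (Function.support g) :=
    hgc.isBounded.subset (subset_tsupport g)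
  -- One bounded set that contains the supports of all `𝔼_n g` with `n ≥ 0`, so that a constant
  -- multiple of its indicator dominates.
  set S := D.cubeHull 0 (Function.support g) with hS
  have hSb : Bornology.IsBounded S := isBounded_cubeHull 0 hgb
  have hlim : Tendsto (fun n : ℕ => eLpNorm (g - D.avg n g) (ENNReal.ofReal p) volume) atTop
      (𝓝 0) := by
    refine tendsto_eLpNorm_zero_of_lintegral (by linarith) ?_
    have hz : ∫⁻ _ : EuclideanSpace ℝ (Fin d), (0 : ℝ≥0∞) = 0 := lintegral_zero
    rw [← hz]
    refine tendsto_lintegral_of_dominated_convergence'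
      (S.indicator fun _ => ENNReal.ofReal (C + C) ^ p) (fun n => ?_) (fun n => ?_) ?_ ?_
    · exact ((hgcont.stronglyMeasurable.sub
        (isCubewiseConst_avg _ g).stronglyMeasurable).enorm.pow_const _).aemeasurable
    · refine Eventually.of_forall fun x => ?_
      by_cases hx : x ∈ S
      · rw [Set.indicator_of_mem hx]
        beta_reduce
        rw [← ofReal_norm]
        have := (norm_sub_le (g x) (D.avg n g x)).trans
          (add_le_add (hC x) (norm_avg_le_of_bound hC _ x))
        gcongr
        exact this
      · have h1 : g x = 0 := by_contra fun h => hx (subset_cubeHull 0 _ h)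
        have h2 : D.avg n g x = 0 := by
          by_contra h
          obtain ⟨y, hy, hy'⟩ := support_avg_subset _ g h
          exact hx ⟨y, D.cubeAt_anti (by lia) x hy, hy'⟩
        have hp0 : 0 < p := by linarith
        simp [h1, h2, hp0]
    · rw [lintegral_indicator (isUnionOfCubes_cubeHull 0 _).measurableSet, setLIntegral_const]
      exact ENNReal.mul_ne_top (ENNReal.rpow_ne_top_of_nonneg (by linarith) ENNReal.ofReal_ne_top)
        hSb.measure_lt_top.ne
    · filter_upwards [ae_tendsto_avg (D := D) hd hgcont.locallyIntegrable] with x hx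
      have h := (tendsto_const_nhds (x := g x)).sub hx
      rw [sub_self] at h
      have := ((ENNReal.continuous_rpow_const (y := p)).tendsto _).comp h.enorm
      rw [enorm_zero, ENNReal.zero_rpow_of_pos (by linarith)] at this
      exact this
  obtain ⟨n, hn⟩ := (hlim.eventually_le_const (pos_iff_ne_zero.2 hε3)).exists
  have hs : D.IsStep n (D.avg n g) := IsStep.avg hgb
  obtain ⟨l, hl⟩ := ((tendsto_eLpNorm_avg_atBot (D := D) hd hs.integrable hp 0).eventually_le_const
    (pos_iff_ne_zero.2 hε3)).exists
  have ha : D.IsStep n (D.avg (0 - l) (D.avg n g)) := (IsStep.avg hs.bounded).mono (by lia)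
  refine ⟨D.avg n g - D.avg (0 - l) (D.avg n g), n, 0 - l, hs.sub ha, ?_, ?_⟩
  · rw [avg_sub _ hs.locallyIntegrable ha.locallyIntegrable, avg_avg_of_ge _ le_rfl, sub_self]
  · have h1 : f - (D.avg n g - D.avg (0 - l) (D.avg n g))
        = (f - g) + ((g - D.avg n g) + D.avg (0 - l) (D.avg n g)) := by abel
    have hm1 : AEStronglyMeasurable (g - D.avg n g) volume :=
      hgcont.aestronglyMeasurable.sub hs.stronglyMeasurable.aestronglyMeasurable
    rw [h1]
    refine (eLpNorm_add_le (hf.1.sub hgp.1) (hm1.add ha.stronglyMeasurable.aestronglyMeasurable)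
      hp1).trans ?_
    refine (add_le_add hfg ((eLpNorm_add_le hm1 ha.stronglyMeasurable.aestronglyMeasurable
      hp1).trans (add_le_add hn hl))).trans ?_
    rw [← add_assoc, ENNReal.add_thirds]

end TestFunctions

end DyadicSystem

/-! ### Hölder's inequality, norming pairings and the converse of Hölder's inequality -/

theorem lintegral_enorm_mul_le_eLpNorm_mul_eLpNorm {α F G : Type*} [MeasurableSpace α]
    {μ : Measure α} [NormedAddCommGroup F] [NormedAddCommGroup G] {p q : ℝ}
    (hpq : p.HolderConjugate q) {f : α → F} {g : α → G} (hf : AEStronglyMeasurable f μ)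
    (hg : AEStronglyMeasurable g μ) :
    ∫⁻ x, ‖f x‖ₑ * ‖g x‖ₑ ∂μ
      ≤ eLpNorm f (ENNReal.ofReal p) μ * eLpNorm g (ENNReal.ofReal q) μ := by
  rw [eLpNorm_ofReal_eq_lintegral_rpow f hpq.pos, eLpNorm_ofReal_eq_lintegral_rpow g hpq.symm.pos]
  exact ENNReal.lintegral_mul_le_Lp_mul_Lq μ hpq hf.enorm hg.enorm

/-- Division by `I ^ (1 / q)`, which is legitimate only because `I` is known to be finite. It
concludes both the converse Hölder inequality and Doob's inequality. -/
theorem rpow_one_div_le_of_le_mul_rpow {p q : ℝ} (hpq : p.HolderConjugate q) {I A : ℝ≥0∞}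
    (hI : I ≠ ∞) (h : I ≤ A * I ^ (1 / q)) : I ^ (1 / p) ≤ A := by
  rcases eq_or_ne I 0 with h0 | h0
  · rw [h0, ENNReal.zero_rpow_of_pos (by have := hpq.pos; positivity)]
    exact zero_le
  · have h5 : I = I ^ (1 / p) * I ^ (1 / q) := by
      rw [← ENNReal.rpow_add _ _ h0 hI, one_div, one_div, hpq.inv_add_inv_eq_one,
        ENNReal.rpow_one]
    have h6 : I ^ (1 / p) * I ^ (1 / q) ≤ A * I ^ (1 / q) := by rwa [← h5]
    exact (ENNReal.mul_le_mul_iff_left (ENNReal.rpow_pos (pos_iff_ne_zero.2 h0) hI).ne'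
      (ENNReal.rpow_ne_top_of_nonneg (by have := hpq.symm.pos; positivity) hI)).1 h6

/-- `B` is a contractive pairing for which the unit ball of `V` norms `U`. -/
structure IsNormingPairing {𝕜 U V : Type*} [RCLike 𝕜] [NormedAddCommGroup U] [NormedSpace 𝕜 U]
    [NormedAddCommGroup V] [NormedSpace 𝕜 V] (B : V →L[𝕜] StrongDual 𝕜 U) : Prop where
  norm_le : ∀ v u, ‖B v u‖ ≤ ‖v‖ * ‖u‖
  exists_le : ∀ u, ∀ δ < (1 : ℝ), 0 < δ → ∃ v, ‖v‖ ≤ 1 ∧ δ * ‖u‖ ≤ RCLike.re (B v u)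

section NormingPairing

variable {𝕜 U : Type*} [RCLike 𝕜] [NormedAddCommGroup U] [NormedSpace 𝕜 U]

theorem isNormingPairing_id :
    IsNormingPairing (ContinuousLinearMap.id 𝕜 (StrongDual 𝕜 U)) where
  norm_le v u := v.le_opNorm u
  exists_le u δ hδ _ := by
    obtain ⟨v, hv, hvu⟩ := exists_dual_vector'' 𝕜 u
    refine ⟨v, hv, ?_⟩
    rw [ContinuousLinearMap.id_apply, hvu, RCLike.ofReal_re]
    exact mul_le_of_le_one_left (norm_nonneg _) hδ.le

/-- A functional need not attain its norm on the unit ball; this is why norming pairings involve a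
factor `δ < 1`. -/
theorem isNormingPairing_inclusionInDoubleDual :
    IsNormingPairing (NormedSpace.inclusionInDoubleDual 𝕜 U) where
  norm_le v u := by
    rw [NormedSpace.dual_def, mul_comm]
    exact u.le_opNorm v
  exists_le u δ hδ _ := by
    rcases eq_or_ne u 0 with rfl | hu
    · exact ⟨0, by simp, by simp⟩
    have : δ * ‖u‖ < ‖u‖ := mul_lt_of_lt_one_left (norm_pos_iff.2 hu) hδ
    obtain ⟨x, hx, hux⟩ := u.exists_lt_apply_of_lt_opNorm this
    -- A unimodular rotation of `x` makes the value real and nonnegative.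
    obtain ⟨c, hc, hcx⟩ := RCLike.exists_norm_eq_mul_self (u x)
    refine ⟨c • x, by rw [norm_smul, hc, one_mul]; exact hx.le, ?_⟩
    rw [NormedSpace.dual_def, map_smul, smul_eq_mul, ← hcx, RCLike.ofReal_re]
    exact hux.le

end NormingPairing

namespace DyadicSystem

section Pairing

variable {d : ℕ} {D : DyadicSystem d} {𝕜 : Type*} [RCLike 𝕜]
  {U : Type*} [NormedAddCommGroup U] [NormedSpace ℝ U] [NormedSpace 𝕜 U] [CompleteSpace U]
  {V : Type*} [NormedAddCommGroup V] [NormedSpace ℝ V] [NormedSpace 𝕜 V] [CompleteSpace V]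
  (B : V →L[𝕜] StrongDual 𝕜 U)

omit [NormedSpace ℝ U] [CompleteSpace U] [NormedSpace ℝ V] [CompleteSpace V] in
theorem IsStep.integrable_pairing {k : ℤ} {v : EuclideanSpace ℝ (Fin d) → V} (hv : D.IsStep k v)
    {u : EuclideanSpace ℝ (Fin d) → U} (hu : LocallyIntegrable u) :
    Integrable fun x => B (v x) (u x) :=
  (hv.comp B (map_zero B)).integrable_clm_apply hu

omit [CompleteSpace V] [NormedSpace ℝ V] in
theorem IsStep.integral_pairing_avg {k : ℤ} {v : EuclideanSpace ℝ (Fin d) → V}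
    (hv : D.IsStep k v) {u : EuclideanSpace ℝ (Fin d) → U} (hu : LocallyIntegrable u) :
    ∫ x, B (v x) (D.avg k u x) = ∫ x, B (v x) (u x) :=
  (hv.comp B (map_zero B)).integral_clm_apply_avg hu

/-- The averaging operator is self-adjoint: both sides equal the pairing of the two averages. -/
theorem integral_pairing_avg_comm {v : EuclideanSpace ℝ (Fin d) → V}
    {u : EuclideanSpace ℝ (Fin d) → U} (hv : LocallyIntegrable v) (hu : LocallyIntegrable u)
    (hvb : Bornology.IsBounded (Function.support v))
    (hub : Bornology.IsBounded (Function.support u)) (j : ℤ) :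
    ∫ x, B (D.avg j v x) (u x) = ∫ x, B (v x) (D.avg j u x) := by
  have h1 : ∫ x, B (D.avg j v x) (D.avg j u x) = ∫ x, B (D.avg j v x) (u x) :=
    (IsStep.avg hvb).integral_pairing_avg B hu
  have h2 : ∫ x, B.flip (D.avg j u x) (D.avg j v x) = ∫ x, B.flip (D.avg j u x) (v x) :=
    (IsStep.avg hub).integral_pairing_avg B.flip hv
  simp only [ContinuousLinearMap.flip_apply] at h2
  rw [← h1, h2]

omit [NormedSpace ℝ U] [CompleteSpace U] [NormedSpace ℝ V] [CompleteSpace V] in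
theorem enorm_integral_pairing_le {B : V →L[𝕜] StrongDual 𝕜 U} (hB : IsNormingPairing B)
    {p q : ℝ} (hpq : p.HolderConjugate q)
    {v : EuclideanSpace ℝ (Fin d) → V} {u : EuclideanSpace ℝ (Fin d) → U}
    (hv : AEStronglyMeasurable v) (hu : AEStronglyMeasurable u) :
    ‖∫ x, B (v x) (u x)‖ₑ
      ≤ eLpNorm v (ENNReal.ofReal p) volume * eLpNorm u (ENNReal.ofReal q) volume := by
  refine (enorm_integral_le_lintegral_enorm _).trans ((lintegral_mono fun x => ?_).trans
    (lintegral_enorm_mul_le_eLpNorm_mul_eLpNorm hpq hv hu))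
  rw [← ofReal_norm, ← ofReal_norm, ← ofReal_norm, ← ENNReal.ofReal_mul (norm_nonneg _)]
  exact ENNReal.ofReal_le_ofReal (hB.norm_le _ _)

omit [NormedSpace ℝ U] [CompleteSpace U] in
-- Removes the mean-zero restriction on the tests: subtract from `v` its average at generation `k -
-- l`. As `l → ∞`, both the `L^q` norm of this correction and its pairing with `w` vanish.
theorem enorm_integral_pairing_le_of_mean_zero {B : V →L[𝕜] StrongDual 𝕜 U}
    (hB : IsNormingPairing B) (hd : 0 < d) {q : ℝ} (hq : 1 < q)
    {w : EuclideanSpace ℝ (Fin d) → U} {k : ℤ} (hw : D.IsStep k w) {a : ℝ}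
    (h : ∀ (v : EuclideanSpace ℝ (Fin d) → V) (m : ℤ), D.IsStep k v → D.avg m v = 0 →
      ‖∫ x, B (v x) (w x)‖ₑ ≤ ENNReal.ofReal a * eLpNorm v (ENNReal.ofReal q) volume)
    {v : EuclideanSpace ℝ (Fin d) → V} (hv : D.IsStep k v) :
    ‖∫ x, B (v x) (w x)‖ₑ ≤ ENNReal.ofReal a * eLpNorm v (ENNReal.ofReal q) volume := by
  have hq1 : 1 ≤ ENNReal.ofReal q := by simpa using ENNReal.ofReal_le_ofReal hq.le
  have ha : ∀ l : ℕ, D.IsStep k (D.avg (k - l) v) := fun l =>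
    (IsStep.avg hv.bounded).mono (by lia)
  have h0 : Tendsto (fun l : ℕ => ∫ x, B (D.avg (k - l) v x) (w x)) atTop (𝓝 0) := by
    refine squeeze_zero_norm (a := fun l : ℕ => ((((2 : ℝ) ^ (-(k - l))) ^ d)⁻¹ *
      ∫ y, ‖v y‖) * ∫ y, ‖w y‖) (fun l => ?_) ?_
    · rw [← integral_const_mul]
      refine norm_integral_le_of_norm_le (hw.integrable.norm.const_mul _)
        (Eventually.of_forall fun x => (hB.norm_le _ _).trans ?_)
      gcongr
      exact norm_avg_le hv.integrable _ x
    · simpa using (tendsto_norm_avg_bound hd v k).mul_const (∫ y, ‖w y‖)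
  have hL : Tendsto (fun l : ℕ => ‖(∫ x, B (v x) (w x)) - ∫ x, B (D.avg (k - l) v x) (w x)‖ₑ) atTop
      (𝓝 ‖(∫ x, B (v x) (w x)) - 0‖ₑ) := (tendsto_const_nhds.sub h0).enorm
  have hR : Tendsto (fun l : ℕ => ENNReal.ofReal a * (eLpNorm v (ENNReal.ofReal q) volume +
      eLpNorm (D.avg (k - l) v) (ENNReal.ofReal q) volume)) atTop
      (𝓝 (ENNReal.ofReal a * (eLpNorm v (ENNReal.ofReal q) volume + 0))) :=
    ENNReal.Tendsto.const_mul (tendsto_const_nhds.add (tendsto_eLpNorm_avg_atBot hd hv.integrable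
      hq k)) (Or.inr ENNReal.ofReal_ne_top)
  rw [sub_zero] at hL
  rw [add_zero] at hR
  refine le_of_tendsto_of_tendsto' hL hR fun l => ?_
  have h1 := h (v - D.avg (k - l) v) (k - l) (hv.sub (ha l)) (by
    rw [avg_sub _ hv.locallyIntegrable (ha l).locallyIntegrable, avg_avg_of_ge _ le_rfl, sub_self])
  simp only [Pi.sub_apply, map_sub, _root_.sub_apply] at h1
  rw [integral_sub (hv.integrable_pairing B hw.locallyIntegrable)
    ((ha l).integrable_pairing B hw.locallyIntegrable)] at h1
  refine h1.trans ?_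
  gcongr
  exact eLpNorm_sub_le hv.stronglyMeasurable.aestronglyMeasurable
    (ha l).stronglyMeasurable.aestronglyMeasurable hq1

omit [NormedSpace ℝ U] [CompleteSpace U] in
-- The extremal test is `‖w‖^{p-1} ψ(w)` with `ψ(w)` almost norming `w`. The choice of `ψ` raises no
-- measurability question, since any function of a step function that vanishes at zero is a step
-- function.
theorem IsStep.eLpNorm_le_of_pairing {B : V →L[𝕜] StrongDual 𝕜 U} (hB : IsNormingPairing B)
    (hd : 0 < d) {p q : ℝ} (hpq : p.HolderConjugate q) {w : EuclideanSpace ℝ (Fin d) → U} {k : ℤ}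
    (hw : D.IsStep k w) {a : ℝ}
    (h : ∀ (v : EuclideanSpace ℝ (Fin d) → V) (m : ℤ), D.IsStep k v → D.avg m v = 0 →
      ‖∫ x, B (v x) (w x)‖ₑ ≤ ENNReal.ofReal a * eLpNorm v (ENNReal.ofReal q) volume) :
    eLpNorm w (ENNReal.ofReal p) volume ≤ ENNReal.ofReal a := by
  set I := ∫⁻ x, ‖w x‖ₑ ^ p with hI
  have hIr : ENNReal.ofReal (∫ x, ‖w x‖ ^ p) = I := by
    rw [ofReal_integral_eq_lintegral_ofReal
      (hw.comp (‖·‖ ^ p) (by simp [hpq.ne_zero])).integrable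
      (Eventually.of_forall fun x => by positivity)]
    refine lintegral_congr fun x => ?_
    rw [← ENNReal.ofReal_rpow_of_nonneg (norm_nonneg _) hpq.nonneg, ofReal_norm]
  have hItop : I ≠ ∞ := hIr ▸ ENNReal.ofReal_ne_top
  have key : ∀ δ : ℝ, δ < 1 → 0 < δ → ENNReal.ofReal δ * I ≤ ENNReal.ofReal a * I ^ (1 / q) := by
    intro δ hδ1 hδ0
    choose ψ hψ1 hψ using fun u => hB.exists_le u δ hδ1 hδ0
    set v : EuclideanSpace ℝ (Fin d) → V := fun x => ((‖w x‖ ^ (p - 1) : ℝ) : 𝕜) • ψ (w x)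
    have hv : D.IsStep k v := hw.comp (fun u => ((‖u‖ ^ (p - 1) : ℝ) : 𝕜) • ψ u)
      (by simp [Real.zero_rpow hpq.sub_one_ne_zero])
    have h1 := enorm_integral_pairing_le_of_mean_zero hB hd hpq.symm.lt hw h hv
    have h2 : eLpNorm v (ENNReal.ofReal q) volume ≤ I ^ (1 / q) := by
      rw [eLpNorm_ofReal_eq_lintegral_rpow v hpq.symm.pos]
      refine ENNReal.rpow_le_rpow (lintegral_mono fun x => ?_) (by
        have := hpq.symm.pos
        positivity)
      rw [← ofReal_norm, ← ofReal_norm, ENNReal.ofReal_rpow_of_nonneg (norm_nonneg _)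
        hpq.symm.nonneg, ENNReal.ofReal_rpow_of_nonneg (norm_nonneg _) hpq.nonneg]
      refine ENNReal.ofReal_le_ofReal ?_
      have h3 : ‖v x‖ ≤ ‖w x‖ ^ (p - 1) := by
        rw [norm_smul, RCLike.norm_ofReal, abs_of_nonneg (by positivity)]
        exact mul_le_of_le_one_right (by positivity) (hψ1 _)
      calc ‖v x‖ ^ q ≤ (‖w x‖ ^ (p - 1)) ^ q :=
            Real.rpow_le_rpow (norm_nonneg _) h3 hpq.symm.nonneg
        _ = ‖w x‖ ^ p := by rw [← Real.rpow_mul (norm_nonneg _), hpq.sub_one_mul_conj]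
    have h4 : δ * ∫ x, ‖w x‖ ^ p ≤ ‖∫ x, B (v x) (w x)‖ := by
      refine le_trans ?_ (RCLike.re_le_norm _)
      rw [← integral_const_mul, ← integral_re (hv.integrable_pairing B hw.locallyIntegrable)]
      refine integral_mono ((hw.comp (‖·‖ ^ p) (by simp [hpq.ne_zero])).integrable.const_mul _)
        (hv.integrable_pairing B hw.locallyIntegrable).re fun x => ?_
      simp only [v, map_smul, _root_.smul_apply, smul_eq_mul, RCLike.re_ofReal_mul]
      calc δ * ‖w x‖ ^ p = ‖w x‖ ^ (p - 1) * (δ * ‖w x‖) := by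
            rcases eq_or_ne ‖w x‖ 0 with h0 | h0
            · rw [h0, Real.zero_rpow hpq.ne_zero]
              ring
            · rw [Real.rpow_sub_one h0]
              field_simp
        _ ≤ _ := by
            gcongr
            exact hψ _
    calc ENNReal.ofReal δ * I = ENNReal.ofReal (δ * ∫ x, ‖w x‖ ^ p) := by
          rw [ENNReal.ofReal_mul hδ0.le, hIr]
      _ ≤ ‖∫ x, B (v x) (w x)‖ₑ := by
          rw [← ofReal_norm]
          exact ENNReal.ofReal_le_ofReal h4
      _ ≤ _ := h1.trans (by gcongr)
  have key1 : I ≤ ENNReal.ofReal a * I ^ (1 / q) := by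
    have ht : Tendsto (fun δ : ℝ => ENNReal.ofReal δ * I) (𝓝[<] 1) (𝓝 (ENNReal.ofReal 1 * I)) :=
      ENNReal.Tendsto.mul_const (ENNReal.tendsto_ofReal (tendsto_id.mono_left nhdsWithin_le_nhds))
        (Or.inr hItop)
    rw [ENNReal.ofReal_one, one_mul] at ht
    refine le_of_tendsto ht ?_
    filter_upwards [self_mem_nhdsWithin, Ioo_mem_nhdsLT (zero_lt_one' ℝ)] with δ h1 h2
    exact key δ h1 h2.1
  rw [eLpNorm_ofReal_eq_lintegral_rpow w hpq.pos, ← hI]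
  exact rpow_one_div_le_of_le_mul_rpow hpq hItop key1

/-- Apply the step-function case to `𝔼_n u`, whose pairing with a step function of generation `n` is
that of `u`, and let `n → ∞` by Fatou's lemma. -/
theorem eLpNorm_le_of_pairing {B : V →L[𝕜] StrongDual 𝕜 U} (hB : IsNormingPairing B)
    (hd : 0 < d) {p q : ℝ} (hpq : p.HolderConjugate q) {u : EuclideanSpace ℝ (Fin d) → U}
    (hu : Integrable u) (hub : Bornology.IsBounded (Function.support u)) {a : ℝ}
    (h : ∀ (v : EuclideanSpace ℝ (Fin d) → V) (k m : ℤ), D.IsStep k v → D.avg m v = 0 →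
      ‖∫ x, B (v x) (u x)‖ₑ ≤ ENNReal.ofReal a * eLpNorm v (ENNReal.ofReal q) volume) :
    eLpNorm u (ENNReal.ofReal p) volume ≤ ENNReal.ofReal a := by
  refine (Lp.eLpNorm_lim_le_liminf_eLpNorm (f := fun n : ℕ => D.avg n u)
    (fun n => (isCubewiseConst_avg _ u).stronglyMeasurable.aestronglyMeasurable) u
    (ae_tendsto_avg hd hu.locallyIntegrable)).trans ?_
  refine (liminf_le_liminf (Eventually.of_forall fun n => ?_)).trans
    (liminf_const (ENNReal.ofReal a)).le
  refine (IsStep.avg hub).eLpNorm_le_of_pairing hB hd hpq fun v m hv h0 => ?_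
  rw [hv.integral_pairing_avg B hu.locallyIntegrable]
  exact h v _ m hv h0

end Pairing

end DyadicSystem

/-! ### UMD constants and dyadic martingale transforms -/

theorem isUMDBound_umdConst {X : Type*} [NormedAddCommGroup X] [NormedSpace ℝ X] [CompleteSpace X]
    (hX : IsUMD X) {p : ℝ} (hp : 1 < p) :
    IsUMDBound (ENNReal.ofReal p) X (umdConst (ENNReal.ofReal p) X) := by
  set s := {β : ℝ | IsUMDBound (ENNReal.ofReal p) X β}
  have hp1 : 1 < ENNReal.ofReal p := by simpa using hp
  have hne : s.Nonempty := hX _ hp1 ENNReal.ofReal_lt_top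
  refine ⟨Real.sInf_nonneg fun β hβ => hβ.1, fun Ω m μ _ ℱ _ f N ε hf hfp hε => ?_⟩
  -- The infimum is itself admissible: the inequality passes to the limit along a minimising
  -- sequence, because the norm on its right-hand side is finite.
  obtain ⟨β, -, hβs, hβ⟩ := exists_seq_tendsto_sInf hne ⟨0, fun β hβ => hβ.1⟩
  have hfin : eLpNorm (∑ n ∈ Finset.range N, (f (n + 1) - f n)) (ENNReal.ofReal p) μ ≠ ∞ := by
    refine (memLp_finsetSum' _ fun n hn => ?_).2.ne
    rw [Finset.mem_range] at hn
    exact (hfp (n + 1) hn).sub (hfp n hn.le)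
  refine ge_of_tendsto' (ENNReal.Tendsto.mul_const (ENNReal.tendsto_ofReal hβs) (Or.inr hfin))
    fun n => (hβ n).2 Ω m μ ℱ f N ε hf hfp hε

theorem umdConst_nonneg (p : ℝ≥0∞) (X : Type*) [NormedAddCommGroup X] [NormedSpace ℝ X]
    [CompleteSpace X] : 0 ≤ umdConst p X := Real.sInf_nonneg fun _ hβ => hβ.1

namespace DyadicSystem

section Martingales

variable {d : ℕ} (D : DyadicSystem d)

/-- The filtration of the dyadic `σ`-algebras of generation `m, m + 1, …`. -/
def filtration (m : ℤ) : Filtration ℕ (inferInstance : MeasurableSpace (EuclideanSpace ℝ (Fin d)))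
    where
  seq n := D.cubeSigma (m + n)
  mono' _ _ h _ hS := IsUnionOfCubes.mono hS (by lia)
  le' n := cubeSigma_le (m + n)

instance (m : ℤ) : SigmaFiniteFiltration volume (D.filtration m) where
  SigmaFinite n := by
    refine Measure.sigmaFinite_of_countable (D.countable_cubes (m + n)) (fun Q hQ => ?_) ?_
    · obtain ⟨x, rfl⟩ := D.exists_eq_cubeAt hQ
      have h : MeasurableSet[D.filtration m n] (D.cubeAt (m + n) x) := isUnionOfCubes_cubeAt _ x
      rw [trim_measurableSet_eq _ h]
      exact (D.volume_cubeAt_ne_top _ x).lt_top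
    · exact Set.eq_univ_of_forall fun x => ⟨_, D.cubeAt_mem _ x, D.mem_cubeAt_self _ x⟩

/-- The dyadic martingale `𝔼_m f, 𝔼_{m+1} f, …`. -/
noncomputable def mart {F : Type*} [NormedAddCommGroup F] [NormedSpace ℝ F] (m : ℤ)
    (f : EuclideanSpace ℝ (Fin d) → F) (n : ℕ) : EuclideanSpace ℝ (Fin d) → F :=
  D.avg (m + n) f

/-- The differences of `D.mart m f`. -/
noncomputable def martDiff {F : Type*} [NormedAddCommGroup F] [NormedSpace ℝ F] (m : ℤ)
    (f : EuclideanSpace ℝ (Fin d) → F) (n : ℕ) : EuclideanSpace ℝ (Fin d) → F :=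
  D.mart m f (n + 1) - D.mart m f n

variable {D} {F : Type*} [NormedAddCommGroup F] [NormedSpace ℝ F] [CompleteSpace F]

theorem martingale_mart (m : ℤ) {f : EuclideanSpace ℝ (Fin d) → F} (hf : Integrable f) :
    Martingale (D.mart m f) (D.filtration m) volume := by
  refine ⟨fun n => (isCubewiseConst_avg (m + n) f).stronglyMeasurable_cubeSigma, fun i j hij => ?_⟩
  refine (ae_eq_condExp_of_forall_setIntegral_eq ((D.filtration m).le i)
    (integrable_avg hf (m + j)) (fun s hs _ => (integrable_avg hf (m + i)).integrableOn)
    (fun s hs _ => ?_)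
    (isCubewiseConst_avg (m + i) f).stronglyMeasurable_cubeSigma.aestronglyMeasurable).symm
  rw [setIntegral_avg hs hf.integrableOn, setIntegral_avg (IsUnionOfCubes.mono hs (by lia))
    hf.integrableOn]

omit [CompleteSpace F] in
theorem IsStep.mart {k m : ℤ} {f : EuclideanSpace ℝ (Fin d) → F} (hf : D.IsStep k f) (n : ℕ) :
    D.IsStep (m + n) (D.mart m f n) := IsStep.avg hf.bounded

omit [CompleteSpace F] in
theorem IsStep.martDiff {k m : ℤ} {f : EuclideanSpace ℝ (Fin d) → F} (hf : D.IsStep k f) (n : ℕ) :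
    D.IsStep (m + (n + 1)) (D.martDiff m f n) := by
  have := (hf.mart (m := m) (n + 1)).sub ((hf.mart (m := m) n).mono (by lia))
  push_cast at this
  exact this

theorem IsStep.mart_eq {m : ℤ} {n : ℕ} {f : EuclideanSpace ℝ (Fin d) → F}
    (hf : D.IsStep (m + n) f) : D.mart m f n = f := hf.const.avg_eq_self

omit [CompleteSpace F] in
theorem mart_zero_eq {m : ℤ} {f : EuclideanSpace ℝ (Fin d) → F} (h0 : D.avg m f = 0) :
    D.mart m f 0 = 0 := by
  simpa [mart] using h0

omit [CompleteSpace F] in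
theorem sum_martDiff (m : ℤ) (f : EuclideanSpace ℝ (Fin d) → F) (n : ℕ) :
    ∑ i ∈ Finset.range n, D.martDiff m f i = D.mart m f n - D.mart m f 0 :=
  Finset.sum_range_sub _ n

theorem eLpNorm_sum_sign_martDiff_le {p β : ℝ} (hβ : IsUMDBound (ENNReal.ofReal p) F β)
    {m : ℤ} {n : ℕ} {f : EuclideanSpace ℝ (Fin d) → F} (hf : D.IsStep (m + n) f)
    (h0 : D.avg m f = 0) {ε : ℕ → ℝ} (hε : ∀ i, ε i = 1 ∨ ε i = -1) :
    eLpNorm (∑ i ∈ Finset.range n, ε i • D.martDiff m f i) (ENNReal.ofReal p) volume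
      ≤ ENNReal.ofReal β * eLpNorm f (ENNReal.ofReal p) volume := by
  have := hβ.2 (EuclideanSpace ℝ (Fin d)) inferInstance volume (D.filtration m) (D.mart m f) n ε
    (martingale_mart m hf.integrable) (fun i _ => (hf.mart i).memLp _) hε
  rwa [Finset.sum_range_sub, mart_zero_eq h0, hf.mart_eq, sub_zero] at this

end Martingales

section Dual

variable {d : ℕ} {D : DyadicSystem d} {𝕜 : Type*} [RCLike 𝕜]
  {U : Type*} [NormedAddCommGroup U] [NormedSpace ℝ U] [NormedSpace 𝕜 U] [CompleteSpace U]
  {V : Type*} [NormedAddCommGroup V] [NormedSpace ℝ V] [NormedSpace 𝕜 V] [CompleteSpace V]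

theorem integral_pairing_martDiff_comm (B : V →L[𝕜] StrongDual 𝕜 U)
    {v : EuclideanSpace ℝ (Fin d) → V} {u : EuclideanSpace ℝ (Fin d) → U} {k : ℤ}
    (hv : D.IsStep k v) (hu : D.IsStep k u) (m : ℤ) (i : ℕ) :
    ∫ x, B (v x) (D.martDiff m u i x) = ∫ x, B (D.martDiff m v i x) (u x) := by
  simp only [martDiff, mart, Pi.sub_apply, map_sub, _root_.sub_apply]
  have hu' : ∀ j, LocallyIntegrable (D.avg j u) := locallyIntegrable_avg hu.locallyIntegrable
  rw [integral_sub (hv.integrable_pairing B (hu' _)) (hv.integrable_pairing B (hu' _)),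
    integral_sub ((IsStep.avg hv.bounded).integrable_pairing B hu.locallyIntegrable)
      ((IsStep.avg hv.bounded).integrable_pairing B hu.locallyIntegrable)]
  simp only [integral_pairing_avg_comm B hv.locallyIntegrable hu.locallyIntegrable hv.bounded
    hu.bounded]

theorem integral_pairing_sum_martDiff_comm (B : V →L[𝕜] StrongDual 𝕜 U)
    {v : EuclideanSpace ℝ (Fin d) → V} {u : EuclideanSpace ℝ (Fin d) → U} {k : ℤ}
    (hv : D.IsStep k v) (hu : D.IsStep k u) (m : ℤ) (n : ℕ) (ε : ℕ → ℝ) :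
    ∫ x, B (v x) ((∑ i ∈ Finset.range n, ε i • D.martDiff m u i) x)
      = ∫ x, B ((∑ i ∈ Finset.range n, ε i • D.martDiff m v i) x) (u x) := by
  have hreal : ∀ (r : ℝ) (a : V) (b : U), B (r • a) b = (r : 𝕜) * B a b := fun r a b => by
    rw [RCLike.real_smul_eq_coe_smul (K := 𝕜) r a, map_smul, _root_.smul_apply, smul_eq_mul]
  have hreal' : ∀ (r : ℝ) (a : V) (b : U), B a (r • b) = (r : 𝕜) * B a b := fun r a b => by
    rw [RCLike.real_smul_eq_coe_smul (K := 𝕜) r b, map_smul, smul_eq_mul]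
  simp only [Finset.sum_apply, Pi.smul_apply, map_sum, _root_.sum_apply, hreal, hreal']
  rw [integral_finsetSum _ fun i _ => Integrable.const_mul
      (hv.integrable_pairing B (hu.martDiff i).locallyIntegrable) _,
    integral_finsetSum _ fun i _ => Integrable.const_mul
      ((hv.martDiff i).integrable_pairing B hu.locallyIntegrable) _]
  simp only [integral_const_mul, integral_pairing_martDiff_comm B hv hu]

/-- A sign transform is self-adjoint, so its bound on `L^q(V)` passes to `L^p(U)` as soon as `V`
norms `U`. In particular the transforms on a dual space are controlled without a UMD hypothesis on
that dual. -/
theorem eLpNorm_sum_sign_martDiff_le_of_dual {B : V →L[𝕜] StrongDual 𝕜 U}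
    (hB : IsNormingPairing B) (hd : 0 < d) {p q : ℝ} (hpq : p.HolderConjugate q) {β : ℝ}
    (hβ : IsUMDBound (ENNReal.ofReal q) V β)
    {m : ℤ} {n : ℕ} {u : EuclideanSpace ℝ (Fin d) → U} (hu : D.IsStep (m + n) u)
    (h0 : D.avg m u = 0) {ε : ℕ → ℝ} (hε : ∀ i, ε i = 1 ∨ ε i = -1) :
    eLpNorm (∑ i ∈ Finset.range n, ε i • D.martDiff m u i) (ENNReal.ofReal p) volume
      ≤ ENNReal.ofReal β * eLpNorm u (ENNReal.ofReal p) volume := by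
  set w := ∑ i ∈ Finset.range n, ε i • D.martDiff m u i with hw
  have hws : D.IsStep (m + n) w := IsStep.sum _ fun i hi => by
    rw [Finset.mem_range] at hi
    exact ((hu.martDiff i).mono (by lia)).comp (fun y => ε i • y) (smul_zero _)
  rw [← ENNReal.ofReal_toReal (hu.memLp (ENNReal.ofReal p)).2.ne, ← ENNReal.ofReal_mul hβ.1]
  refine hws.eLpNorm_le_of_pairing hB hd hpq fun v m' hv h0' => ?_
  rw [ENNReal.ofReal_mul hβ.1, ENNReal.ofReal_toReal (hu.memLp (ENNReal.ofReal p)).2.ne]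
  -- The test `v` may have mean zero only at a coarser generation than `m`, so both martingales are
  -- started at `m - l`. The `l` additional differences of `u` vanish; the signs there, which
  -- truncated subtraction sets to `ε 0`, are immaterial.
  obtain ⟨l, hl⟩ : ∃ l : ℕ, m - l ≤ m' := ⟨(m - m').toNat, by lia⟩
  have hv0 : D.avg (m - l) v = 0 := avg_eq_zero_of_le hv.locallyIntegrable h0' hl
  set ε' : ℕ → ℝ := fun i => ε (i - l) with hε'
  have hw' : w = ∑ i ∈ Finset.range (l + n), ε' i • D.martDiff (m - l) u i := by
    rw [Finset.sum_range_add, Finset.sum_eq_zero, zero_add, hw]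
    · refine Finset.sum_congr rfl fun i _ => ?_
      simp only [hε', martDiff, mart, Nat.add_sub_cancel_left]
      have h1 : m - l + ((l + i : ℕ) : ℤ) = m + i := by push_cast; ring
      have h2 : m - l + ((l + i + 1 : ℕ) : ℤ) = m + (i + 1 : ℕ) := by push_cast; ring
      rw [h1, h2]
    · intro i hi
      rw [Finset.mem_range] at hi
      rw [martDiff, mart, mart, avg_eq_zero_of_le hu.locallyIntegrable h0 (by lia),
        avg_eq_zero_of_le hu.locallyIntegrable h0 (by lia), sub_zero, smul_zero]
  have hln : m - l + ((l + n : ℕ) : ℤ) = m + n := by push_cast; ring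
  have hsum : D.IsStep (m + n) (∑ i ∈ Finset.range (l + n), ε' i • D.martDiff (m - l) v i) :=
    IsStep.sum _ fun i hi => by
      rw [Finset.mem_range] at hi
      exact ((hv.martDiff i).mono (by lia)).comp (fun y => ε' i • y) (smul_zero _)
  rw [hw', integral_pairing_sum_martDiff_comm B hv hu]
  refine (enorm_integral_pairing_le hB hpq.symm hsum.stronglyMeasurable.aestronglyMeasurable
    hu.stronglyMeasurable.aestronglyMeasurable).trans ?_
  rw [mul_right_comm]
  gcongr
  exact eLpNorm_sum_sign_martDiff_le hβ (by rwa [hln]) hv0 fun i => hε _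

end Dual

end DyadicSystem

/-- Young's inequality for `s * a ^ (p - 1)`, multiplied by `q`. It controls one increment of the
`p`-th power of a running maximum, from `a` to `max a s`, in the proof of Doob's inequality. -/
theorem max_rpow_sub_rpow_le {p q : ℝ} (hpq : p.HolderConjugate q) {a s : ℝ} (ha : 0 ≤ a)
    (hs : 0 ≤ s) :
    max a s ^ p - a ^ p ≤ q * (s * (max a s ^ (p - 1) - a ^ (p - 1))) := by
  rcases le_total s a with h | h
  · simp [max_eq_left h]
  · rw [max_eq_right h]
    have h1 := Real.young_inequality_of_nonneg hs (Real.rpow_nonneg ha (p - 1)) hpq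
    rw [← Real.rpow_mul ha, hpq.sub_one_mul_conj] at h1
    have h2 : s * s ^ (p - 1) = s ^ p := by
      rcases eq_or_ne s 0 with h0 | h0
      · rw [h0, Real.zero_rpow hpq.ne_zero, zero_mul]
      · rw [Real.rpow_sub_one h0]
        field_simp
    have h3 : q / p = q - 1 := hpq.symm.div_conj_eq_sub_one
    have h4 := mul_le_mul_of_nonneg_left h1 hpq.symm.nonneg
    have h5 : q * (s ^ p / p + a ^ p / q) = (q - 1) * s ^ p + a ^ p := by
      rw [← h3, mul_add, mul_div_cancel₀ _ hpq.symm.ne_zero]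
      ring
    rw [mul_sub, h2]
    linarith

/-! ### Randomisation by signs -/

section Rademacher

/-- The signs that are `1` on `S` and `-1` off `S`. -/
noncomputable def signOn (S : Finset ℕ) (i : ℕ) : ℝ := by
  classical exact if i ∈ S then 1 else -1

theorem signOn_eq_or (S : Finset ℕ) (i : ℕ) : signOn S i = 1 ∨ signOn S i = -1 := by
  unfold signOn
  split_ifs <;> simp

theorem signOn_mul_self (S : Finset ℕ) (i : ℕ) : signOn S i * signOn S i = 1 := by
  rcases signOn_eq_or S i with h | h <;> simp [h]

theorem signOn_symmDiff_of_mem (S : Finset ℕ) {A : Finset ℕ} {i : ℕ} (hi : i ∈ A) :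
    signOn (symmDiff S A) i = -signOn S i := by
  unfold signOn
  simp only [Finset.mem_symmDiff, hi, not_true_eq_false, and_false, true_and, false_or]
  split_ifs <;> simp

theorem signOn_symmDiff_of_notMem (S : Finset ℕ) {A : Finset ℕ} {i : ℕ} (hi : i ∉ A) :
    signOn (symmDiff S A) i = signOn S i := by
  unfold signOn
  simp [Finset.mem_symmDiff, hi]

theorem symmDiff_mem_powerset {S A : Finset ℕ} {n : ℕ} (hS : S ∈ (Finset.range n).powerset)
    (hA : A ⊆ Finset.range n) : symmDiff S A ∈ (Finset.range n).powerset := by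
  rw [Finset.mem_powerset] at hS ⊢
  intro i hi
  rcases Finset.mem_symmDiff.1 hi with h | h
  · exact hS h.1
  · exact hA h.1

/-- Sign patterns are encoded by subsets. Symmetric difference with `A` flips the signs on `A` and
permutes the patterns, so sums over all patterns are invariant under it. -/
theorem sum_powerset_symmDiff {M : Type*} [AddCommMonoid M] {n : ℕ} {A : Finset ℕ}
    (hA : A ⊆ Finset.range n) (φ : Finset ℕ → M) :
    ∑ S ∈ (Finset.range n).powerset, φ (symmDiff S A) = ∑ S ∈ (Finset.range n).powerset, φ S :=
  Finset.sum_bij' (fun S _ => symmDiff S A) (fun S _ => symmDiff S A)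
    (fun _ hS => symmDiff_mem_powerset hS hA) (fun _ hS => symmDiff_mem_powerset hS hA)
    (fun S _ => symmDiff_symmDiff_cancel_right A S) (fun S _ => symmDiff_symmDiff_cancel_right A S)
    fun _ _ => rfl

theorem sum_signOn_mul_signOn {n i j : ℕ} (hi : i < n) (hij : i ≠ j) :
    ∑ S ∈ (Finset.range n).powerset, signOn S i * signOn S j = 0 := by
  have h := sum_powerset_symmDiff (n := n) (A := {i})
    (by simpa using hi) fun S => signOn S i * signOn S j
  simp only [signOn_symmDiff_of_mem _ (Finset.mem_singleton_self i),
    signOn_symmDiff_of_notMem _ (show j ∉ ({i} : Finset ℕ) by simpa using hij.symm), neg_mul,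
    Finset.sum_neg_distrib] at h
  linarith

variable {X Y E : Type*} [NormedAddCommGroup X] [NormedSpace ℝ X] [NormedAddCommGroup Y]
  [NormedSpace ℝ Y] [NormedAddCommGroup E] [NormedSpace ℝ E]

/-- Orthogonality of the signs leaves only the diagonal. Truncating one factor at `l` already
truncates the diagonal sum. -/
theorem sum_sum_signOn_bilinear {n l : ℕ} (hl : l ≤ n) (t : X →ₗ[ℝ] Y →ₗ[ℝ] E) (x : ℕ → X)
    (y : ℕ → Y) :
    ∑ S ∈ (Finset.range n).powerset, t (∑ i ∈ Finset.range l, signOn S i • x i)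
        (∑ j ∈ Finset.range n, signOn S j • y j)
      = (2 : ℝ) ^ n • ∑ i ∈ Finset.range l, t (x i) (y i) := by
  have hexp : ∀ S, t (∑ i ∈ Finset.range l, signOn S i • x i)
      (∑ j ∈ Finset.range n, signOn S j • y j) = ∑ i ∈ Finset.range l, ∑ j ∈ Finset.range n,
        (signOn S i * signOn S j) • t (x i) (y j) := fun S => by
    rw [map_sum t, LinearMap.sum_apply]
    refine Finset.sum_congr rfl fun i _ => ?_
    rw [map_sum]
    refine Finset.sum_congr rfl fun j _ => ?_
    rw [map_smul, map_smul, LinearMap.smul_apply, smul_smul, mul_comm]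
  simp only [hexp]
  rw [Finset.sum_comm, Finset.smul_sum]
  refine Finset.sum_congr rfl fun i hi => ?_
  rw [Finset.mem_range] at hi
  rw [Finset.sum_comm, Finset.sum_eq_single i]
  · rw [← Finset.sum_smul]
    simp [signOn_mul_self]
  · intro j _ hj
    rw [← Finset.sum_smul]
    rw [sum_signOn_mul_signOn (hi.trans_le hl) hj.symm, zero_smul]
  · intro h
    exact absurd (Finset.mem_range.2 (hi.trans_le hl)) h

/-- A truncated signed sum is the mean of the full sum and of the full sum with its tail signs
flipped; use convexity of `t ^ p` and the invariance under the flip. -/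
theorem sum_norm_sum_signOn_rpow_le {n l : ℕ} (hl : l ≤ n) {p : ℝ} (hp : 1 ≤ p) (x : ℕ → X) :
    ∑ S ∈ (Finset.range n).powerset, ‖∑ i ∈ Finset.range l, signOn S i • x i‖ ^ p
      ≤ ∑ S ∈ (Finset.range n).powerset, ‖∑ i ∈ Finset.range n, signOn S i • x i‖ ^ p := by
  set a : Finset ℕ → ℝ := fun S => ‖∑ i ∈ Finset.range n, signOn S i • x i‖ ^ p with ha
  set A := Finset.Ico l n with hA
  have hAn : A ⊆ Finset.range n := fun i hi => by
    simp only [hA, Finset.mem_Ico, Finset.mem_range] at hi ⊢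
    exact hi.2
  have key : ∀ S, ‖∑ i ∈ Finset.range l, signOn S i • x i‖ ^ p
      ≤ 1 / 2 * a S + 1 / 2 * a (symmDiff S A) := fun S => by
    have h1 : ∑ i ∈ Finset.range l, signOn S i • x i
        = (1 / 2 : ℝ) • (∑ i ∈ Finset.range n, signOn S i • x i)
          + (1 / 2 : ℝ) • ∑ i ∈ Finset.range n, signOn (symmDiff S A) i • x i := by
      have hlow : ∑ i ∈ Finset.range l, signOn (symmDiff S A) i • x i
          = ∑ i ∈ Finset.range l, signOn S i • x i := Finset.sum_congr rfl fun i hi => by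
        rw [signOn_symmDiff_of_notMem S (show i ∉ A by
          simp only [hA, Finset.mem_Ico, Finset.mem_range] at hi ⊢; lia)]
      have hhigh : ∑ i ∈ A, signOn (symmDiff S A) i • x i = -∑ i ∈ A, signOn S i • x i := by
        rw [← Finset.sum_neg_distrib]
        refine Finset.sum_congr rfl fun i hi => ?_
        rw [signOn_symmDiff_of_mem S hi, neg_smul]
      rw [← Finset.sum_range_add_sum_Ico _ hl, ← Finset.sum_range_add_sum_Ico _ hl, hlow, hhigh]
      module
    rw [h1]
    refine le_trans (Real.rpow_le_rpow (norm_nonneg _) (norm_add_le _ _) (by linarith)) ?_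
    rw [norm_smul, norm_smul, Real.norm_of_nonneg (by norm_num)]
    exact (convexOn_rpow hp).2 (norm_nonneg _) (norm_nonneg _) (by norm_num) (by norm_num)
      (by norm_num)
  calc _ ≤ ∑ S ∈ (Finset.range n).powerset, (1 / 2 * a S + 1 / 2 * a (symmDiff S A)) :=
        Finset.sum_le_sum fun S _ => key S
    _ = _ := by
        rw [Finset.sum_add_distrib, ← Finset.mul_sum, ← Finset.mul_sum,
          sum_powerset_symmDiff hAn a]
        ring

/-- The right-hand side does not involve `l`, so all partial sums, and with them their supremum, are
bounded at once. -/
theorem norm_sum_bilinear_le_signOn {n l : ℕ} (hl : l ≤ n) {p q : ℝ} (hpq : p.HolderConjugate q)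
    {t : X →ₗ[ℝ] Y →ₗ[ℝ] E} (ht : ∀ x y, ‖t x y‖ ≤ ‖x‖ * ‖y‖) (x : ℕ → X) (y : ℕ → Y) :
    2 ^ n * ‖∑ i ∈ Finset.range l, t (x i) (y i)‖
      ≤ (∑ S ∈ (Finset.range n).powerset, ‖∑ i ∈ Finset.range n, signOn S i • x i‖ ^ p) ^ (1 / p)
        * (∑ S ∈ (Finset.range n).powerset, ‖∑ i ∈ Finset.range n, signOn S i • y i‖ ^ q)
          ^ (1 / q) := by
  have h1 : 2 ^ n * ‖∑ i ∈ Finset.range l, t (x i) (y i)‖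
      = ‖∑ S ∈ (Finset.range n).powerset, t (∑ i ∈ Finset.range l, signOn S i • x i)
        (∑ j ∈ Finset.range n, signOn S j • y j)‖ := by
    rw [sum_sum_signOn_bilinear hl, norm_smul, norm_pow, Real.norm_ofNat]
  rw [h1]
  calc _ ≤ ∑ S ∈ (Finset.range n).powerset, ‖∑ i ∈ Finset.range l, signOn S i • x i‖
          * ‖∑ j ∈ Finset.range n, signOn S j • y j‖ :=
        (norm_sum_le _ _).trans (Finset.sum_le_sum fun S _ => ht _ _)
    _ ≤ _ := Real.inner_le_Lp_mul_Lq_of_nonneg _ hpq (fun _ _ => norm_nonneg _)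
        fun _ _ => norm_nonneg _
    _ ≤ _ := by
        have := hpq.pos
        gcongr ?_ ^ (1 / p) * _
        exact sum_norm_sum_signOn_rpow_le hl hpq.lt.le x

end Rademacher

/-! ### Doob's maximal inequality -/

namespace DyadicSystem

section Doob

variable {d : ℕ} {D : DyadicSystem d} {F : Type*} [NormedAddCommGroup F] [NormedSpace ℝ F]

/-- The maximal function of the dyadic martingale `𝔼_m f, …, 𝔼_{m+n} f`. -/
noncomputable def martMax (D : DyadicSystem d) (m : ℤ) (f : EuclideanSpace ℝ (Fin d) → F) (n : ℕ) :
    EuclideanSpace ℝ (Fin d) → ℝ :=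
  fun x => partialSups (fun i => ‖D.mart m f i x‖) n

theorem norm_mart_le_martMax (m : ℤ) (f : EuclideanSpace ℝ (Fin d) → F) {i n : ℕ} (hi : i ≤ n)
    (x : EuclideanSpace ℝ (Fin d)) : ‖D.mart m f i x‖ ≤ D.martMax m f n x :=
  le_partialSups_of_le (fun i => ‖D.mart m f i x‖) hi

theorem martMax_nonneg (m : ℤ) (f : EuclideanSpace ℝ (Fin d) → F) (n : ℕ)
    (x : EuclideanSpace ℝ (Fin d)) : 0 ≤ D.martMax m f n x :=
  (norm_nonneg _).trans (norm_mart_le_martMax m f le_rfl x)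

theorem martMax_succ (m : ℤ) (f : EuclideanSpace ℝ (Fin d) → F) (n : ℕ)
    (x : EuclideanSpace ℝ (Fin d)) :
    D.martMax m f (n + 1) x = max (D.martMax m f n x) ‖D.mart m f (n + 1) x‖ :=
  partialSups_add_one _ _

theorem martMax_mono (m : ℤ) (f : EuclideanSpace ℝ (Fin d) → F) (n : ℕ)
    (x : EuclideanSpace ℝ (Fin d)) : D.martMax m f n x ≤ D.martMax m f (n + 1) x := by
  rw [martMax_succ]
  exact le_max_left _ _

theorem IsStep.martMax {k m : ℤ} {f : EuclideanSpace ℝ (Fin d) → F} (hf : D.IsStep k f) (n : ℕ) :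
    D.IsStep (m + n) (D.martMax m f n) := by
  induction n with
  | zero =>
    have : D.martMax m f 0 = fun x => ‖D.mart m f 0 x‖ := by
      ext x
      exact partialSups_zero _
    rw [this]
    exact (hf.mart 0).norm
  | succ n ih =>
    have : D.martMax m f (n + 1) = fun x => max (D.martMax m f n x) ‖D.mart m f (n + 1) x‖ :=
      funext (martMax_succ m f n)
    rw [this]
    exact (ih.mono (by lia)).comp₂ (hf.mart (n + 1)).norm max (max_self 0)

/-- The increments of `∫ M_i^p` are at most `q` times those of `∫ ‖f‖ M_i^{p-1}`. Summing them gives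
`∫ M^p ≤ q ∫ ‖f‖ M^{p-1}`, to which Hölder's inequality applies. The mean-zero hypothesis makes the
initial terms vanish. -/
theorem eLpNorm_martMax_le {p q : ℝ} (hpq : p.HolderConjugate q) {m : ℤ} {n : ℕ}
    {f : EuclideanSpace ℝ (Fin d) → F} (hf : D.IsStep (m + n) f) (h0 : D.avg m f = 0) :
    eLpNorm (D.martMax m f n) (ENNReal.ofReal p) volume
      ≤ ENNReal.ofReal q * eLpNorm f (ENNReal.ofReal p) volume := by
  set M := D.martMax m f with hM
  have hMs : ∀ i : ℕ, D.IsStep (m + i) (M i) := fun i => hf.martMax i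
  have hMp : ∀ i : ℕ, D.IsStep (m + i) (fun x => M i x ^ p) := fun i =>
    (hMs i).comp (· ^ p) (Real.zero_rpow hpq.ne_zero)
  have hMp1 : ∀ i : ℕ, D.IsStep (m + i) (fun x => M i x ^ (p - 1)) := fun i =>
    (hMs i).comp (· ^ (p - 1)) (Real.zero_rpow hpq.sub_one_ne_zero)
  have hM0 : M 0 = 0 := by
    ext x
    rw [hM, martMax, partialSups_zero, mart_zero_eq h0]
    simp
  have hle : ∀ i x, M i x ^ (p - 1) ≤ M (i + 1) x ^ (p - 1) := fun i x =>
    Real.rpow_le_rpow (martMax_nonneg m f i x) (martMax_mono m f i x) hpq.sub_one_pos.le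
  have hnn : ∀ i x, 0 ≤ M i x := martMax_nonneg m f
  have hprod : ∀ i ≤ n, D.IsStep (m + n) (fun x => ‖f x‖ * M i x ^ (p - 1)) := fun i hi =>
    hf.norm.comp₂ ((hMp1 i).mono (by lia)) (· * ·) (zero_mul 0)
  have step : ∀ i < n, (∫ x, M (i + 1) x ^ p) - ∫ x, M i x ^ p
      ≤ q * ((∫ x, ‖f x‖ * M (i + 1) x ^ (p - 1)) - ∫ x, ‖f x‖ * M i x ^ (p - 1)) := by
    intro i hi
    -- A nonnegative weight that is constant on the cubes of generation `m + i + 1`; hence `‖𝔼 f‖ ≤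
    -- 𝔼 ‖f‖` may be used under it and the average then dropped.
    set c : EuclideanSpace ℝ (Fin d) → ℝ := fun x => M (i + 1) x ^ (p - 1) - M i x ^ (p - 1)
    have hc : D.IsStep (m + (i + 1 : ℕ)) c :=
      (hMp1 (i + 1)).comp₂ ((hMp1 i).mono (by lia)) (· - ·) (sub_zero 0)
    have hcf : D.IsStep (m + n) fun x => c x * ‖f x‖ :=
      (hc.mono (by lia)).comp₂ hf.norm (· * ·) (zero_mul 0)
    have hci : D.IsStep (m + (i + 1 : ℕ)) fun x => c x * D.avg (m + (i + 1 : ℕ)) (‖f ·‖) x :=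
      hc.comp₂ (IsStep.avg hf.norm.bounded) (· * ·) (zero_mul 0)
    rw [← integral_sub (hMp (i + 1)).integrable (hMp i).integrable,
      ← integral_sub (hprod (i + 1) hi).integrable (hprod i hi.le).integrable]
    calc ∫ x, (M (i + 1) x ^ p - M i x ^ p)
        ≤ ∫ x, q * (c x * D.avg (m + (i + 1 : ℕ)) (‖f ·‖) x) := by
          refine integral_mono ((hMp (i + 1)).integrable.sub (hMp i).integrable)
            (hci.integrable.const_mul q) fun x => ?_
          have h1 := max_rpow_sub_rpow_le hpq (hnn i x) (norm_nonneg (D.mart m f (i + 1) x))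
          rw [← martMax_succ, mul_comm ‖_‖] at h1
          refine h1.trans (mul_le_mul_of_nonneg_left (mul_le_mul_of_nonneg_left ?_
            (sub_nonneg.2 (hle i x))) hpq.symm.nonneg)
          exact norm_avg_le_avg_norm f _ x
      _ = q * ∫ x, (‖f x‖ * M (i + 1) x ^ (p - 1) - ‖f x‖ * M i x ^ (p - 1)) := by
          rw [integral_const_mul, integral_avg_mul_of_const hc.const hf.norm.locallyIntegrable
            hcf.integrable]
          congr 2
          ext x
          simp only [c]
          ring
  have hsum := Finset.sum_le_sum fun i hi => step i (Finset.mem_range.1 hi)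
  rw [← Finset.mul_sum, Finset.sum_range_sub (fun i => ∫ x, M i x ^ p),
    Finset.sum_range_sub (fun i => ∫ x, ‖f x‖ * M i x ^ (p - 1)), hM0] at hsum
  simp only [Pi.zero_apply, Real.zero_rpow hpq.ne_zero, Real.zero_rpow hpq.sub_one_ne_zero,
    mul_zero, integral_zero, sub_zero] at hsum
  set I := ∫⁻ x, ‖M n x‖ₑ ^ p with hI
  have hIr : ENNReal.ofReal (∫ x, M n x ^ p) = I := by
    rw [ofReal_integral_eq_lintegral_ofReal (hMp n).integrable
      (Eventually.of_forall fun x => Real.rpow_nonneg (hnn n x) p)]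
    refine lintegral_congr fun x => ?_
    rw [← ENNReal.ofReal_rpow_of_nonneg (hnn n x) hpq.nonneg, Real.enorm_of_nonneg (hnn n x)]
  have hItop : I ≠ ∞ := hIr ▸ ENNReal.ofReal_ne_top
  rw [eLpNorm_ofReal_eq_lintegral_rpow _ hpq.pos]
  refine rpow_one_div_le_of_le_mul_rpow hpq hItop ?_
  calc I ≤ ENNReal.ofReal q * ENNReal.ofReal (∫ x, ‖f x‖ * M n x ^ (p - 1)) := by
        rw [← hIr, ← ENNReal.ofReal_mul hpq.symm.nonneg]
        exact ENNReal.ofReal_le_ofReal hsum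
    _ = ENNReal.ofReal q * ∫⁻ x, ‖f x‖ₑ * ‖M n x ^ (p - 1)‖ₑ := by
        rw [ofReal_integral_eq_lintegral_ofReal (hprod n le_rfl).integrable
          (Eventually.of_forall fun x => mul_nonneg (norm_nonneg _) (Real.rpow_nonneg (hnn n x) _))]
        congr 1
        refine lintegral_congr fun x => ?_
        rw [ENNReal.ofReal_mul (norm_nonneg _), ofReal_norm,
          Real.enorm_of_nonneg (Real.rpow_nonneg (hnn n x) _)]
    _ ≤ ENNReal.ofReal q * (eLpNorm f (ENNReal.ofReal p) volume
          * eLpNorm (fun x => M n x ^ (p - 1)) (ENNReal.ofReal q) volume) := by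
        gcongr
        exact lintegral_enorm_mul_le_eLpNorm_mul_eLpNorm hpq
          hf.stronglyMeasurable.aestronglyMeasurable (hMp1 n).stronglyMeasurable.aestronglyMeasurable
    _ = ENNReal.ofReal q * eLpNorm f (ENNReal.ofReal p) volume * I ^ (1 / q) := by
        rw [mul_assoc, eLpNorm_ofReal_eq_lintegral_rpow (fun x => M n x ^ (p - 1)) hpq.symm.pos, hI]
        congr 4
        ext x
        rw [Real.enorm_of_nonneg (Real.rpow_nonneg (hnn n x) _), Real.enorm_of_nonneg (hnn n x),
          ← ENNReal.ofReal_rpow_of_nonneg (hnn n x) hpq.sub_one_pos.le, ← ENNReal.rpow_mul,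
          hpq.sub_one_mul_conj]

end Doob

end DyadicSystem

/-! ### The Hardy space estimate for the symmetrised tensor sum -/

section TensorEval

variable {𝕜 : Type*} [RCLike 𝕜]
  {X : Type*} [NormedAddCommGroup X] [NormedSpace ℝ X] [NormedSpace 𝕜 X] [IsScalarTower ℝ 𝕜 X]
  {Y : Type*} [NormedAddCommGroup Y] [NormedSpace ℝ Y] [NormedSpace 𝕜 Y] [IsScalarTower ℝ 𝕜 Y]

variable (𝕜 X Y) in
/-- The elementary tensor `x ⊗ y*` as the functional `T ↦ y* (T x)` on `X →L[𝕜] Y`. -/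
noncomputable def tensorEval : X →L[𝕜] StrongDual 𝕜 Y →L[𝕜] StrongDual 𝕜 (X →L[𝕜] Y) :=
  (ContinuousLinearMap.compL 𝕜 (X →L[𝕜] Y) Y 𝕜).flip ∘L ContinuousLinearMap.apply 𝕜 Y

omit [NormedSpace ℝ X] [IsScalarTower ℝ 𝕜 X] [NormedSpace ℝ Y] [IsScalarTower ℝ 𝕜 Y] in
theorem tensorEval_apply (x : X) (y : StrongDual 𝕜 Y) (T : X →L[𝕜] Y) :
    tensorEval 𝕜 X Y x y T = y (T x) := rfl

omit [NormedSpace ℝ X] [IsScalarTower ℝ 𝕜 X] [NormedSpace ℝ Y] [IsScalarTower ℝ 𝕜 Y] in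
theorem norm_tensorEval_le (x : X) (y : StrongDual 𝕜 Y) :
    ‖tensorEval 𝕜 X Y x y‖ ≤ ‖x‖ * ‖y‖ :=
  ContinuousLinearMap.opNorm_le_bound _ (by positivity) fun T => by
    rw [tensorEval_apply]
    calc ‖y (T x)‖ ≤ ‖y‖ * (‖T‖ * ‖x‖) :=
          (y.le_opNorm _).trans (by gcongr; exact T.le_opNorm x)
      _ = ‖x‖ * ‖y‖ * ‖T‖ := by ring

end TensorEval

/-- A `𝕜`-bilinear map as a real bilinear map. -/
noncomputable def ContinuousLinearMap.toRealBilin {𝕜 X Z E : Type*} [RCLike 𝕜]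
    [NormedAddCommGroup X] [NormedSpace ℝ X] [NormedSpace 𝕜 X] [NormedAddCommGroup Z]
    [NormedSpace ℝ Z] [NormedSpace 𝕜 Z] [NormedAddCommGroup E] [NormedSpace ℝ E] [NormedSpace 𝕜 E]
    (t : X →L[𝕜] Z →L[𝕜] E) : X →ₗ[ℝ] Z →ₗ[ℝ] E :=
  LinearMap.mk₂ ℝ (fun x y => t x y) (fun x x' y => by simp)
    (fun c x y => map_real_smul (t.flip y) (t.flip y).continuous c x)
    (fun x y y' => by simp)
    (fun c x y => map_real_smul (t x) (t x).continuous c y)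

namespace DyadicSystem

section Hardy

variable {d : ℕ} {D : DyadicSystem d} {𝕜 : Type*} [RCLike 𝕜]
  {X : Type*} [NormedAddCommGroup X] [NormedSpace ℝ X] [NormedSpace 𝕜 X] [CompleteSpace X]
  {Z : Type*} [NormedAddCommGroup Z] [NormedSpace ℝ Z] [NormedSpace 𝕜 Z] [CompleteSpace Z]
  {E : Type*} [NormedAddCommGroup E] [NormedSpace ℝ E] [NormedSpace 𝕜 E] [CompleteSpace E]
  {t : X →L[𝕜] Z →L[𝕜] E}
  {f : EuclideanSpace ℝ (Fin d) → X} {g : EuclideanSpace ℝ (Fin d) → Z} {m : ℤ} {n : ℕ}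

/-- The partial sums of `∑ (𝔼_{k-1} f ⊗ 𝔻_k g + 𝔻_k f ⊗ 𝔼_{k-1} g)`. -/
noncomputable def paraTensor (D : DyadicSystem d) (t : X →L[𝕜] Z →L[𝕜] E) (m : ℤ)
    (f : EuclideanSpace ℝ (Fin d) → X)
    (g : EuclideanSpace ℝ (Fin d) → Z) (n : ℕ) :
    EuclideanSpace ℝ (Fin d) → E := fun x =>
  ∑ i ∈ Finset.range n, (t (D.mart m f i x) (D.martDiff m g i x)
    + t (D.martDiff m f i x) (D.mart m g i x))

omit [CompleteSpace X] [CompleteSpace Z] [NormedSpace ℝ E] [CompleteSpace E] in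
-- The discrete product rule: an increment of `𝔼_k f ⊗ 𝔼_k g` is the sum of the two paraproduct
-- terms and the diagonal term `𝔻_k f ⊗ 𝔻_k g`. The starting value is zero because one factor is.
theorem paraTensor_eq (hf : D.avg m f = 0) (n : ℕ) (x : EuclideanSpace ℝ (Fin d)) :
    D.paraTensor t m f g n x = t (D.mart m f n x) (D.mart m g n x)
      - ∑ i ∈ Finset.range n, t (D.martDiff m f i x) (D.martDiff m g i x) := by
  induction n with
  | zero => simp [paraTensor, mart_zero_eq hf]
  | succ n ih =>
    rw [paraTensor] at ih ⊢
    rw [Finset.sum_range_succ, ih, Finset.sum_range_succ]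
    simp only [martDiff, Pi.sub_apply, map_sub, _root_.sub_apply]
    abel

omit [CompleteSpace X] [CompleteSpace Z] [NormedSpace ℝ E] [CompleteSpace E] in
theorem IsStep.paraTensor_term {k l : ℤ} (hf : D.IsStep k f) (hg : D.IsStep l g) (i : ℕ) :
    D.IsStep (m + (i + 1)) (fun x => t (D.mart m f i x) (D.martDiff m g i x)
      + t (D.martDiff m f i x) (D.mart m g i x)) := by
  have h1 : D.IsStep (m + (i + 1)) fun x => t (D.mart m f i x) (D.martDiff m g i x) :=
    ((hf.mart (m := m) i).mono (by lia)).comp₂ (hg.martDiff (m := m) i)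
      (fun a b => t a b) (by simp)
  have h2 : D.IsStep (m + (i + 1)) fun x => t (D.martDiff m f i x) (D.mart m g i x) :=
    (hf.martDiff (m := m) i).comp₂ ((hg.mart (m := m) i).mono (by lia))
      (fun a b => t a b) (by simp)
  exact h1.add h2

omit [CompleteSpace X] [CompleteSpace Z] [NormedSpace ℝ E] [CompleteSpace E] in
theorem IsStep.paraTensor {k l : ℤ} (hf : D.IsStep k f) (hg : D.IsStep l g) (n : ℕ) :
    D.IsStep (m + n) (D.paraTensor t m f g n) := by
  have : D.paraTensor t m f g n = ∑ i ∈ Finset.range n, fun x =>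
      (t (D.mart m f i x) (D.martDiff m g i x)
        + t (D.martDiff m f i x) (D.mart m g i x)) := by
    ext1 x
    rw [DyadicSystem.paraTensor, Finset.sum_apply]
  rw [this]
  refine IsStep.sum _ fun i hi => ?_
  rw [Finset.mem_range] at hi
  exact (IsStep.paraTensor_term hf hg i).mono (by lia)

theorem avg_martDiff {F : Type*} [NormedAddCommGroup F] [NormedSpace ℝ F] [CompleteSpace F]
    {f : EuclideanSpace ℝ (Fin d) → F} {k : ℤ} (hf : D.IsStep k f) (i : ℕ) :
    D.avg (m + i) (D.martDiff m f i) = 0 := by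
  rw [martDiff, avg_sub _ (hf.mart _).locallyIntegrable (hf.mart _).locallyIntegrable, mart, mart,
    avg_avg_of_le hf.locallyIntegrable (by lia), avg_avg_of_le hf.locallyIntegrable le_rfl,
    sub_self]

/-- In each of the two added terms one factor is constant on the cubes of generation `m + i` and the
other has mean zero there, so the partial sums form a martingale. -/
theorem avg_paraTensor_succ {k l : ℤ} (hf : D.IsStep k f) (hg : D.IsStep l g) (i : ℕ) :
    D.avg (m + i) (D.paraTensor t m f g (i + 1)) = D.paraTensor t m f g i := by
  have h1 : D.paraTensor t m f g (i + 1) = D.paraTensor t m f g i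
      + ((fun x => t (D.mart m f i x) (D.martDiff m g i x))
      + fun x => t.flip (D.mart m g i x) (D.martDiff m f i x)) := by
    ext1 x
    simp only [DyadicSystem.paraTensor, Finset.sum_range_succ, Pi.add_apply, ContinuousLinearMap.flip_apply]
  have hs1 : D.IsStep (m + i) (fun x => t (D.mart m f i x)) :=
    (hf.mart i).comp _ (map_zero _)
  have hs2 : D.IsStep (m + i) (fun x => t.flip (D.mart m g i x)) :=
    (hg.mart i).comp _ (map_zero t.flip)
  have hl1 := (hs1.integrable_clm_apply
    (hg.martDiff (m := m) i).locallyIntegrable).locallyIntegrable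
  have hl2 := (hs2.integrable_clm_apply
    (hf.martDiff (m := m) i).locallyIntegrable).locallyIntegrable
  rw [h1, avg_add _ (IsStep.paraTensor hf hg i).locallyIntegrable (hl1.add hl2),
    avg_add _ hl1 hl2, (IsStep.paraTensor hf hg i).const.avg_eq_self,
    avg_clm_apply hs1.const (hg.martDiff i).locallyIntegrable,
    avg_clm_apply hs2.const (hf.martDiff i).locallyIntegrable, avg_martDiff hf, avg_martDiff hg]
  ext1 x
  simp

theorem avg_paraTensor {k l : ℤ} (hf : D.IsStep k f) (hg : D.IsStep l g) {i n : ℕ} (hi : i ≤ n) :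
    D.avg (m + i) (D.paraTensor t m f g n) = D.paraTensor t m f g i := by
  induction n, hi using Nat.le_induction with
  | base => exact (IsStep.paraTensor hf hg i).const.avg_eq_self
  | succ n hi ih =>
    rw [← avg_avg_of_le (IsStep.paraTensor hf hg _).locallyIntegrable
      (show m + i ≤ m + n by lia), avg_paraTensor_succ hf hg, ih]

theorem avg_paraTensor_zero {k l : ℤ} (hf : D.IsStep k f) (hg : D.IsStep l g) (n : ℕ) :
    D.avg m (D.paraTensor t m f g n) = 0 := by
  have h := avg_paraTensor (t := t) (m := m) hf hg (Nat.zero_le n)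
  rw [Nat.cast_zero, add_zero] at h
  rw [h]
  ext1 x
  simp [DyadicSystem.paraTensor]

theorem iSup_enorm_avg_le {F : Type*} [NormedAddCommGroup F] [NormedSpace ℝ F] [CompleteSpace F]
    {h : EuclideanSpace ℝ (Fin d) → F} (hh : D.IsStep (m + n) h) (h0 : D.avg m h = 0)
    {x : EuclideanSpace ℝ (Fin d)} {C : ℝ≥0∞} (hC : ∀ i ≤ n, ‖D.mart m h i x‖ₑ ≤ C) :
    ⨆ k : ℤ, ‖D.avg k h x‖ₑ ≤ C := by
  refine iSup_le fun k => ?_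
  rcases le_total k m with hk | hk
  · rw [avg_eq_zero_of_le hh.locallyIntegrable h0 hk]
    simp
  rcases le_total k (m + n) with hk' | hk'
  · have := hC (k - m).toNat (by lia)
    rwa [mart, show m + ((k - m).toNat : ℤ) = k by lia] at this
  · have := hC n le_rfl
    rwa [mart, hh.const.avg_eq_self, ← (hh.const.mono hk').avg_eq_self] at this

/-- The `ℓ^p` average over all signs of the signed sums of martingale differences. -/
noncomputable def signedSquare {F : Type*} [NormedAddCommGroup F] [NormedSpace ℝ F]
    (D : DyadicSystem d) (m : ℤ) (n : ℕ) (p : ℝ) (f : EuclideanSpace ℝ (Fin d) → F) :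
    EuclideanSpace ℝ (Fin d) → ℝ := fun x =>
  (∑ S ∈ (Finset.range n).powerset,
    ‖∑ i ∈ Finset.range n, signOn S i • D.martDiff m f i x‖ ^ p) ^ (1 / p)

theorem IsStep.signedSquare {F : Type*} [NormedAddCommGroup F] [NormedSpace ℝ F]
    {h : EuclideanSpace ℝ (Fin d) → F} {k : ℤ} (hh : D.IsStep k h) {p : ℝ} (hp : 0 < p) :
    D.IsStep (m + n) (D.signedSquare m n p h) := by
  have h1 : D.IsStep (m + n) (∑ S ∈ (Finset.range n).powerset, fun x =>
      ‖(∑ i ∈ Finset.range n, signOn S i • D.martDiff m h i) x‖ ^ p) := by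
    refine IsStep.sum _ fun S _ => IsStep.comp (IsStep.sum _ fun i hi => ?_) (‖·‖ ^ p)
      (by simp [hp.ne'])
    rw [Finset.mem_range] at hi
    exact ((hh.martDiff i).mono (by lia)).comp (fun y => signOn S i • y) (smul_zero _)
  have h2 := h1.comp (· ^ (1 / p)) (Real.zero_rpow (by positivity))
  convert! h2 using 1
  ext x
  simp only [DyadicSystem.signedSquare, Finset.sum_apply, Pi.smul_apply]

/-- Interchange the integral with the sum over the `2 ^ n` sign patterns. The power of `2 ^ n`
remains because the definition sums over the patterns without normalising. -/
theorem eLpNorm_signedSquare_le {F : Type*} [NormedAddCommGroup F] [NormedSpace ℝ F]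
    {h : EuclideanSpace ℝ (Fin d) → F} {k : ℤ} (hh : D.IsStep k h) {p : ℝ} (hp : 0 < p) {C : ℝ≥0∞}
    (hC : ∀ ε : ℕ → ℝ, (∀ i, ε i = 1 ∨ ε i = -1) →
      eLpNorm (∑ i ∈ Finset.range n, ε i • D.martDiff m h i) (ENNReal.ofReal p) volume ≤ C) :
    eLpNorm (D.signedSquare m n p h) (ENNReal.ofReal p) volume ≤ (2 ^ n) ^ (1 / p) * C := by
  have h1 : ∀ x, ‖D.signedSquare m n p h x‖ₑ ^ p = ∑ S ∈ (Finset.range n).powerset,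
      ‖(∑ i ∈ Finset.range n, signOn S i • D.martDiff m h i) x‖ₑ ^ p := fun x => by
    have hnn : 0 ≤ ∑ S ∈ (Finset.range n).powerset,
      ‖∑ i ∈ Finset.range n, signOn S i • D.martDiff m h i x‖ ^ p :=
      Finset.sum_nonneg fun _ _ => by positivity
    rw [DyadicSystem.signedSquare, Real.enorm_of_nonneg (by positivity),
      ← ENNReal.ofReal_rpow_of_nonneg hnn (by positivity), one_div, ENNReal.rpow_inv_rpow hp.ne',
      ENNReal.ofReal_sum_of_nonneg fun _ _ => by positivity]
    refine Finset.sum_congr rfl fun S _ => ?_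
    rw [← ENNReal.ofReal_rpow_of_nonneg (norm_nonneg _) hp.le, ofReal_norm]
    simp
  rw [eLpNorm_ofReal_eq_lintegral_rpow _ hp]
  simp only [h1]
  rw [lintegral_finsetSum']
  · calc _ ≤ (∑ S ∈ (Finset.range n).powerset, C ^ p) ^ (1 / p) := by
          refine ENNReal.rpow_le_rpow (Finset.sum_le_sum fun S _ => ?_) (by positivity)
          rw [← eLpNorm_ofReal_rpow _ hp]
          exact ENNReal.rpow_le_rpow (hC _ (signOn_eq_or S)) hp.le
      _ = _ := by
          rw [Finset.sum_const, Finset.card_powerset, Finset.card_range, nsmul_eq_mul,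
            ENNReal.mul_rpow_of_nonneg _ _ (by positivity), one_div, ENNReal.rpow_rpow_inv hp.ne']
          norm_cast
  · intro S _
    refine AEMeasurable.pow_const (AEStronglyMeasurable.enorm ?_) _
    exact (Finset.aestronglyMeasurable_sum _ fun i _ =>
      ((hh.martDiff i).stronglyMeasurable.const_smul _).aestronglyMeasurable)

omit [CompleteSpace X] [CompleteSpace Z] [CompleteSpace E] in
theorem enorm_paraTensor_le (ht : ∀ x y, ‖t x y‖ ≤ ‖x‖ * ‖y‖) {p q : ℝ}
    (hpq : p.HolderConjugate q) (hf0 : D.avg m f = 0)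
    {i n : ℕ} (hi : i ≤ n) (x : EuclideanSpace ℝ (Fin d)) :
    ‖D.paraTensor t m f g i x‖ₑ ≤ ‖D.martMax m f n x‖ₑ * ‖D.martMax m g n x‖ₑ
      + (2 ^ n)⁻¹ * (‖D.signedSquare m n p f x‖ₑ * ‖D.signedSquare m n q g x‖ₑ) := by
  rw [paraTensor_eq hf0, sub_eq_add_neg]
  refine le_trans (enorm_add_le _ _) (add_le_add ?_ ?_)
  · rw [Real.enorm_of_nonneg (martMax_nonneg _ _ _ _), Real.enorm_of_nonneg
      (martMax_nonneg _ _ _ _), ← ENNReal.ofReal_mul (martMax_nonneg _ _ _ _), ← ofReal_norm]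
    refine ENNReal.ofReal_le_ofReal ((ht _ _).trans ?_)
    gcongr
    · exact martMax_nonneg _ _ _ _
    · exact norm_mart_le_martMax m f hi x
    · exact norm_mart_le_martMax m g hi x
  · have h := norm_sum_bilinear_le_signOn (t := t.toRealBilin) hi hpq ht
      (fun j => D.martDiff m f j x) (fun j => D.martDiff m g j x)
    have h2 : (2 : ℝ≥0∞) ^ n = ENNReal.ofReal (2 ^ n) := by
      rw [ENNReal.ofReal_pow zero_le_two, ENNReal.ofReal_ofNat]
    rw [enorm_neg, ← ENNReal.mul_le_iff_le_inv (by simp) (by finiteness), h2, ← ofReal_norm,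
      ← ENNReal.ofReal_mul (by positivity), ← enorm_mul, Real.enorm_of_nonneg (by
        rw [DyadicSystem.signedSquare, DyadicSystem.signedSquare]
        positivity)]
    exact ENNReal.ofReal_le_ofReal h

theorem hardyNorm_paraTensor_le (ht : ∀ x y, ‖t x y‖ ≤ ‖x‖ * ‖y‖) {p q : ℝ}
    (hpq : p.HolderConjugate q) {βX βZ : ℝ} (hβX0 : 0 ≤ βX) (hβZ0 : 0 ≤ βZ)
    (hf : D.IsStep (m + n) f) (hg : D.IsStep (m + n) g)
    (hβX : ∀ ε : ℕ → ℝ, (∀ i, ε i = 1 ∨ ε i = -1) →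
      eLpNorm (∑ i ∈ Finset.range n, ε i • D.martDiff m f i) (ENNReal.ofReal p) volume
        ≤ ENNReal.ofReal βX * eLpNorm f (ENNReal.ofReal p) volume)
    (hβZ : ∀ ε : ℕ → ℝ, (∀ i, ε i = 1 ∨ ε i = -1) →
      eLpNorm (∑ i ∈ Finset.range n, ε i • D.martDiff m g i) (ENNReal.ofReal q) volume
        ≤ ENNReal.ofReal βZ * eLpNorm g (ENNReal.ofReal q) volume)
    (hf0 : D.avg m f = 0) (hg0 : D.avg m g = 0) :
    D.hardyNorm (D.paraTensor t m f g n) ≤ ENNReal.ofReal (p * q + βX * βZ) *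
      (eLpNorm f (ENNReal.ofReal p) volume * eLpNorm g (ENNReal.ofReal q) volume) := by
  have hMf := hf.martMax (m := m) n
  have hMg := hg.martMax (m := m) n
  have hSf := hf.signedSquare (m := m) (n := n) hpq.pos
  have hSg := hg.signedSquare (m := m) (n := n) hpq.symm.pos
  have hH := IsStep.paraTensor (t := t) (m := m) hf hg n
  calc D.hardyNorm (D.paraTensor t m f g n)
      ≤ ∫⁻ x, (‖D.martMax m f n x‖ₑ * ‖D.martMax m g n x‖ₑ
        + (2 ^ n)⁻¹ * (‖D.signedSquare m n p f x‖ₑ * ‖D.signedSquare m n q g x‖ₑ)) := by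
        refine lintegral_mono fun x => iSup_enorm_avg_le hH (avg_paraTensor_zero hf hg n)
          fun i hi => ?_
        rw [mart, avg_paraTensor hf hg hi]
        exact enorm_paraTensor_le ht hpq hf0 hi x
    _ = (∫⁻ x, ‖D.martMax m f n x‖ₑ * ‖D.martMax m g n x‖ₑ) + (2 ^ n)⁻¹ *
        ∫⁻ x, ‖D.signedSquare m n p f x‖ₑ * ‖D.signedSquare m n q g x‖ₑ := by
        have hmeas : Measurable fun x => ‖D.martMax m f n x‖ₑ * ‖D.martMax m g n x‖ₑ :=
          hMf.stronglyMeasurable.enorm.mul hMg.stronglyMeasurable.enorm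
        rw [lintegral_add_left hmeas,
          lintegral_const_mul' _ _ (by simp)]
    -- Doob's constant in `L^p` is the conjugate exponent, so `f` contributes `q` and `g`
    -- contributes `p`.
    _ ≤ (ENNReal.ofReal q * eLpNorm f (ENNReal.ofReal p) volume) *
          (ENNReal.ofReal p * eLpNorm g (ENNReal.ofReal q) volume) + (2 ^ n)⁻¹ *
        (((2 ^ n) ^ (1 / p) * (ENNReal.ofReal βX * eLpNorm f (ENNReal.ofReal p) volume)) *
        ((2 ^ n) ^ (1 / q) * (ENNReal.ofReal βZ * eLpNorm g (ENNReal.ofReal q) volume))) := by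
        gcongr
        · refine (lintegral_enorm_mul_le_eLpNorm_mul_eLpNorm hpq
            hMf.stronglyMeasurable.aestronglyMeasurable
            hMg.stronglyMeasurable.aestronglyMeasurable).trans ?_
          gcongr
          · exact eLpNorm_martMax_le hpq hf hf0
          · exact eLpNorm_martMax_le hpq.symm hg hg0
        · refine (lintegral_enorm_mul_le_eLpNorm_mul_eLpNorm hpq
            hSf.stronglyMeasurable.aestronglyMeasurable
            hSg.stronglyMeasurable.aestronglyMeasurable).trans ?_
          gcongr
          · exact eLpNorm_signedSquare_le hf hpq.pos hβX
          · exact eLpNorm_signedSquare_le hg hpq.symm.pos hβZ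
    _ = _ := by
        have h2 : (2 ^ n : ℝ≥0∞) ^ (1 / p) * (2 ^ n) ^ (1 / q) = 2 ^ n := by
          rw [← ENNReal.rpow_add _ _ (by simp) (by finiteness), one_div, one_div,
            hpq.inv_add_inv_eq_one, ENNReal.rpow_one]
        have h3 : (2 ^ n : ℝ≥0∞)⁻¹ * 2 ^ n = 1 := ENNReal.inv_mul_cancel (by simp) (by finiteness)
        rw [ENNReal.ofReal_add (mul_nonneg hpq.nonneg hpq.symm.nonneg)
          (mul_nonneg hβX0 hβZ0), ENNReal.ofReal_mul hpq.nonneg, ENNReal.ofReal_mul hβX0]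
        calc _ = ENNReal.ofReal p * ENNReal.ofReal q * (eLpNorm f (ENNReal.ofReal p) volume
              * eLpNorm g (ENNReal.ofReal q) volume) + ((2 ^ n : ℝ≥0∞)⁻¹ *
              ((2 ^ n : ℝ≥0∞) ^ (1 / p) * (2 ^ n) ^ (1 / q))) * (ENNReal.ofReal βX *
              ENNReal.ofReal βZ) * (eLpNorm f (ENNReal.ofReal p) volume
              * eLpNorm g (ENNReal.ofReal q) volume) := by ring
          _ = _ := by rw [h2, h3, one_mul, ← add_mul]

end Hardy

end DyadicSystem

/-! ### `H^1`-BMO duality for step functions by stopping times -/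

theorem sum_geometric_indicator_le (t : ℝ) (ht : 0 ≤ t) {ε : ℝ} (hε : 0 < ε) (N : ℕ) :
    ∑ i ∈ Finset.range N, (if ε * 2 ^ i < t then ε * 2 ^ i else 0) ≤ 2 * t := by
  have h1 : ∀ N : ℕ, ∑ i ∈ Finset.range N, (if ε * 2 ^ i < t then ε * 2 ^ i else 0)
      ≤ ε * 2 ^ N := fun N => by
    induction N with
    | zero => simpa using hε.le
    | succ N ih =>
      rw [Finset.sum_range_succ, pow_succ]
      have : (if ε * 2 ^ N < t then ε * 2 ^ N else 0) ≤ ε * 2 ^ N := by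
        split_ifs
        · exact le_rfl
        · positivity
      linarith
  induction N with
  | zero => simpa using ht
  | succ N ih =>
    rw [Finset.sum_range_succ]
    split_ifs with h
    · linarith [h1 N]
    · linarith

namespace DyadicSystem

section Indicator

variable {d : ℕ} {D : DyadicSystem d} {F : Type*} [NormedAddCommGroup F] {k : ℤ}
  {S : Set (EuclideanSpace ℝ (Fin d))} {f : EuclideanSpace ℝ (Fin d) → F}

theorem IsUnionOfCubes.inter {S T : Set (EuclideanSpace ℝ (Fin d))} (hS : D.IsUnionOfCubes k S)
    (hT : D.IsUnionOfCubes k T) : D.IsUnionOfCubes k (S ∩ T) :=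
  fun x hx => Set.subset_inter (hS x hx.1) (hT x hx.2)

theorem IsStep.indicator (hS : D.IsUnionOfCubes k S) (hf : D.IsStep k f) :
    D.IsStep k (S.indicator f) := by
  refine ⟨fun x y hy => ?_, hf.bounded.subset ?_⟩
  swap
  · rw [Set.support_indicator]
    exact Set.inter_subset_right
  by_cases hx : x ∈ S
  · rw [Set.indicator_of_mem hx, Set.indicator_of_mem (hS x hx hy), hf.const x y hy]
  · rw [Set.indicator_of_notMem hx, Set.indicator_of_notMem (hS.compl x hx hy)]

theorem avg_indicator_eq_zero [NormedSpace ℝ F] (hS : D.IsUnionOfCubes k S)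
    (hf : D.avg k f = 0) : D.avg k (S.indicator f) = 0 := by
  ext1 x
  by_cases hx : x ∈ S
  · rw [avg_congr_on_cube (g := f) fun y hy => Set.indicator_of_mem (hS x hx hy) f, hf]
  · rw [avg_congr_on_cube (g := 0) fun y hy => Set.indicator_of_notMem (hS.compl x hx hy) f,
      avg_zero]

theorem setLIntegral_enorm_sub_avg_le [NormedSpace ℝ F] {b : EuclideanSpace ℝ (Fin d) → F}
    (hS : D.IsUnionOfCubes k S) :
    ∫⁻ y in S, ‖b y - D.avg k b y‖ₑ ≤ D.bmoNorm b * volume S := by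
  rw [← setLIntegral_const]
  refine hS.setLIntegral_le fun x _ => ?_
  rw [setLIntegral_const, setLIntegral_congr_fun
    (g := fun y => ‖b y - ⨍ z in D.cubeAt k x, b z‖ₑ) (D.measurableSet_cubeAt k x)
    fun y hy => by simp only [isCubewiseConst_avg k b x y hy]; rfl]
  have h : (volume (D.cubeAt k x))⁻¹ * ∫⁻ y in D.cubeAt k x, ‖b y - ⨍ z in D.cubeAt k x, b z‖ₑ
      ≤ D.bmoNorm b :=
    le_iSup_of_le k (le_iSup₂_of_le (D.cubeAt k x) (D.cubeAt_mem k x) le_rfl)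
  rwa [← ENNReal.div_eq_inv_mul, ENNReal.div_le_iff (D.volume_cubeAt_ne_zero k x)
    (D.volume_cubeAt_ne_top k x)] at h

end Indicator

section Stopping

variable {d : ℕ} {D : DyadicSystem d} {E : Type*} [NormedAddCommGroup E] [NormedSpace ℝ E]
  {m : ℤ} {n : ℕ} {h : EuclideanSpace ℝ (Fin d) → E}

/-- The set on which the dyadic martingale of `h` has not been stopped by time `i`, where one stops
as soon as the next value exceeds `c` somewhere on the current cube. -/
def notStopped (D : DyadicSystem d) (m : ℤ) (h : EuclideanSpace ℝ (Fin d) → E) (c : ℝ) (i : ℕ) :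
    Set (EuclideanSpace ℝ (Fin d)) :=
  {x | ∀ j ≤ i, ∀ y ∈ D.cubeAt (m + j) x, ‖D.mart m h (j + 1) y‖ ≤ c}

/-- The martingale of `h`, stopped at the level `c`. -/
noncomputable def stopped (D : DyadicSystem d) (m : ℤ) (h : EuclideanSpace ℝ (Fin d) → E) (c : ℝ)
    (n : ℕ) : EuclideanSpace ℝ (Fin d) → E :=
  ∑ i ∈ Finset.range n, (D.notStopped m h c i).indicator (D.martDiff m h i)

theorem isUnionOfCubes_notStopped (c : ℝ) (i : ℕ) :
    D.IsUnionOfCubes (m + i) (D.notStopped m h c i) := fun x hx y hy j hj => by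
  rw [D.cubeAt_congr (D.cubeAt_anti (by lia) x hy)]
  exact hx j hj

theorem notStopped_anti (c : ℝ) {i j : ℕ} (hij : i ≤ j) :
    D.notStopped m h c j ⊆ D.notStopped m h c i :=
  fun _ hx l hl => hx l (hl.trans hij)

theorem notStopped_mono {c c' : ℝ} (hc : c ≤ c') (i : ℕ) :
    D.notStopped m h c i ⊆ D.notStopped m h c' i :=
  fun _ hx l hl y hy => (hx l hl y hy).trans hc

/-- Stopping happens one step before the level could be exceeded, so the stopped values never
overshoot. The induction also carries the fact that before stopping one sees the original
martingale. -/
theorem norm_stopped_le (h0 : D.avg m h = 0) {c : ℝ} (hc : 0 ≤ c) (n : ℕ)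
    (x : EuclideanSpace ℝ (Fin d)) : ‖D.stopped m h c n x‖ ≤ c := by
  suffices H : ‖D.stopped m h c n x‖ ≤ c ∧
      ((∀ i < n, x ∈ D.notStopped m h c i) → D.stopped m h c n x = D.mart m h n x) from H.1
  induction n with
  | zero => simp [stopped, mart_zero_eq h0, hc]
  | succ n ih =>
    have hs : D.stopped m h c (n + 1) x
        = D.stopped m h c n x + (D.notStopped m h c n).indicator (D.martDiff m h n) x := by
      simp only [stopped, Finset.sum_range_succ, Pi.add_apply]
    by_cases hx : x ∈ D.notStopped m h c n
    · have h1 := ih.2 fun i hi => notStopped_anti c hi.le hx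
      have h2 : D.stopped m h c (n + 1) x = D.mart m h (n + 1) x := by
        rw [hs, h1, Set.indicator_of_mem hx, martDiff, Pi.sub_apply, add_sub_cancel]
      exact ⟨h2 ▸ hx n le_rfl x (D.mem_cubeAt_self _ x), fun _ => h2⟩
    · refine ⟨?_, fun H => absurd (H n (Nat.lt_succ_self n)) hx⟩
      rw [hs, Set.indicator_of_notMem hx, add_zero]
      exact ih.1

theorem stopped_eq [CompleteSpace E] (hh : D.IsStep (m + n) h) (h0 : D.avg m h = 0) {c : ℝ}
    (hc : ∀ x, ‖h x‖ ≤ c) : D.stopped m h c n = h := by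
  have h1 : ∀ i, D.notStopped m h c i = Set.univ := fun i =>
    Set.eq_univ_of_forall fun x j _ y _ => norm_avg_le_of_bound hc _ y
  simp only [stopped, h1, Set.indicator_univ]
  rw [sum_martDiff, mart_zero_eq h0, hh.mart_eq, sub_zero]

theorem IsStep.stopped {k : ℤ} (hh : D.IsStep k h) (c : ℝ) (n : ℕ) :
    D.IsStep (m + n) (D.stopped m h c n) := IsStep.sum _ fun i hi => by
  rw [Finset.mem_range] at hi
  exact (hh.martDiff i).mono (by lia) |>.indicator
    ((isUnionOfCubes_notStopped c i).mono (by lia))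

/-- The set on which the martingale of `h` is stopped at the time `i`. -/
def stopSet (D : DyadicSystem d) (m : ℤ) (h : EuclideanSpace ℝ (Fin d) → E) (c : ℝ) (i : ℕ) :
    Set (EuclideanSpace ℝ (Fin d)) :=
  {x | x ∉ D.notStopped m h c i ∧ ∀ j < i, x ∈ D.notStopped m h c j}

theorem isUnionOfCubes_stopSet (c : ℝ) (i : ℕ) :
    D.IsUnionOfCubes (m + i) (D.stopSet m h c i) := fun x hx y hy =>
  ⟨(isUnionOfCubes_notStopped c i).compl x hx.1 hy, fun j hj =>
    ((isUnionOfCubes_notStopped c j).mono (by lia)) x (hx.2 j hj) hy⟩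

theorem disjoint_stopSet (c : ℝ) {i j : ℕ} (hij : i ≠ j) :
    Disjoint (D.stopSet m h c i) (D.stopSet m h c j) := by
  rw [Set.disjoint_left]
  intro x hi hj
  rcases lt_or_gt_of_ne hij with h | h
  · exact hi.1 (hj.2 i h)
  · exact hj.1 (hi.2 j h)

theorem exists_mem_stopSet {c : ℝ} {i : ℕ} {x : EuclideanSpace ℝ (Fin d)}
    (hx : x ∉ D.notStopped m h c i) : ∃ j ≤ i, x ∈ D.stopSet m h c j := by
  classical
  have hex : ∃ j, x ∉ D.notStopped m h c j := ⟨i, hx⟩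
  exact ⟨Nat.find hex, Nat.find_min' hex hx, Nat.find_spec hex,
    fun j hj => not_not.1 (Nat.find_min hex hj)⟩

/-- Every cube of generation `m + i` in the stopping set has a child on which the next value exceeds
`c`. Stopping one step early thus costs only the volume ratio `2 ^ d`. -/
theorem volume_stopSet_le (c : ℝ) {i : ℕ} (hi : i < n) :
    volume (D.stopSet m h c i)
      ≤ 2 ^ d * volume (D.stopSet m h c i ∩ {x | c < D.martMax m h n x}) := by
  set T := {x | c < D.martMax m h n x}
  have hmain : ∫⁻ _ in D.stopSet m h c i, 1
      ≤ ∫⁻ x in D.stopSet m h c i, T.indicator (fun _ => 2 ^ d) x := by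
    refine (isUnionOfCubes_stopSet c i).setLIntegral_le fun x hx => ?_
    obtain ⟨y, hy, hyc⟩ : ∃ y ∈ D.cubeAt (m + i) x, c < ‖D.mart m h (i + 1) y‖ := by
      by_contra! H
      refine hx.1 fun j hj y hy => ?_
      rcases hj.lt_or_eq with hj | rfl
      · exact hx.2 j hj j le_rfl y hy
      · exact H y hy
    have hsub : D.cubeAt (m + i + 1) y ⊆ D.cubeAt (m + i) x := by
      rw [← D.cubeAt_congr hy]
      exact D.cubeAt_succ_subset _ y
    calc ∫⁻ _ in D.cubeAt (m + i) x, 1 = 2 ^ d * volume (D.cubeAt (m + i + 1) y) := by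
          rw [setLIntegral_one, D.volume_cubeAt_eq_two_pow_mul _ x y]
      _ = ∫⁻ z in D.cubeAt (m + i + 1) y, T.indicator (fun _ => 2 ^ d) z := by
          rw [← setLIntegral_const]
          refine setLIntegral_congr_fun (D.measurableSet_cubeAt _ _) fun z hz => ?_
          rw [Set.indicator_of_mem]
          refine lt_of_lt_of_le ?_ (norm_mart_le_martMax m h (Nat.succ_le_of_lt hi) z)
          have : D.mart m h (i + 1) z = D.mart m h (i + 1) y := by
            refine isCubewiseConst_avg _ h y z ?_
            rwa [Nat.cast_succ, ← add_assoc]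
          rwa [this]
      _ ≤ _ := lintegral_mono_set hsub
  rw [setLIntegral_one] at hmain
  refine hmain.trans ((lintegral_indicator_const_le _ _).trans ?_)
  rw [Measure.restrict_apply' (isUnionOfCubes_stopSet c i).measurableSet, Set.inter_comm]

theorem measurableSet_lt_martMax {k : ℤ} (hh : D.IsStep k h) (c : ℝ) (n : ℕ) :
    MeasurableSet {x | c < D.martMax m h n x} :=
  measurableSet_lt measurable_const (hh.martMax (m := m) n).stronglyMeasurable.measurable

theorem sum_volume_stopSet_le {k : ℤ} (hh : D.IsStep k h) (c : ℝ) (n : ℕ) :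
    ∑ i ∈ Finset.range n, volume (D.stopSet m h c i)
      ≤ 2 ^ d * volume {x | c < D.martMax m h n x} := by
  calc _ ≤ ∑ i ∈ Finset.range n,
        2 ^ d * volume (D.stopSet m h c i ∩ {x | c < D.martMax m h n x}) :=
        Finset.sum_le_sum fun i hi => volume_stopSet_le c (Finset.mem_range.1 hi)
    _ = 2 ^ d * volume (⋃ i ∈ Finset.range n,
        (D.stopSet m h c i ∩ {x | c < D.martMax m h n x})) := by
        rw [← Finset.mul_sum, measure_biUnion_finset]
        · exact fun i _ j _ hij => (disjoint_stopSet c hij).mono Set.inter_subset_left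
            Set.inter_subset_left
        · exact fun i _ => (isUnionOfCubes_stopSet c i).measurableSet.inter
            (measurableSet_lt_martMax hh c n)
    _ ≤ _ := by
        gcongr
        exact Set.iUnion₂_subset fun i _ => Set.inter_subset_right

variable [CompleteSpace E]

omit [CompleteSpace E] in
-- The two stopped martingales coincide until the lower level stops, so their difference lives on
-- the disjoint stopping sets of the lower level.
theorem stopped_sub_stopped_eq (c c' : ℝ) (hc : c ≤ c') (n : ℕ) :
    D.stopped m h c' n - D.stopped m h c n
      = ∑ i ∈ Finset.range n,
        (D.stopSet m h c i).indicator (D.stopped m h c' n - D.stopped m h c n) := by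
  ext1 x
  rw [Finset.sum_apply]
  by_cases hx : ∃ i < n, x ∉ D.notStopped m h c i
  · obtain ⟨i, hi, hxi⟩ := hx
    obtain ⟨j, hj, hxj⟩ := exists_mem_stopSet hxi
    rw [Finset.sum_eq_single j, Set.indicator_of_mem hxj]
    · exact fun l _ hl => Set.indicator_of_notMem
        (Set.disjoint_left.1 (disjoint_stopSet c hl.symm) hxj) _
    · exact fun H => absurd (Finset.mem_range.2 (hj.trans_lt hi)) H
  · push Not at hx
    rw [Finset.sum_eq_zero, Pi.sub_apply, sub_eq_zero]
    · simp only [stopped, Finset.sum_apply]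
      refine Finset.sum_congr rfl fun i hi => ?_
      rw [Finset.mem_range] at hi
      rw [Set.indicator_of_mem (hx i hi), Set.indicator_of_mem (notStopped_mono hc i (hx i hi))]
    · intro i hi
      rw [Finset.mem_range] at hi
      exact Set.indicator_of_notMem (fun H => H.1 (hx i hi)) _

/-- On the set stopped at time `i` only the differences with index `j ≥ i` survive. Each is
restricted to a union of cubes of generation `m + j`, which preserves its mean zero. This is the
cancellation of an atom. -/
theorem avg_indicator_stopSet {k : ℤ} (hh : D.IsStep k h) (c c' : ℝ) (hc : c ≤ c') (i n : ℕ) :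
    D.avg (m + i) ((D.stopSet m h c i).indicator (D.stopped m h c' n - D.stopped m h c n)) = 0 := by
  have h1 : (D.stopSet m h c i).indicator (D.stopped m h c' n - D.stopped m h c n)
      = ∑ j ∈ Finset.range n, if i ≤ j then
        (D.stopSet m h c i ∩ D.notStopped m h c' j).indicator (D.martDiff m h j) else 0 := by
    ext1 x
    rw [Finset.sum_apply]
    by_cases hx : x ∈ D.stopSet m h c i
    · rw [Set.indicator_of_mem hx]
      simp only [stopped, Pi.sub_apply, Finset.sum_apply, ← Finset.sum_sub_distrib]
      refine Finset.sum_congr rfl fun j _ => ?_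
      split_ifs with hij
      · rw [Set.indicator_of_notMem fun H => hx.1 (notStopped_anti c hij H), sub_zero]
        by_cases hx' : x ∈ D.notStopped m h c' j
        · rw [Set.indicator_of_mem hx', Set.indicator_of_mem (Set.mem_inter hx hx')]
        · rw [Set.indicator_of_notMem hx', Set.indicator_of_notMem fun H => hx' H.2]
      · have := hx.2 j (not_le.1 hij)
        rw [Set.indicator_of_mem this, Set.indicator_of_mem (notStopped_mono hc j this), sub_self,
          Pi.zero_apply]
    · rw [Set.indicator_of_notMem hx, Finset.sum_eq_zero]
      intro j _
      split_ifs
      · exact Set.indicator_of_notMem (fun H => hx H.1) _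
      · rfl
  rw [h1]
  have hz : ∀ j ∈ Finset.range n, D.IsStep (m + n) (if i ≤ j then
        (D.stopSet m h c i ∩ D.notStopped m h c' j).indicator (D.martDiff m h j) else 0) ∧
      D.avg (m + i) (if i ≤ j then
        (D.stopSet m h c i ∩ D.notStopped m h c' j).indicator (D.martDiff m h j) else 0) = 0 := by
    intro j hj
    rw [Finset.mem_range] at hj
    split_ifs with hij
    · have hU : D.IsUnionOfCubes (m + j) (D.stopSet m h c i ∩ D.notStopped m h c' j) :=
        ((isUnionOfCubes_stopSet c i).mono (by lia)).inter (isUnionOfCubes_notStopped c' j)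
      have hs := IsStep.indicator (hU.mono (by lia : m + j ≤ m + n))
        ((hh.martDiff (m := m) j).mono (by lia))
      refine ⟨hs, ?_⟩
      exact avg_eq_zero_of_le hs.locallyIntegrable
        (avg_indicator_eq_zero hU (avg_martDiff hh j)) (by lia)
    · exact ⟨IsStep.zero, avg_zero _⟩
  exact (Finset.sum_induction _ (fun φ => D.IsStep (m + n) φ ∧ D.avg (m + i) φ = 0)
    (fun φ ψ hφ hψ => ⟨hφ.1.add hψ.1, by
      rw [avg_add _ hφ.1.locallyIntegrable hψ.1.locallyIntegrable, hφ.2, hψ.2, add_zero]⟩)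
    ⟨IsStep.zero, avg_zero _⟩ hz).2

variable {𝕜 : Type*} [RCLike 𝕜] [NormedSpace 𝕜 E]
  {F : Type*} [NormedAddCommGroup F] [NormedSpace ℝ F] [NormedSpace 𝕜 F] [CompleteSpace F]
  {B : E →L[𝕜] StrongDual 𝕜 F}

omit [NormedSpace ℝ E] [CompleteSpace E] [NormedSpace ℝ F] [CompleteSpace F] in
theorem enorm_pairing_le (hB : ∀ v u, ‖B v u‖ ≤ ‖v‖ * ‖u‖) (v : E) (u : F) :
    ‖B v u‖ₑ ≤ ‖v‖ₑ * ‖u‖ₑ := by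
  rw [← ofReal_norm, ← ofReal_norm, ← ofReal_norm, ← ENNReal.ofReal_mul (norm_nonneg _)]
  exact ENNReal.ofReal_le_ofReal (hB v u)

omit [CompleteSpace F] in
-- The pairing of an atom with a BMO function: its cancellation allows `b` to be replaced by `b -
-- 𝔼_k b`, whose integral over `S` the BMO norm controls.
theorem enorm_integral_pairing_le_of_avg_eq_zero (hB : ∀ v u, ‖B v u‖ ≤ ‖v‖ * ‖u‖)
    {b : EuclideanSpace ℝ (Fin d) → F} (hb : LocallyIntegrable b) {k l : ℤ}
    {S : Set (EuclideanSpace ℝ (Fin d))} (hS : D.IsUnionOfCubes k S)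
    {w : EuclideanSpace ℝ (Fin d) → E} (hw : D.IsStep l w) (hw0 : D.avg k w = 0)
    (hwS : Function.support w ⊆ S) {C : ℝ} (hC : ∀ x, ‖w x‖ ≤ C) :
    ‖∫ x, B (w x) (b x)‖ₑ ≤ ENNReal.ofReal C * (D.bmoNorm b * volume S) := by
  have hba : LocallyIntegrable (D.avg k b) := locallyIntegrable_avg hb k
  have h1 : ∫ x, B (w x) (D.avg k b x) = 0 := by
    have h2 := avg_clm_apply (D := D) (k := k) (φ := fun x => B.flip (D.avg k b x))
      (fun x y hy => by simp only [isCubewiseConst_avg k b x y hy]) hw.locallyIntegrable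
    rw [← integral_avg (D := D) (hw.integrable_pairing B hba) k]
    simp only [ContinuousLinearMap.flip_apply, hw0] at h2
    simp only [h2, Pi.zero_apply, map_zero, _root_.zero_apply, integral_zero]
  have h3 : ∫ x, B (w x) (b x) = ∫ x, B (w x) (b x - D.avg k b x) := by
    simp only [map_sub]
    rw [integral_sub (hw.integrable_pairing B hb) (hw.integrable_pairing B hba), h1, sub_zero]
  rw [h3]
  calc _ ≤ ∫⁻ x, ‖B (w x) (b x - D.avg k b x)‖ₑ := enorm_integral_le_lintegral_enorm _
    _ ≤ ∫⁻ x, S.indicator (fun x => ENNReal.ofReal C * ‖b x - D.avg k b x‖ₑ) x := by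
        refine lintegral_mono fun x => ?_
        by_cases hx : x ∈ S
        · rw [Set.indicator_of_mem hx]
          refine (enorm_pairing_le hB _ _).trans ?_
          gcongr
          rw [← ofReal_norm]
          exact ENNReal.ofReal_le_ofReal (hC x)
        · have : w x = 0 := by_contra fun H => hx (hwS H)
          simp [this]
    _ = ENNReal.ofReal C * ∫⁻ x in S, ‖b x - D.avg k b x‖ₑ := by
        rw [lintegral_indicator hS.measurableSet, lintegral_const_mul' _ _ ENNReal.ofReal_ne_top]
    _ ≤ _ := by
        gcongr
        exact setLIntegral_enorm_sub_avg_le hS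

omit [CompleteSpace F] in
-- The difference of the truncations at `2 c` and `c` is a sum of atoms of size at most `3 c`; the
-- factor `2 ^ d` comes from the volume of the stopping sets.
theorem enorm_integral_pairing_stopped_le (hB : ∀ v u, ‖B v u‖ ≤ ‖v‖ * ‖u‖)
    {b : EuclideanSpace ℝ (Fin d) → F} (hb : LocallyIntegrable b) {k : ℤ} (hh : D.IsStep k h)
    (h0 : D.avg m h = 0) {c : ℝ} (hc : 0 ≤ c) (n : ℕ) :
    ‖∫ x, B ((D.stopped m h (2 * c) n - D.stopped m h c n) x) (b x)‖ₑ
      ≤ 3 * 2 ^ d * D.bmoNorm b * (ENNReal.ofReal c * volume {x | c < D.martMax m h n x}) := by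
  have hc2 : c ≤ 2 * c := by linarith
  set a := D.stopped m h (2 * c) n - D.stopped m h c n with ha
  have has : D.IsStep (m + n) a := (hh.stopped _ n).sub (hh.stopped _ n)
  have hind : ∀ i ∈ Finset.range n, D.IsStep (m + n) ((D.stopSet m h c i).indicator a) :=
    fun i hi => by
      rw [Finset.mem_range] at hi
      exact IsStep.indicator ((isUnionOfCubes_stopSet c i).mono (by lia)) has
  have hbound : ∀ x, ‖a x‖ ≤ 3 * c := fun x => by
    have h1 := norm_stopped_le (D := D) h0 (by linarith : 0 ≤ 2 * c) n x
    have h2 := norm_stopped_le (D := D) h0 hc n x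
    exact (norm_sub_le _ _).trans (by linarith)
  have hsum : ∫ x, B (a x) (b x)
      = ∑ i ∈ Finset.range n, ∫ x, B ((D.stopSet m h c i).indicator a x) (b x) := by
    rw [← integral_finsetSum _ fun i hi => (hind i hi).integrable_pairing B hb]
    refine integral_congr_ae (Eventually.of_forall fun x => ?_)
    have := congrFun (stopped_sub_stopped_eq (D := D) (m := m) (h := h) c (2 * c) hc2 n) x
    rw [← ha, Finset.sum_apply] at this
    simp only
    conv_lhs => rw [this]
    rw [map_sum, _root_.sum_apply]
  rw [hsum]
  calc _ ≤ ∑ i ∈ Finset.range n, ‖∫ x, B ((D.stopSet m h c i).indicator a x) (b x)‖ₑ :=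
        enorm_sum_le _ _
    _ ≤ ∑ i ∈ Finset.range n, ENNReal.ofReal (3 * c) *
          (D.bmoNorm b * volume (D.stopSet m h c i)) := by
        refine Finset.sum_le_sum fun i hi => ?_
        refine enorm_integral_pairing_le_of_avg_eq_zero hB hb (isUnionOfCubes_stopSet c i)
          (hind i hi) (avg_indicator_stopSet hh c (2 * c) hc2 i n) Set.support_indicator_subset
          fun x => ?_
        exact (norm_indicator_le_norm_self _ _).trans (hbound x)
    _ ≤ ENNReal.ofReal (3 * c) * (D.bmoNorm b * (2 ^ d * volume {x | c < D.martMax m h n x})) := by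
        rw [← Finset.mul_sum, ← Finset.mul_sum]
        gcongr
        exact sum_volume_stopSet_le hh c n
    _ = _ := by
        rw [ENNReal.ofReal_mul (by norm_num), ENNReal.ofReal_ofNat]
        ring

omit [CompleteSpace E] in
-- A discrete layer-cake estimate: at each point the levels `ε 2^i` below the maximal function sum
-- to at most twice its value.
theorem sum_mul_volume_lt_martMax_le {k : ℤ} (hh : D.IsStep k h) {ε : ℝ} (hε : 0 < ε) (N : ℕ) :
    ∑ i ∈ Finset.range N, ENNReal.ofReal (ε * 2 ^ i) *
        volume {x | ε * 2 ^ i < D.martMax m h n x}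
      ≤ 2 * ∫⁻ x, ‖D.martMax m h n x‖ₑ := by
  have h1 : ∀ i, ENNReal.ofReal (ε * 2 ^ i) * volume {x | ε * 2 ^ i < D.martMax m h n x}
      = ∫⁻ x, {x | ε * 2 ^ i < D.martMax m h n x}.indicator
        (fun _ => ENNReal.ofReal (ε * 2 ^ i)) x := fun i =>
    (lintegral_indicator_const (measurableSet_lt_martMax hh _ n) _).symm
  simp only [h1]
  rw [← lintegral_finsetSum _ fun i _ =>
    measurable_const.indicator (measurableSet_lt_martMax hh _ n),
    ← lintegral_const_mul' _ _ (by norm_num)]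
  refine lintegral_mono fun x => ?_
  rw [Real.enorm_of_nonneg (martMax_nonneg m h n x), ← ENNReal.ofReal_ofNat 2,
    ← ENNReal.ofReal_mul (by norm_num)]
  refine le_trans (le_of_eq ?_) (ENNReal.ofReal_le_ofReal
    (sum_geometric_indicator_le _ (martMax_nonneg m h n x) hε N))
  rw [ENNReal.ofReal_sum_of_nonneg fun i _ => by split_ifs <;> positivity]
  refine Finset.sum_congr rfl fun i _ => ?_
  by_cases H : ε * 2 ^ i < D.martMax m h n x
  · rw [Set.indicator_of_mem (show x ∈ {x | ε * 2 ^ i < D.martMax m h n x} from H), if_pos H]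
  · rw [Set.indicator_of_notMem (show x ∉ {x | ε * 2 ^ i < D.martMax m h n x} from H), if_neg H,
      ENNReal.ofReal_zero]

omit [CompleteSpace E] in
theorem lintegral_enorm_martMax_le (m : ℤ) (n : ℕ) (h : EuclideanSpace ℝ (Fin d) → E) :
    ∫⁻ x, ‖D.martMax m h n x‖ₑ ≤ D.hardyNorm h := by
  refine lintegral_mono fun x => ?_
  obtain ⟨i, -, hi⟩ := exists_partialSups_eq (fun i => ‖D.mart m h i x‖) n
  rw [martMax, hi, enorm_norm]
  exact le_iSup (fun k : ℤ => ‖D.avg k h x‖ₑ) (m + i)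

/-- The dyadic `H^1`-BMO duality inequality for step functions. -/
theorem enorm_integral_pairing_le_bmoNorm_mul_hardyNorm (hB : ∀ v u, ‖B v u‖ ≤ ‖v‖ * ‖u‖)
    {b : EuclideanSpace ℝ (Fin d) → F} (hb : LocallyIntegrable b)
    (hh : D.IsStep (m + n) h) (h0 : D.avg m h = 0) :
    ‖∫ x, B (h x) (b x)‖ₑ ≤ 6 * 2 ^ d * D.bmoNorm b * D.hardyNorm h := by
  -- A bounded set that supports the martingale stopped at any level, so that `I` below does not
  -- depend on `ε`.
  set K := ⋃ i ∈ Finset.range n, Function.support (D.martDiff m h i) with hK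
  have hKb : Bornology.IsBounded K :=
    (Bornology.isBounded_biUnion_finset _).2 fun i _ => (hh.martDiff i).bounded
  obtain ⟨R, hR⟩ := hKb.subset_closedBall 0
  set I := ∫⁻ x in Metric.closedBall (0 : EuclideanSpace ℝ (Fin d)) R, ‖b x‖ₑ with hI
  have hItop : I ≠ ∞ := (integrableOn_of_isBounded hb Metric.isBounded_closedBall).2.ne
  obtain ⟨C, hC0, hC⟩ := hh.exists_bound
  have key : ∀ ε : ℝ, 0 < ε → ‖∫ x, B (h x) (b x)‖ₑ
      ≤ ENNReal.ofReal ε * I + 6 * 2 ^ d * D.bmoNorm b * D.hardyNorm h := by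
    intro ε hε
    obtain ⟨N, hN⟩ : ∃ N : ℕ, C ≤ ε * 2 ^ N := by
      obtain ⟨N, hN⟩ := pow_unbounded_of_one_lt (C / ε) one_lt_two
      exact ⟨N, by rw [mul_comm]; exact ((div_lt_iff₀ hε).1 hN).le⟩
    have hst : ∀ c, Integrable fun x => B (D.stopped m h c n x) (b x) := fun c =>
      (hh.stopped (m := m) c n).integrable_pairing B hb
    -- Telescope over the levels `ε 2^i`: above the supremum of `h` nothing is stopped, and the
    -- lowest truncation contributes at most `ε I`, which disappears as `ε → 0`.
    have htel : ∫ x, B (h x) (b x) = (∫ x, B (D.stopped m h ε n x) (b x)) +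
        ∑ i ∈ Finset.range N, ∫ x, B ((D.stopped m h (2 * (ε * 2 ^ i)) n
          - D.stopped m h (ε * 2 ^ i) n) x) (b x) := by
      set J : ℕ → 𝕜 := fun j => ∫ x, B (D.stopped m h (ε * 2 ^ j) n x) (b x) with hJ
      have h1 : ∀ i : ℕ, ∫ x, B ((D.stopped m h (2 * (ε * 2 ^ i)) n
          - D.stopped m h (ε * 2 ^ i) n) x) (b x) = J (i + 1) - J i := fun i => by
        rw [show 2 * (ε * 2 ^ i) = ε * 2 ^ (i + 1) by ring]
        simp only [Pi.sub_apply, map_sub, _root_.sub_apply]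
        exact integral_sub (hst _) (hst _)
      have h2 : ∫ x, B (D.stopped m h ε n x) (b x) = J 0 := by simp [hJ]
      have h3 : ∫ x, B (h x) (b x) = J N := by
        simp only [hJ]
        rw [stopped_eq hh h0 fun x => (hC x).trans hN]
      rw [Finset.sum_congr rfl fun i _ => h1 i, Finset.sum_range_sub J, h2, h3]
      ring
    rw [htel]
    refine le_trans (enorm_add_le _ _) (add_le_add ?_ ?_)
    · calc _ ≤ ∫⁻ x, ‖B (D.stopped m h ε n x) (b x)‖ₑ := enorm_integral_le_lintegral_enorm _
        _ ≤ ∫⁻ x, (Metric.closedBall 0 R).indicator (fun x => ENNReal.ofReal ε * ‖b x‖ₑ) x := by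
            refine lintegral_mono fun x => ?_
            by_cases hx : x ∈ Metric.closedBall (0 : EuclideanSpace ℝ (Fin d)) R
            · rw [Set.indicator_of_mem hx]
              refine (enorm_pairing_le hB _ _).trans ?_
              gcongr
              rw [← ofReal_norm]
              exact ENNReal.ofReal_le_ofReal (norm_stopped_le h0 hε.le n x)
            · have : D.stopped m h ε n x = 0 := by
                rw [stopped, Finset.sum_apply]
                refine Finset.sum_eq_zero fun i hi => ?_
                refine Set.indicator_apply_eq_zero.2 fun _ => ?_
                by_contra H
                exact hx (hR (Set.mem_biUnion hi H))
              simp [this]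
        _ = _ := by
            rw [lintegral_indicator Metric.isClosed_closedBall.measurableSet,
              lintegral_const_mul' _ _ ENNReal.ofReal_ne_top]
    · calc _ ≤ ∑ i ∈ Finset.range N, 3 * 2 ^ d * D.bmoNorm b * (ENNReal.ofReal (ε * 2 ^ i) *
            volume {x | ε * 2 ^ i < D.martMax m h n x}) :=
            (enorm_sum_le _ _).trans (Finset.sum_le_sum fun i _ =>
              enorm_integral_pairing_stopped_le hB hb hh h0 (by positivity) n)
        _ ≤ 3 * 2 ^ d * D.bmoNorm b * (2 * D.hardyNorm h) := by
            rw [← Finset.mul_sum]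
            gcongr
            refine (sum_mul_volume_lt_martMax_le hh hε N).trans ?_
            gcongr
            exact lintegral_enorm_martMax_le m n h
        _ = _ := by ring
  have hlim : Tendsto (fun ε : ℝ => ENNReal.ofReal ε * I
      + 6 * 2 ^ d * D.bmoNorm b * D.hardyNorm h) (𝓝[>] 0)
      (𝓝 (ENNReal.ofReal 0 * I + 6 * 2 ^ d * D.bmoNorm b * D.hardyNorm h)) :=
    (ENNReal.Tendsto.mul_const (ENNReal.tendsto_ofReal (tendsto_id.mono_left nhdsWithin_le_nhds))
      (Or.inr hItop)).add tendsto_const_nhds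
  rw [ENNReal.ofReal_zero, zero_mul, zero_add] at hlim
  refine ge_of_tendsto hlim ?_
  filter_upwards [self_mem_nhdsWithin] with ε hε
  exact key ε hε

end Stopping

end DyadicSystem

/-! ### Representation of the pairing by a `Y`-valued function -/

namespace DyadicSystem

section Levels

variable {d : ℕ} {D : DyadicSystem d} {F : Type*} [NormedAddCommGroup F] [NormedSpace ℝ F]
  [CompleteSpace F] {f : EuclideanSpace ℝ (Fin d) → F} {m : ℤ} {n : ℕ}

omit [CompleteSpace F] in
theorem diff_eq_martDiff (m : ℤ) (f : EuclideanSpace ℝ (Fin d) → F) (i : ℕ) :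
    D.diff (m + i + 1) f = D.martDiff m f i := by
  rw [diff, martDiff, mart, mart]
  push_cast
  congr 2 <;> ring

theorem IsStep.diff_eq_zero (hf : D.IsStep (m + n) f) (h0 : D.avg m f = 0) {k : ℤ}
    (hk : k ≤ m ∨ m + n < k) : D.diff k f = 0 := by
  rcases hk with hk | hk
  · rw [diff, avg_eq_zero_of_le hf.locallyIntegrable h0 hk,
      avg_eq_zero_of_le hf.locallyIntegrable h0 (by lia), sub_self]
  · rw [diff, (hf.const.mono (by lia)).avg_eq_self, (hf.const.mono (by lia)).avg_eq_self, sub_self]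

theorem finsum_eq_sum_range_of_eq_zero {M : Type*} [AddCommMonoid M] {Φ : ℤ → M}
    (h : ∀ k, k ≤ m ∨ m + n < k → Φ k = 0) :
    ∑ᶠ k, Φ k = ∑ i ∈ Finset.range n, Φ (m + i + 1) := by
  rw [finsum_eq_sum_of_support_subset (s := (Finset.range n).image fun i : ℕ => m + i + 1),
    Finset.sum_image]
  · intro i _ j _ hij
    simpa using hij
  · intro k hk
    have h1 : ¬ (k ≤ m ∨ m + n < k) := fun H => hk (h k H)
    rw [Finset.coe_image]
    refine ⟨(k - m - 1).toNat, ?_, ?_⟩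
    · simp only [Finset.coe_range, Set.mem_Iio]
      lia
    · show m + ((k - m - 1).toNat : ℤ) + 1 = k
      lia

theorem IsTestFunction.exists_common_levels {G : Type*} [NormedAddCommGroup G] [NormedSpace ℝ G]
    [CompleteSpace G] (hd : 0 < d) {p q : ℝ≥0∞} (hp : 1 ≤ p) (hq : 1 ≤ q)
    {g : EuclideanSpace ℝ (Fin d) → G} (hf : D.IsTestFunction p f) (hg : D.IsTestFunction q g) :
    ∃ (m : ℤ) (n : ℕ), f =ᵐ[volume] D.avg (m + n) f ∧ D.avg m (D.avg (m + n) f) = 0 ∧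
      g =ᵐ[volume] D.avg (m + n) g ∧ D.avg m (D.avg (m + n) g) = 0 := by
  obtain ⟨m₁, N₁, h1, h1'⟩ := hf.exists_levels hd hp
  obtain ⟨m₂, N₂, h2, h2'⟩ := hg.exists_levels hd hq
  set m := min m₁ m₂
  set n := (max N₁ N₂ - m).toNat with hn
  have h3 : N₁ ≤ m + n := by have := Int.self_le_toNat (max N₁ N₂ - m); lia
  have h4 : N₂ ≤ m + n := by have := Int.self_le_toNat (max N₁ N₂ - m); lia
  refine ⟨m, n, h1' _ h3, ?_, h2' _ h4, ?_⟩
  · rw [← avg_congr_ae _ (h1' _ h3), h1 _ (min_le_left _ _)]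
  · rw [← avg_congr_ae _ (h2' _ h4), h2 _ (min_le_right _ _)]

omit [CompleteSpace F] [NormedSpace ℝ F] in
theorem isBounded_support_of_hasCompactSupport (hf : HasCompactSupport f) :
    Bornology.IsBounded (Function.support f) :=
  hf.isCompact.isBounded.subset (subset_tsupport f)

omit [CompleteSpace F] in
theorem IsTestFunction.add {p : ℝ≥0∞} (hp : 1 ≤ p) {g : EuclideanSpace ℝ (Fin d) → F}
    (hf : D.IsTestFunction p f) (hg : D.IsTestFunction p g) : D.IsTestFunction p (f + g) where
  memLp := hf.memLp.add hg.memLp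
  hasCompactSupport := hf.hasCompactSupport.add hg.hasCompactSupport
  finite_expansion := by
    refine (hf.finite_expansion.union hg.finite_expansion).subset fun k hk => ?_
    by_contra H
    simp only [Set.mem_union, Set.mem_ofPred_eq, not_or, not_not] at H
    refine hk ?_
    have h1 := (hf.integrable hp).locallyIntegrable
    have h2 := (hg.integrable hp).locallyIntegrable
    rw [diff] at H ⊢
    rw [avg_add _ h1 h2, avg_add _ h1 h2, add_sub_add_comm, H.1]
    simpa [diff] using H.2

omit [CompleteSpace F] in
theorem avg_smul {𝕜 : Type*} [RCLike 𝕜] [NormedSpace 𝕜 F] [IsScalarTower ℝ 𝕜 F] (k : ℤ) (c : 𝕜)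
    (f : EuclideanSpace ℝ (Fin d) → F) : D.avg k (c • f) = c • D.avg k f := by
  have : SMulCommClass ℝ 𝕜 F := IsScalarTower.to_smulCommClass
  ext x
  simp only [avg_eq, Pi.smul_apply]
  rw [integral_smul, smul_comm]

omit [CompleteSpace F] in
theorem diff_smul {𝕜 : Type*} [RCLike 𝕜] [NormedSpace 𝕜 F] [IsScalarTower ℝ 𝕜 F] (k : ℤ) (c : 𝕜)
    (f : EuclideanSpace ℝ (Fin d) → F) : D.diff k (c • f) = c • D.diff k f := by
  rw [diff, diff, avg_smul, avg_smul, smul_sub]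

omit [CompleteSpace F] in
theorem diff_add (k : ℤ) {g : EuclideanSpace ℝ (Fin d) → F} (hf : LocallyIntegrable f)
    (hg : LocallyIntegrable g) : D.diff k (f + g) = D.diff k f + D.diff k g := by
  rw [diff, diff, diff, avg_add k hf hg, avg_add _ hf hg, add_sub_add_comm]

omit [CompleteSpace F] in
theorem IsTestFunction.const_smul {𝕜 : Type*} [RCLike 𝕜] [NormedSpace 𝕜 F] [IsScalarTower ℝ 𝕜 F]
    {p : ℝ≥0∞} (c : 𝕜) (hf : D.IsTestFunction p f) : D.IsTestFunction p (c • f) where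
  memLp := hf.memLp.const_smul c
  hasCompactSupport := hf.hasCompactSupport.smul_left
  finite_expansion := hf.finite_expansion.subset fun k hk h => hk (by rw [diff_smul, h, smul_zero])

end Levels

section Operator

variable {d : ℕ} {D : DyadicSystem d} {𝕜 : Type} [RCLike 𝕜]
  {X : Type*} [NormedAddCommGroup X] [NormedSpace ℝ X] [NormedSpace 𝕜 X] [IsScalarTower ℝ 𝕜 X]
  [CompleteSpace X]
  {Y : Type*} [NormedAddCommGroup Y] [NormedSpace ℝ Y] [NormedSpace 𝕜 Y] [IsScalarTower ℝ 𝕜 Y]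
  [CompleteSpace Y]
  {b : EuclideanSpace ℝ (Fin d) → X →L[𝕜] Y}
  {f : EuclideanSpace ℝ (Fin d) → X} {g : EuclideanSpace ℝ (Fin d) → StrongDual 𝕜 Y}
  {m : ℤ} {n : ℕ}

omit [CompleteSpace X] [CompleteSpace Y] in
theorem symParaproduct_congr_ae {f' : EuclideanSpace ℝ (Fin d) → X}
    {g' : EuclideanSpace ℝ (Fin d) → StrongDual 𝕜 Y} (hf : f =ᵐ[volume] f')
    (hg : g =ᵐ[volume] g') : D.symParaproduct b f g = D.symParaproduct b f' g' := by
  simp only [symParaproduct, diff_congr_ae _ hf, diff_congr_ae _ hg, avg_congr_ae _ hf,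
    avg_congr_ae _ hg]

/-- The Hardy space function `∑ (𝔼_{k-1} f ⊗ 𝔻_k g + 𝔻_k f ⊗ 𝔼_{k-1} g)` as a function with values
in the functionals on `X →L[𝕜] Y`. -/
noncomputable abbrev paraFunctional (D : DyadicSystem d) (m : ℤ)
    (f : EuclideanSpace ℝ (Fin d) → X) (g : EuclideanSpace ℝ (Fin d) → StrongDual 𝕜 Y) (n : ℕ) :
    EuclideanSpace ℝ (Fin d) → StrongDual 𝕜 (X →L[𝕜] Y) :=
  D.paraTensor (𝕜 := 𝕜) (X := X) (Z := StrongDual 𝕜 Y) (E := StrongDual 𝕜 (X →L[𝕜] Y))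
    (tensorEval 𝕜 X Y) m f g n

omit [CompleteSpace Y] in
theorem symParaproduct_eq_integral_paraTensor (hf : D.IsStep (m + n) f) (hf0 : D.avg m f = 0)
    (hg : D.IsStep (m + n) g) (hg0 : D.avg m g = 0) :
    D.symParaproduct b f g
      = ∫ x, D.paraFunctional m f g n x (b x) := by
  rw [symParaproduct]
  refine integral_congr_ae (Eventually.of_forall fun x => ?_)
  dsimp only
  rw [finsum_eq_sum_range_of_eq_zero (m := m) (n := n), paraFunctional, paraTensor, _root_.sum_apply]
  · refine Finset.sum_congr rfl fun i _ => ?_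
    rw [diff_eq_martDiff, diff_eq_martDiff, add_sub_cancel_right]
    rfl
  · intro k hk
    simp [hf.diff_eq_zero hf0 hk, hg.diff_eq_zero hg0 hk]

omit [NormedSpace ℝ X] [IsScalarTower ℝ 𝕜 X] [CompleteSpace X] [IsScalarTower ℝ 𝕜 Y]
  [CompleteSpace Y] [NormedSpace ℝ Y] in
theorem IsStep.integrable_apply {k : ℤ} (hf : D.IsStep k f) (hb : LocallyIntegrable b) :
    Integrable fun x => b x (f x) :=
  IsStep.integrable_clm_apply (φ := fun x => ContinuousLinearMap.apply 𝕜 Y (f x))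
    (hf.comp (ContinuousLinearMap.apply 𝕜 Y) (map_zero _)) hb

omit [NormedSpace ℝ X] [IsScalarTower ℝ 𝕜 X] [CompleteSpace X] [IsScalarTower ℝ 𝕜 Y]
  [CompleteSpace Y] [NormedSpace ℝ Y] in
theorem IsStep.isBounded_support_apply {k : ℤ} (hf : D.IsStep k f)
    (b : EuclideanSpace ℝ (Fin d) → X →L[𝕜] Y) :
    Bornology.IsBounded (Function.support fun x => b x (f x)) :=
  hf.bounded.subset fun x hx h => hx (by simp [h])

/-- The function `b f - ∑ 𝔻_k (b 𝔻_k f)` representing `Λ_b f`. -/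
noncomputable def symParaproductFun (D : DyadicSystem d) (b : EuclideanSpace ℝ (Fin d) → X →L[𝕜] Y)
    (f : EuclideanSpace ℝ (Fin d) → X) : EuclideanSpace ℝ (Fin d) → Y := fun x =>
  b x (f x) - ∑ᶠ k, D.diff k (fun y => b y (D.diff k f y)) x

omit [IsScalarTower ℝ 𝕜 X] [CompleteSpace X] [IsScalarTower ℝ 𝕜 Y] [CompleteSpace Y] in
theorem symParaproductFun_congr_ae {f' : EuclideanSpace ℝ (Fin d) → X} (h : f =ᵐ[volume] f') :
    D.symParaproductFun b f =ᵐ[volume] D.symParaproductFun b f' := by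
  filter_upwards [h] with x hx
  simp only [symParaproductFun, diff_congr_ae _ h, hx]

omit [IsScalarTower ℝ 𝕜 X] [IsScalarTower ℝ 𝕜 Y] [CompleteSpace Y] in
theorem symParaproductFun_eq (hf : D.IsStep (m + n) f) (hf0 : D.avg m f = 0)
    (x : EuclideanSpace ℝ (Fin d)) : D.symParaproductFun b f x
      = b x (f x) - ∑ i ∈ Finset.range n, D.martDiff m (fun y => b y (D.martDiff m f i y)) i x := by
  rw [symParaproductFun, finsum_eq_sum_range_of_eq_zero (m := m) (n := n)]
  · simp only [diff_eq_martDiff]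
  · intro k hk
    rw [hf.diff_eq_zero hf0 hk]
    simp only [Pi.zero_apply, map_zero]
    simp [diff, show (fun _ : EuclideanSpace ℝ (Fin d) => (0 : Y)) = 0 from rfl, avg_zero]

omit [IsScalarTower ℝ 𝕜 X] [IsScalarTower ℝ 𝕜 Y] [CompleteSpace Y] in
theorem integrable_symParaproductFun (hb : LocallyIntegrable b) (hf : D.IsStep (m + n) f)
    (hf0 : D.avg m f = 0) : Integrable (D.symParaproductFun b f) := by
  rw [funext (symParaproductFun_eq (b := b) hf hf0)]
  refine (hf.integrable_apply hb).sub (integrable_finsetSum _ fun i _ => ?_)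
  have h := (hf.martDiff (m := m) i).integrable_apply hb
  exact (integrable_avg h _).sub (integrable_avg h _)

omit [IsScalarTower ℝ 𝕜 X] [IsScalarTower ℝ 𝕜 Y] [CompleteSpace Y] in
theorem isBounded_support_symParaproductFun (hf : D.IsStep (m + n) f) (hf0 : D.avg m f = 0) :
    Bornology.IsBounded (Function.support (D.symParaproductFun b f)) := by
  have h : ∀ i, Bornology.IsBounded (Function.support
      (D.martDiff m (fun y => b y (D.martDiff m f i y)) i)) := fun i =>
    have h := (hf.martDiff (m := m) i).isBounded_support_apply b
    ((IsStep.avg h).bounded.union (IsStep.avg h).bounded).subset (Function.support_sub _ _)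
  refine ((hf.isBounded_support_apply b).union ((Bornology.isBounded_biUnion_finset
    (Finset.range n)).2 fun i _ => h i)).subset fun x hx => ?_
  by_contra H
  simp only [Set.mem_union, Set.mem_iUnion, not_or, not_exists, Function.mem_support,
    not_not] at H
  refine hx ?_
  rw [symParaproductFun_eq hf hf0, H.1, Finset.sum_eq_zero H.2, sub_zero]

omit [IsScalarTower ℝ 𝕜 Y] in
theorem integral_apply_martDiff_comm {k : ℤ} {w : EuclideanSpace ℝ (Fin d) → Y}
    (hg : D.IsStep k g) (hw : Integrable w) (hwb : Bornology.IsBounded (Function.support w))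
    (i : ℕ) : ∫ x, g x (D.martDiff m w i x) = ∫ x, D.martDiff m g i x (w x) := by
  have h := fun j => integral_pairing_avg_comm (D := D)
    (ContinuousLinearMap.id 𝕜 (StrongDual 𝕜 Y)) hg.locallyIntegrable hw.locallyIntegrable
    hg.bounded hwb j
  have h1 := fun j => (IsStep.avg (D := D) (j := j) hg.bounded).integrable_pairing
    (ContinuousLinearMap.id 𝕜 (StrongDual 𝕜 Y)) hw.locallyIntegrable
  have h2 := fun j => hg.integrable_pairing (ContinuousLinearMap.id 𝕜 (StrongDual 𝕜 Y))
    (integrable_avg (D := D) hw j).locallyIntegrable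
  simp only [ContinuousLinearMap.coe_id', id_eq] at h h1 h2
  simp only [martDiff, mart, Pi.sub_apply, map_sub, _root_.sub_apply]
  rw [integral_sub (h2 _) (h2 _), integral_sub (h1 _) (h1 _), h, h]

/-- By the product rule the form is `∫ g (b f) - ∑ ∫ 𝔻_k g (b 𝔻_k f)`; self-adjointness moves each
`𝔻_k` from `g` to `b 𝔻_k f`. Hence `Λ_b f` is an honest `Y`-valued function, and no passage through
the bidual is needed. -/
theorem integral_symParaproductFun (hb : LocallyIntegrable b) (hf : D.IsStep (m + n) f)
    (hf0 : D.avg m f = 0) (hg : D.IsStep (m + n) g) (hg0 : D.avg m g = 0) :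
    ∫ x, g x (D.symParaproductFun b f x) = D.symParaproduct b f g := by
  have hw := fun i => (hf.martDiff (m := m) i).integrable_apply hb
  have hwb := fun i => (hf.martDiff (m := m) i).isBounded_support_apply b
  have hI : ∀ {w : EuclideanSpace ℝ (Fin d) → Y}, Integrable w → ∀ {k : ℤ}
      {g : EuclideanSpace ℝ (Fin d) → StrongDual 𝕜 Y}, D.IsStep k g →
      Integrable fun x => g x (w x) := fun hw _ _ hg =>
    hg.integrable_clm_apply hw.locallyIntegrable
  have hwd : ∀ i, Integrable (D.martDiff m (fun y => b y (D.martDiff m f i y)) i) := fun i =>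
    (integrable_avg (hw i) _).sub (integrable_avg (hw i) _)
  rw [symParaproduct_eq_integral_paraTensor hf hf0 hg hg0]
  simp only [paraFunctional, paraTensor_eq hf0, symParaproductFun_eq hf hf0, hf.mart_eq, hg.mart_eq,
    map_sub, map_sum, _root_.sub_apply, _root_.sum_apply, tensorEval_apply]
  rw [integral_sub (hI (hf.integrable_apply hb) hg)
      (integrable_finsetSum _ fun i _ => hI (hwd i) hg),
    integral_sub (hI (hf.integrable_apply hb) hg)
      (integrable_finsetSum _ fun i _ => hI (hw i) (hg.martDiff i)),
    integral_finsetSum _ fun i _ => hI (hwd i) hg,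
    integral_finsetSum _ fun i _ => hI (hw i) (hg.martDiff i)]
  congr 1
  exact Finset.sum_congr rfl fun i _ => integral_apply_martDiff_comm hg (hw i) (hwb i) i

end Operator

end DyadicSystem

/-! ### Use of a duality constant, and extension to `L^p` -/

namespace DyadicSystem

section Duality

theorem bmoNorm_linearIsometry_comp {d : ℕ} {D : DyadicSystem d} {𝕜 W Z : Type*} [RCLike 𝕜]
    [NormedAddCommGroup W] [NormedSpace ℝ W] [NormedSpace 𝕜 W] [CompleteSpace W]
    [NormedAddCommGroup Z] [NormedSpace ℝ Z] [NormedSpace 𝕜 Z] [CompleteSpace Z]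
    (φ : W →ₗᵢ[𝕜] Z) {b : EuclideanSpace ℝ (Fin d) → W} (hb : LocallyIntegrable b) :
    D.bmoNorm (fun x => φ (b x)) = D.bmoNorm b := by
  refine iSup_congr fun k => iSup_congr fun Q => iSup_congr fun hQ => ?_
  obtain ⟨x, rfl⟩ := D.exists_eq_cubeAt hQ
  have h : ⨍ y in D.cubeAt k x, φ (b y) = φ (⨍ y in D.cubeAt k x, b y) := by
    rw [setAverage_eq, setAverage_eq]
    refine (congrArg _ (φ.toContinuousLinearMap.integral_comp_comm
      (integrableOn_cubeAt hb k x))).trans ?_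
    exact (map_real_smul φ φ.continuous _ _).symm
  simp only [h, ← map_sub, enorm_eq_nnnorm, φ.nnnorm_map]

/-- Against a step function `b` pairs absolutely integrably, so by dominated convergence the
truncated limit is the plain integral. The isometry `φ` admits functions `b` whose values lie only
in a subspace of a dual. -/
theorem IsDualityConstant.enorm_integral_le.{w} {d : ℕ} {D : DyadicSystem d} {𝕜 : Type} [RCLike 𝕜]
    {c : ℝ} (hc : IsDualityConstant.{w} 𝕜 D c) {W : Type*} [NormedAddCommGroup W]
    [NormedSpace ℝ W] [NormedSpace 𝕜 W] [CompleteSpace W] {E : Type w} [NormedAddCommGroup E]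
    [NormedSpace ℝ E] [NormedSpace 𝕜 E] [IsScalarTower ℝ 𝕜 E] [CompleteSpace E]
    (φ : W →ₗᵢ[𝕜] StrongDual 𝕜 E)
    {b : EuclideanSpace ℝ (Fin d) → W} (hb : D.MemBMO b)
    {h : EuclideanSpace ℝ (Fin d) → E} {k : ℤ} (hs : D.IsStep k h)
    (hh : D.hardyNorm h < ∞) :
    ‖∫ x, φ (b x) (h x)‖ₑ ≤ ENNReal.ofReal c * D.bmoNorm b * D.hardyNorm h := by
  have hφ : D.bmoNorm (fun x => φ (b x)) = D.bmoNorm b :=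
    bmoNorm_linearIsometry_comp φ hb.locallyIntegrable
  have hφb : LocallyIntegrable fun x => φ (b x) := fun x => by
    obtain ⟨S, hS, hI⟩ := hb.locallyIntegrable x
    exact ⟨S, hS, φ.toContinuousLinearMap.integrable_comp hI⟩
  obtain ⟨L, hL, hLn⟩ := hc.2 E (fun x => φ (b x)) h
    ⟨hφb, hφ.trans_lt hb.bmoNorm_lt_top⟩ ⟨hs.integrable, hh⟩
  have hint : Integrable fun x => φ (b x) (h x) :=
    IsStep.integrable_apply hs hφb
  have hlim : Tendsto (fun N : ℕ => ∫ x, (min 1 ((N : ℝ) / ‖φ (b x)‖)) • (φ (b x)) (h x)) atTop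
      (𝓝 (∫ x, φ (b x) (h x))) := by
    refine tendsto_integral_of_dominated_convergence (fun x => ‖φ (b x) (h x)‖) (fun N => ?_)
      hint.norm (fun N => Eventually.of_forall fun x => ?_) (Eventually.of_forall fun x => ?_)
    · have h1 : AEStronglyMeasurable fun x => φ (b x) := hφb.aestronglyMeasurable
      exact ((aemeasurable_const.min (aemeasurable_const.div
        h1.norm.aemeasurable)).aestronglyMeasurable).smul hint.aestronglyMeasurable
    · have h1 : 0 ≤ min 1 ((N : ℝ) / ‖φ (b x)‖) := by positivity
      rw [norm_smul, Real.norm_of_nonneg h1]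
      exact mul_le_of_le_one_left (norm_nonneg _) (min_le_left _ _)
    · rcases eq_or_ne (b x) 0 with h0 | h0
      · simp [h0]
      · refine tendsto_const_nhds.congr' ?_
        filter_upwards [eventually_ge_atTop ⌈‖φ (b x)‖⌉₊] with N hN
        have h1 : 0 < ‖φ (b x)‖ := by rw [φ.norm_map]; exact norm_pos_iff.2 h0
        rw [min_eq_left ((one_le_div₀ h1).2 (Nat.ceil_le.1 hN)), one_smul]
  rw [tendsto_nhds_unique hlim hL, ← ofReal_norm]
  refine (ENNReal.ofReal_le_ofReal hLn).trans ?_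
  rw [hφ, ENNReal.ofReal_mul (mul_nonneg hc.1 ENNReal.toReal_nonneg), ENNReal.ofReal_mul hc.1,
    ENNReal.ofReal_toReal hb.bmoNorm_lt_top.ne, ENNReal.ofReal_toReal hh.ne]

end Duality

section Extension

variable {d : ℕ} {D : DyadicSystem d} {𝕜 : Type} [RCLike 𝕜]
  {X : Type*} [NormedAddCommGroup X] [NormedSpace ℝ X] [NormedSpace 𝕜 X] [IsScalarTower ℝ 𝕜 X]
  [CompleteSpace X]
  {Y : Type*} [NormedAddCommGroup Y] [NormedSpace ℝ Y] [NormedSpace 𝕜 Y] [IsScalarTower ℝ 𝕜 Y]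
  [CompleteSpace Y]
  {b : EuclideanSpace ℝ (Fin d) → X →L[𝕜] Y} {p q : ℝ}

/-- The bound `A` for the bilinear form of the paraproduct on mean-zero step functions. -/
def IsParaproductBound (D : DyadicSystem d) (b : EuclideanSpace ℝ (Fin d) → X →L[𝕜] Y) (p q A : ℝ) :
    Prop :=
  ∀ (f : EuclideanSpace ℝ (Fin d) → X) (g : EuclideanSpace ℝ (Fin d) → StrongDual 𝕜 Y) (m : ℤ)
    (n : ℕ), D.IsStep (m + n) f → D.avg m f = 0 → D.IsStep (m + n) g → D.avg m g = 0 →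
    ‖∫ x, D.paraFunctional m f g n x (b x)‖ₑ ≤ ENNReal.ofReal A *
      (eLpNorm f (ENNReal.ofReal p) volume * eLpNorm g (ENNReal.ofReal q) volume)

theorem eLpNorm_symParaproductFun_le (hd : 0 < d) (hpq : p.HolderConjugate q)
    (hb : LocallyIntegrable b) {A : ℝ} (hA0 : 0 ≤ A) (hA : D.IsParaproductBound b p q A)
    {f : EuclideanSpace ℝ (Fin d) → X} {m : ℤ} {n : ℕ} (hf : D.IsStep (m + n) f)
    (hf0 : D.avg m f = 0) :
    eLpNorm (D.symParaproductFun b f) (ENNReal.ofReal p) volume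
      ≤ ENNReal.ofReal A * eLpNorm f (ENNReal.ofReal p) volume := by
  have hfin : eLpNorm f (ENNReal.ofReal p) volume ≠ ∞ := (hf.memLp _).eLpNorm_ne_top
  rw [← ENNReal.ofReal_toReal hfin, ← ENNReal.ofReal_mul hA0]
  refine eLpNorm_le_of_pairing (D := D) (isNormingPairing_id (𝕜 := 𝕜)) hd hpq
    (integrable_symParaproductFun hb hf hf0) (isBounded_support_symParaproductFun hf hf0)
    fun v k l hv hv0 => ?_
  -- The form bound asks for a common range of generations, so the ranges of `f` and of the test `v`
  -- are both enlarged.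
  set M := min m l
  obtain ⟨N, hN1, hN2⟩ : ∃ N : ℕ, m + n ≤ M + N ∧ k ≤ M + N :=
    ⟨(max (m + n) k - M).toNat, by have := Int.self_le_toNat (max (m + n) k - M); lia,
      by have := Int.self_le_toNat (max (m + n) k - M); lia⟩
  have hf' : D.IsStep (M + N) f := hf.mono hN1
  have hv' : D.IsStep (M + N) v := hv.mono hN2
  have hf0' := avg_eq_zero_of_le hf.locallyIntegrable hf0 (min_le_left m l)
  have hv0' := avg_eq_zero_of_le hv.locallyIntegrable hv0 (min_le_right m l)
  simp only [ContinuousLinearMap.coe_id', id_eq]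
  rw [integral_symParaproductFun hb hf' hf0' hv' hv0',
    symParaproduct_eq_integral_paraTensor hf' hf0' hv' hv0', ENNReal.ofReal_mul hA0,
    ENNReal.ofReal_toReal hfin, mul_assoc]
  exact hA f v M N hf' hf0' hv' hv0'

theorem IsTestFunction.exists_step (hd : 0 < d) {f : EuclideanSpace ℝ (Fin d) → X} {p : ℝ≥0∞}
    (hp : 1 ≤ p) (hf : D.IsTestFunction p f) : ∃ (m : ℤ) (n : ℕ) (s : EuclideanSpace ℝ (Fin d) → X),
      D.IsStep (m + n) s ∧ D.avg m s = 0 ∧ f =ᵐ[volume] s := by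
  obtain ⟨m, n, h, h0, -⟩ := hf.exists_common_levels hd hp hp hf
  exact ⟨m, n, _, IsStep.avg (isBounded_support_of_hasCompactSupport hf.hasCompactSupport), h0, h⟩

theorem IsTestFunction.eLpNorm_symParaproductFun_le (hd : 0 < d) (hpq : p.HolderConjugate q)
    (hb : LocallyIntegrable b) {A : ℝ} (hA0 : 0 ≤ A) (hA : D.IsParaproductBound b p q A)
    {f : EuclideanSpace ℝ (Fin d) → X} (hf : D.IsTestFunction (ENNReal.ofReal p) f) :
    eLpNorm (D.symParaproductFun b f) (ENNReal.ofReal p) volume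
      ≤ ENNReal.ofReal A * eLpNorm f (ENNReal.ofReal p) volume := by
  obtain ⟨m, n, s, hs, hs0, hfs⟩ := hf.exists_step hd (ENNReal.one_le_ofReal.2 hpq.lt.le)
  rw [eLpNorm_congr_ae hfs, eLpNorm_congr_ae (symParaproductFun_congr_ae (b := b) hfs)]
  exact DyadicSystem.eLpNorm_symParaproductFun_le hd hpq hb hA0 hA hs hs0

theorem IsTestFunction.aestronglyMeasurable_symParaproductFun (hd : 0 < d) {p : ℝ≥0∞} (hp : 1 ≤ p)
    (hb : LocallyIntegrable b) {f : EuclideanSpace ℝ (Fin d) → X} (hf : D.IsTestFunction p f) :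
    AEStronglyMeasurable (D.symParaproductFun b f) := by
  obtain ⟨m, n, s, hs, hs0, hfs⟩ := hf.exists_step hd hp
  exact (integrable_symParaproductFun hb hs hs0).aestronglyMeasurable.congr
    (symParaproductFun_congr_ae hfs).symm

theorem IsTestFunction.integral_symParaproductFun (hd : 0 < d) {p q : ℝ≥0∞} (hp : 1 ≤ p)
    (hq : 1 ≤ q) (hb : LocallyIntegrable b) {f : EuclideanSpace ℝ (Fin d) → X}
    {g : EuclideanSpace ℝ (Fin d) → StrongDual 𝕜 Y} (hf : D.IsTestFunction p f)
    (hg : D.IsTestFunction q g) :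
    ∫ x, g x (D.symParaproductFun b f x) = D.symParaproduct b f g := by
  obtain ⟨m, n, h1, h2, h3, h4⟩ := hf.exists_common_levels hd hp hq hg
  rw [symParaproduct_congr_ae h1 h3, ← DyadicSystem.integral_symParaproductFun hb
    (IsStep.avg (isBounded_support_of_hasCompactSupport hf.hasCompactSupport)) h2
    (IsStep.avg (isBounded_support_of_hasCompactSupport hg.hasCompactSupport)) h4]
  refine integral_congr_ae ?_
  filter_upwards [symParaproductFun_congr_ae (b := b) h1, h3] with x hx hx'
  rw [hx, hx']

omit [IsScalarTower ℝ 𝕜 X] [CompleteSpace X] [IsScalarTower ℝ 𝕜 Y] [CompleteSpace Y] in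
theorem finite_support_diff_apply {f : EuclideanSpace ℝ (Fin d) → X} {p : ℝ≥0∞}
    (hf : D.IsTestFunction p f) (b : EuclideanSpace ℝ (Fin d) → X →L[𝕜] Y)
    (x : EuclideanSpace ℝ (Fin d)) :
    (Function.support fun k => D.diff k (fun y => b y (D.diff k f y)) x).Finite := by
  refine hf.finite_expansion.subset fun k hk h => hk ?_
  simp only [h, Pi.zero_apply, map_zero]
  simp [diff, show (fun _ : EuclideanSpace ℝ (Fin d) => (0 : Y)) = 0 from rfl, avg_zero]

omit [IsScalarTower ℝ 𝕜 X] [CompleteSpace X] [NormedSpace ℝ Y] [IsScalarTower ℝ 𝕜 Y]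
  [CompleteSpace Y] in
theorem IsTestFunction.integrable_apply_diff {f : EuclideanSpace ℝ (Fin d) → X} {p : ℝ≥0∞}
    (hf : D.IsTestFunction p f) (hb : LocallyIntegrable b) (k : ℤ) :
    Integrable fun y => b y (D.diff k f y) := by
  have h := isBounded_support_of_hasCompactSupport hf.hasCompactSupport
  exact (((IsStep.avg h).mono le_rfl).sub ((IsStep.avg h).mono (by lia))).integrable_apply hb

omit [IsScalarTower ℝ 𝕜 X] [CompleteSpace X] [IsScalarTower ℝ 𝕜 Y] [CompleteSpace Y] in
theorem symParaproductFun_add {p : ℝ≥0∞} (hp : 1 ≤ p) (hb : LocallyIntegrable b)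
    {f g : EuclideanSpace ℝ (Fin d) → X} (hf : D.IsTestFunction p f) (hg : D.IsTestFunction p g) :
    D.symParaproductFun b (f + g) = D.symParaproductFun b f + D.symParaproductFun b g := by
  ext x
  have h : ∀ k, D.diff k (fun y => b y (D.diff k (f + g) y))
      = D.diff k (fun y => b y (D.diff k f y)) + D.diff k (fun y => b y (D.diff k g y)) := by
    intro k
    rw [diff_add k (hf.integrable hp).locallyIntegrable (hg.integrable hp).locallyIntegrable,
      ← diff_add k (hf.integrable_apply_diff hb k).locallyIntegrable
        (hg.integrable_apply_diff hb k).locallyIntegrable]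
    congr 1
    ext y
    simp
  simp only [symParaproductFun, h, Pi.add_apply, map_add]
  rw [finsum_add_distrib (finite_support_diff_apply hf b x) (finite_support_diff_apply hg b x),
    add_sub_add_comm]

omit [CompleteSpace X] [CompleteSpace Y] in
theorem symParaproductFun_smul (c : 𝕜) (f : EuclideanSpace ℝ (Fin d) → X) :
    D.symParaproductFun b (c • f) = c • D.symParaproductFun b f := by
  ext x
  have h : ∀ k, D.diff k (fun y => b y (D.diff k (c • f) y))
      = c • D.diff k (fun y => b y (D.diff k f y)) := by
    intro k
    rw [diff_smul k c f, ← diff_smul k c fun y => b y (D.diff k f y)]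
    simp only [Pi.smul_apply, map_smul]
    rfl
  simp only [symParaproductFun, h, Pi.smul_apply, map_smul, smul_sub, smul_finsum]

variable (D 𝕜 X) in
/-- The space of test functions. -/
def testFunctions (p : ℝ≥0∞) [hp : Fact (1 ≤ p)] : Submodule 𝕜 (EuclideanSpace ℝ (Fin d) → X) where
  carrier := {f | D.IsTestFunction p f}
  add_mem' := IsTestFunction.add hp.out
  zero_mem' := IsStep.zero.isTestFunction (k := 0) (avg_zero 0) p
  smul_mem' c _ := IsTestFunction.const_smul c

variable (D 𝕜 X) in
/-- The inclusion of the test functions in `L^p`. -/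
noncomputable def testToLp (p : ℝ≥0∞) [Fact (1 ≤ p)] :
    D.testFunctions 𝕜 X p →ₗ[𝕜] Lp X p (volume : Measure (EuclideanSpace ℝ (Fin d))) where
  toFun f := IsTestFunction.memLp f.2 |>.toLp
  map_add' f g := MemLp.toLp_add (IsTestFunction.memLp f.2) (IsTestFunction.memLp g.2)
  map_smul' c f := MemLp.toLp_const_smul c (IsTestFunction.memLp f.2)

theorem denseRange_testToLp (hd : 0 < d) (hp : 1 < p) [Fact (1 ≤ ENNReal.ofReal p)] :
    DenseRange (D.testToLp 𝕜 X (ENNReal.ofReal p)) := by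
  refine Metric.denseRange_iff.2 fun F r hr => ?_
  obtain ⟨s, k, m, hs, hs0, h⟩ := exists_step_eLpNorm_sub_le (D := D) hd hp (Lp.memLp F)
    (ε := ENNReal.ofReal (r / 2)) (by simpa using hr)
  refine ⟨⟨s, hs.isTestFunction hs0 _⟩, ?_⟩
  have h1 : dist F ((hs.memLp (ENNReal.ofReal p)).toLp s) ≤ r / 2 := by
    rw [dist_eq_norm]
    nth_rewrite 1 [← Lp.toLp_coeFn F (Lp.memLp F)]
    rw [← MemLp.toLp_sub, Lp.norm_toLp]
    exact ENNReal.toReal_le_of_le_ofReal (by positivity) h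
  exact h1.trans_lt (half_lt_self hr)

/-- The symmetrised paraproduct extends to a bounded operator whose norm is at most any bound for
its bilinear form on mean-zero step functions. -/
theorem exists_symParaproduct_operator (hd : 0 < d) (hpq : p.HolderConjugate q)
    [Fact (1 ≤ ENNReal.ofReal p)] (hb : LocallyIntegrable b) {A₀ : ℝ} (hA₀ : 0 ≤ A₀)
    (hA : D.IsParaproductBound b p q A₀) :
    ∃ T : Lp X (ENNReal.ofReal p) (volume : Measure (EuclideanSpace ℝ (Fin d))) →L[𝕜]
        Lp Y (ENNReal.ofReal p) (volume : Measure (EuclideanSpace ℝ (Fin d))),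
      (∀ (f : EuclideanSpace ℝ (Fin d) → X) (g : EuclideanSpace ℝ (Fin d) → StrongDual 𝕜 Y)
        (hf : D.IsTestFunction (ENNReal.ofReal p) f) (_ : D.IsTestFunction (ENNReal.ofReal q) g),
        ∫ x, (g x) (T (hf.memLp.toLp f) x) = D.symParaproduct b f g) ∧
      ∀ A, 0 ≤ A → D.IsParaproductBound b p q A → ‖T‖ ≤ A := by
  have hp1 : 1 ≤ ENNReal.ofReal p := ENNReal.one_le_ofReal.2 hpq.lt.le
  have hq1 : 1 ≤ ENNReal.ofReal q := ENNReal.one_le_ofReal.2 hpq.symm.lt.le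
  have hmem : ∀ f : D.testFunctions 𝕜 X (ENNReal.ofReal p),
      MemLp (D.symParaproductFun b f) (ENNReal.ofReal p) := fun f =>
    ⟨IsTestFunction.aestronglyMeasurable_symParaproductFun hd hp1 hb f.2,
      (IsTestFunction.eLpNorm_symParaproductFun_le hd hpq hb hA₀ hA f.2).trans_lt
        (ENNReal.mul_lt_top ENNReal.ofReal_lt_top (IsTestFunction.memLp f.2).2)⟩
  let U : D.testFunctions 𝕜 X (ENNReal.ofReal p) →ₗ[𝕜]
      Lp Y (ENNReal.ofReal p) (volume : Measure (EuclideanSpace ℝ (Fin d))) :=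
    { toFun := fun f => (hmem f).toLp
      map_add' := fun f g => by
        rw [← MemLp.toLp_add]
        exact MemLp.toLp_congr _ _ (Eq.eventuallyEq (symParaproductFun_add hp1 hb f.2 g.2))
      map_smul' := fun c f => by
        rw [RingHom.id_apply, ← MemLp.toLp_const_smul]
        exact MemLp.toLp_congr _ _ (Eq.eventuallyEq (symParaproductFun_smul c f.1)) }
  -- Stated for every `A`, so that one operator inherits all the available bounds: one from the
  -- explicit constant and one from each duality constant.
  have hbound : ∀ A, 0 ≤ A → D.IsParaproductBound b p q A →
      ∀ f, ‖U f‖ ≤ A * ‖D.testToLp 𝕜 X (ENNReal.ofReal p) f‖ := by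
    intro A hA0 hA f
    have h1 := IsTestFunction.eLpNorm_symParaproductFun_le hd hpq hb hA0 hA f.2
    refine (Lp.norm_toLp _ (hmem f)).trans_le (le_trans ?_
      (congrArg (A * ·) (Lp.norm_toLp _ (IsTestFunction.memLp f.2)).symm).le)
    have h2 := ENNReal.toReal_mono (ENNReal.mul_lt_top ENNReal.ofReal_lt_top
      (IsTestFunction.memLp f.2).2).ne h1
    rwa [ENNReal.toReal_mul, ENNReal.toReal_ofReal hA0] at h2
  have hdense := denseRange_testToLp (D := D) (𝕜 := 𝕜) (X := X) hd hpq.lt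
  refine ⟨U.extendOfNorm (D.testToLp 𝕜 X (ENNReal.ofReal p)), fun f g hf hg => ?_,
    fun A hA0 hA => LinearMap.opNorm_extendOfNorm_le hdense hA0 (hbound A hA0 hA)⟩
  rw [← hf.integral_symParaproductFun hd hp1 hq1 hb hg]
  have h1 : U.extendOfNorm (D.testToLp 𝕜 X (ENNReal.ofReal p)) (hf.memLp.toLp f) = U ⟨f, hf⟩ :=
    LinearMap.extendOfNorm_eq hdense ⟨A₀, hbound A₀ hA₀ hA⟩ ⟨f, hf⟩
  rw [h1]
  refine integral_congr_ae ?_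
  filter_upwards [(hmem ⟨f, hf⟩).coeFn_toLp] with x hx
  exact congrArg (g x) hx

end Extension

end DyadicSystem

/-! ### Lower bounds for UMD constants in terms of `p` and `q` -/

namespace DyadicSystem

section LowerBound

variable {d : ℕ} {D : DyadicSystem d} {F : Type*} [NormedAddCommGroup F] [NormedSpace ℝ F]
  [CompleteSpace F]

omit [CompleteSpace F] in
theorem avg_sum {ι : Type*} (k : ℤ) (s : Finset ι) {f : ι → EuclideanSpace ℝ (Fin d) → F}
    (hf : ∀ i ∈ s, LocallyIntegrable (f i)) :
    D.avg k (∑ i ∈ s, f i) = ∑ i ∈ s, D.avg k (f i) := by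
  classical
  induction s using Finset.induction_on with
  | empty => simp [avg_zero]
  | insert i s hi ih =>
    rw [Finset.sum_insert hi, Finset.sum_insert hi, avg_add k (hf i (Finset.mem_insert_self i s))
      (locallyIntegrable_finsetSum' _ fun j hj => hf j (Finset.mem_insert_of_mem hj)),
      ih fun j hj => hf j (Finset.mem_insert_of_mem hj)]

/-- Prescribed increments of the right generations and with the right mean zero are the martingale
differences of their sum. -/
theorem martDiff_sum {m : ℤ} {n : ℕ} {δ : ℕ → EuclideanSpace ℝ (Fin d) → F}
    (hδ : ∀ j : ℕ, D.IsStep (m + (j + 1)) (δ j)) (hδ0 : ∀ j : ℕ, D.avg (m + j) (δ j) = 0) {i : ℕ}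
    (hi : i < n) : D.martDiff m (∑ j ∈ Finset.range n, δ j) i = δ i := by
  have h1 := fun j => (hδ j).locallyIntegrable
  rw [martDiff, mart, mart, avg_sum _ _ fun j _ => h1 j, avg_sum _ _ fun j _ => h1 j,
    ← Finset.sum_sub_distrib, Finset.sum_eq_single i]
  · rw [hδ0 i, sub_zero]
    exact ((hδ i).const.mono (by push_cast; exact le_rfl)).avg_eq_self
  · intro j _ hj
    rcases lt_or_gt_of_ne hj with hj | hj
    · rw [((hδ j).const.mono (by push_cast; lia)).avg_eq_self,
        ((hδ j).const.mono (by lia)).avg_eq_self, sub_self]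
    · rw [avg_eq_zero_of_le (h1 j) (hδ0 j) (by push_cast; lia),
        avg_eq_zero_of_le (h1 j) (hδ0 j) (by lia), sub_self]
  · exact fun h => absurd (Finset.mem_range.2 hi) h

/-- The normalised difference `1_{I_{j+1}} - 2^{-d} 1_{I_j}` along the cubes `I_j` of generation
`m + j` around `0`. -/
noncomputable def nestedDiff (D : DyadicSystem d) (m : ℤ) (j : ℕ) (x : EuclideanSpace ℝ (Fin d)) :
    ℝ :=
  (D.cubeAt (m + (j + 1)) 0).indicator 1 x - (2 ^ d)⁻¹ * (D.cubeAt (m + j) 0).indicator 1 x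

theorem isStep_indicator_cubeAt (k : ℤ) (x₀ : EuclideanSpace ℝ (Fin d)) :
    D.IsStep k ((D.cubeAt k x₀).indicator (1 : EuclideanSpace ℝ (Fin d) → ℝ)) := by
  refine ⟨fun x y hy => ?_, (D.isBounded_cubeAt k x₀).subset Set.support_indicator_subset⟩
  by_cases hx : x ∈ D.cubeAt k x₀
  · rw [Set.indicator_of_mem hx, Set.indicator_of_mem (isUnionOfCubes_cubeAt k x₀ x hx hy)]
    rfl
  · rw [Set.indicator_of_notMem hx,
      Set.indicator_of_notMem ((isUnionOfCubes_cubeAt k x₀).compl x hx hy)]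

theorem isStep_nestedDiff (m : ℤ) (j : ℕ) : D.IsStep (m + (j + 1)) (D.nestedDiff m j) :=
  (isStep_indicator_cubeAt _ 0).comp₂ ((isStep_indicator_cubeAt (m + j) 0).mono (by lia))
    (fun a b => a - (2 ^ d)⁻¹ * b) (by simp)

theorem avg_nestedDiff (m : ℤ) (j : ℕ) : D.avg (m + j) (D.nestedDiff m j) = 0 := by
  ext x
  by_cases hx : x ∈ D.cubeAt (m + j) 0
  · have h1 : D.cubeAt (m + (j + 1)) 0 ⊆ D.cubeAt (m + j) 0 := D.cubeAt_anti (by lia) 0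
    have h2 := (isStep_indicator_cubeAt (D := D) (m + (j + 1)) 0).integrable
    have h3 := (isStep_indicator_cubeAt (D := D) (m + j) 0).integrable
    have h4 := D.volume_cubeAt_eq_two_pow_mul (m + j) 0 0
    rw [avg_eq, D.cubeAt_congr hx]
    simp only [nestedDiff]
    rw [integral_sub h2.integrableOn (h3.integrableOn.const_mul _), integral_const_mul,
      setIntegral_indicator (D.measurableSet_cubeAt _ _), setIntegral_indicator
      (D.measurableSet_cubeAt _ _), Set.inter_eq_right.2 h1, Set.inter_self]
    have h5 : volume.real (D.cubeAt (m + j) 0) = 2 ^ d * volume.real (D.cubeAt (m + (j + 1)) 0) := by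
      rw [measureReal_def, h4, ENNReal.toReal_mul, ENNReal.toReal_pow, add_assoc]
      rfl
    simp [h5]
  · rw [avg_congr_on_cube (g := 0) fun y hy => ?_, avg_zero]
    have hy' := (isUnionOfCubes_cubeAt (D := D) (m + j) 0).compl x hx hy
    rw [nestedDiff, Set.indicator_of_notMem hy', Set.indicator_of_notMem fun h =>
      hy' (D.cubeAt_anti (by lia) 0 h)]
    simp

theorem nestedDiff_of_mem {m : ℤ} {j : ℕ} {x : EuclideanSpace ℝ (Fin d)}
    (hx : x ∈ D.cubeAt (m + (j + 1)) 0) : D.nestedDiff m j x = 1 - (2 ^ d)⁻¹ := by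
  rw [nestedDiff, Set.indicator_of_mem hx, Set.indicator_of_mem (D.cubeAt_anti (by lia) 0 hx)]
  simp

theorem nestedDiff_of_mem_of_notMem {m : ℤ} {j : ℕ} {x : EuclideanSpace ℝ (Fin d)}
    (hx : x ∈ D.cubeAt (m + j) 0) (hx' : x ∉ D.cubeAt (m + (j + 1)) 0) :
    D.nestedDiff m j x = -(2 ^ d)⁻¹ := by
  rw [nestedDiff, Set.indicator_of_mem hx, Set.indicator_of_notMem hx']
  simp

theorem nestedDiff_of_notMem {m : ℤ} {j : ℕ} {x : EuclideanSpace ℝ (Fin d)}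
    (hx : x ∉ D.cubeAt (m + j) 0) : D.nestedDiff m j x = 0 := by
  rw [nestedDiff, Set.indicator_of_notMem hx,
    Set.indicator_of_notMem fun h => hx (D.cubeAt_anti (by lia) 0 h)]
  simp

theorem sum_nestedDiff_of_mem {m : ℤ} {n : ℕ} {x : EuclideanSpace ℝ (Fin d)}
    (hx : x ∈ D.cubeAt (m + n) 0) :
    ∑ j ∈ Finset.range n, D.nestedDiff m j x = n * (1 - (2 ^ d)⁻¹) := by
  rw [Finset.sum_congr rfl fun j hj => nestedDiff_of_mem (D.cubeAt_anti
    (by have := Finset.mem_range.1 hj; lia) 0 hx)]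
  rw [Finset.sum_const, Finset.card_range, nsmul_eq_mul]

theorem alternating_sum_nestedDiff_of_mem {m : ℤ} {n : ℕ} {x : EuclideanSpace ℝ (Fin d)}
    (hx : x ∈ D.cubeAt (m + n) 0) :
    ∑ j ∈ Finset.range n, (-1) ^ j * D.nestedDiff m j x
      = (1 - (2 ^ d)⁻¹) * ((1 - (-1) ^ n) / 2) := by
  rw [Finset.sum_congr rfl fun j hj => by rw [nestedDiff_of_mem (D.cubeAt_anti
    (by have := Finset.mem_range.1 hj; lia) 0 hx)], ← Finset.sum_mul,
    geom_sum_eq (by norm_num)]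
  ring

/-- While `x` stays in the chain, the alternating sum is `0` or `1 - 2^{-d}` in turn. The step at
which `x` leaves changes it to `-2^{-d}` or `1`, and later terms vanish. -/
theorem abs_alternating_sum_nestedDiff_le (m : ℤ) (n : ℕ) (x : EuclideanSpace ℝ (Fin d)) :
    |∑ j ∈ Finset.range n, (-1) ^ j * D.nestedDiff m j x|
      ≤ (D.cubeAt m 0).indicator 1 x := by
  have ha : (0 : ℝ) ≤ (2 ^ d)⁻¹ ∧ ((2 : ℝ) ^ d)⁻¹ ≤ 1 :=
    ⟨by positivity, inv_le_one_of_one_le₀ (one_le_pow₀ one_le_two)⟩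
  by_cases hx : x ∈ D.cubeAt m 0
  swap
  · rw [Set.indicator_of_notMem hx, Finset.sum_eq_zero fun j _ => ?_, abs_zero]
    rw [nestedDiff_of_notMem fun h => hx (D.cubeAt_anti (by lia) 0 h), mul_zero]
  rw [Set.indicator_of_mem hx, Pi.one_apply]
  induction n with
  | zero => simp
  | succ n ih =>
    rw [Finset.sum_range_succ]
    by_cases h1 : x ∈ D.cubeAt (m + n) 0
    · rw [alternating_sum_nestedDiff_of_mem h1]
      by_cases h2 : x ∈ D.cubeAt (m + (n + 1)) 0
      · rw [nestedDiff_of_mem h2, abs_le]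
        rcases neg_one_pow_eq_or ℝ n with h | h <;> rw [h] <;> constructor <;> linarith
      · rw [nestedDiff_of_mem_of_notMem h1 h2, abs_le]
        rcases neg_one_pow_eq_or ℝ n with h | h <;> rw [h] <;> constructor <;> linarith
    · rwa [nestedDiff_of_notMem h1, mul_zero, add_zero]

theorem volume_cubeAt_eq_pow_mul (m : ℤ) (n : ℕ) (x : EuclideanSpace ℝ (Fin d)) :
    volume (D.cubeAt m x) = (2 ^ d) ^ n * volume (D.cubeAt (m + n) x) := by
  induction n with
  | zero => simp
  | succ n ih =>
    rw [ih, D.volume_cubeAt_eq_two_pow_mul (m + n) x x, pow_succ, mul_assoc]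
    push_cast
    rw [add_assoc]

/-- Lower bound for the norm of dyadic martingale transforms. -/
theorem le_of_forall_eLpNorm_sum_sign_martDiff_le [Nontrivial F] (hd : 0 < d)
    (D : DyadicSystem d) {p β : ℝ} (hp : 1 < p) (hβ0 : 0 ≤ β)
    (hβ : ∀ (m : ℤ) (n : ℕ) (f : EuclideanSpace ℝ (Fin d) → F), D.IsStep (m + n) f →
      D.avg m f = 0 → ∀ ε : ℕ → ℝ, (∀ i, ε i = 1 ∨ ε i = -1) →
        eLpNorm (∑ i ∈ Finset.range n, ε i • D.martDiff m f i) (ENNReal.ofReal p) volume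
          ≤ ENNReal.ofReal β * eLpNorm f (ENNReal.ofReal p) volume) :
    p ≤ 2 * 4 ^ d * β := by
  obtain ⟨v, hv⟩ := exists_ne (0 : F)
  have hp0 : 0 < p := by linarith
  -- Long enough for the unsigned sum to reach `p / 2` on the innermost cube, and short enough that
  -- `n ≤ 2 p`, so that the volume ratio `2^{d n}` has `p`-th root at most `4 ^ d`.
  set n := ⌈p⌉₊ with hn
  -- The alternating signs are built into `f`, which is therefore bounded; the transform with the
  -- same signs removes them and produces the large unsigned sum.
  set δ : ℕ → EuclideanSpace ℝ (Fin d) → F := fun j x => ((-1) ^ j * D.nestedDiff 0 j x) • v with hδ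
  have h1 : ∀ j : ℕ, D.IsStep (0 + (j + 1)) (δ j) := fun j =>
    (isStep_nestedDiff 0 j).comp (fun t => ((-1) ^ j * t) • v) (by simp)
  have h2 : ∀ j : ℕ, D.avg (0 + j) (δ j) = 0 := fun j => by
    have h := avg_clm_apply (D := D) (k := 0 + j)
      (φ := fun _ => ((-1 : ℝ) ^ j) • (ContinuousLinearMap.id ℝ ℝ).smulRight v)
      (fun _ _ _ => rfl) (isStep_nestedDiff (D := D) 0 j).locallyIntegrable
    have h' : δ j = fun x => (((-1 : ℝ) ^ j) • (ContinuousLinearMap.id ℝ ℝ).smulRight v)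
      (D.nestedDiff 0 j x) := by
      ext x
      simp [hδ, mul_smul]
    rw [h', h, avg_nestedDiff]
    ext x
    simp
  set f := ∑ j ∈ Finset.range n, δ j with hf
  have hfs : D.IsStep (0 + n) f := IsStep.sum _ fun j hj =>
    (h1 j).mono (by have := Finset.mem_range.1 hj; lia)
  have hf0 : D.avg 0 f = 0 := by
    rw [hf, avg_sum _ _ fun j _ => (h1 j).locallyIntegrable]
    exact Finset.sum_eq_zero fun j _ =>
      avg_eq_zero_of_le (h1 j).locallyIntegrable (h2 j) (by lia)
  have h3 := hβ 0 n f hfs hf0 (fun j => (-1) ^ j) fun j => neg_one_pow_eq_or ℝ j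
  rw [Finset.sum_congr rfl fun i hi => by rw [martDiff_sum h1 h2 (Finset.mem_range.1 hi)]] at h3
  have hq0 : ENNReal.ofReal p ≠ 0 := (ENNReal.ofReal_pos.2 hp0).ne'
  have h4 : eLpNorm f (ENNReal.ofReal p) volume ≤ ‖v‖ₑ * volume (D.cubeAt 0 0) ^ (1 / p) := by
    have h := eLpNorm_indicator_const (μ := volume) (c := v) (D.measurableSet_cubeAt 0 0) hq0
      ENNReal.ofReal_ne_top
    rw [ENNReal.toReal_ofReal hp0.le] at h
    rw [← h]
    refine eLpNorm_mono fun x => ?_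
    have h5 := abs_alternating_sum_nestedDiff_le (D := D) 0 n x
    rw [hf, Finset.sum_apply, hδ, ← Finset.sum_smul, norm_smul, Real.norm_eq_abs]
    by_cases hx : x ∈ D.cubeAt 0 0
    · rw [Set.indicator_of_mem hx] at h5 ⊢
      exact mul_le_of_le_one_left (norm_nonneg _) h5
    · rw [Set.indicator_of_notMem hx] at h5 ⊢
      rw [norm_zero]
      exact mul_nonpos_of_nonpos_of_nonneg h5 (norm_nonneg _)
  have h6 : ENNReal.ofReal (p / 2) * ‖v‖ₑ * volume (D.cubeAt (0 + n) 0) ^ (1 / p)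
      ≤ eLpNorm (∑ i ∈ Finset.range n, (-1 : ℝ) ^ i • δ i) (ENNReal.ofReal p) volume := by
    have h := eLpNorm_indicator_const (μ := volume) (c := (p / 2) • v)
      (D.measurableSet_cubeAt (0 + n) 0) hq0 ENNReal.ofReal_ne_top
    rw [ENNReal.toReal_ofReal hp0.le, enorm_smul, Real.enorm_eq_ofReal (by positivity)] at h
    rw [← h]
    refine eLpNorm_mono fun x => ?_
    by_cases hx : x ∈ D.cubeAt (0 + n) 0
    · have h7 : (∑ i ∈ Finset.range n, (-1 : ℝ) ^ i • δ i) x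
          = (n * (1 - (2 ^ d)⁻¹) : ℝ) • v := by
        rw [← sum_nestedDiff_of_mem hx, Finset.sum_apply, Finset.sum_smul]
        refine Finset.sum_congr rfl fun i _ => ?_
        rw [Pi.smul_apply, hδ, smul_smul, ← mul_assoc, ← mul_pow]
        norm_num
      have h8 : ((2 : ℝ) ^ d)⁻¹ ≤ 1 / 2 := by
        rw [one_div]
        exact inv_anti₀ two_pos (le_self_pow₀ one_le_two hd.ne')
      have h9 : p ≤ n := Nat.le_ceil p
      rw [Set.indicator_of_mem hx, h7, norm_smul, norm_smul, Real.norm_of_nonneg (by positivity),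
        Real.norm_of_nonneg (mul_nonneg (by positivity) (by linarith))]
      gcongr
      nlinarith
    · rw [Set.indicator_of_notMem hx, norm_zero]
      exact norm_nonneg _
  have h10 := (h6.trans h3).trans (mul_le_mul_right h4 _)
  set V := volume (D.cubeAt (0 + n) 0) ^ (1 / p) with hV
  have hV0 : V ≠ 0 := by
    rw [hV, Ne, ENNReal.rpow_eq_zero_iff]
    simp [D.volume_cubeAt_ne_zero, D.volume_cubeAt_ne_top]
  have hVt : V ≠ ∞ := ENNReal.rpow_ne_top_of_nonneg (by positivity) (D.volume_cubeAt_ne_top _ _)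
  have hn2 : (n : ℝ) * (1 / p) ≤ 2 := by
    have := (Nat.ceil_lt_add_one hp0.le).le
    rw [mul_one_div, div_le_iff₀ hp0]
    linarith
  have h11 : volume (D.cubeAt 0 0) ^ (1 / p) ≤ ENNReal.ofReal (4 ^ d) * V := by
    rw [volume_cubeAt_eq_pow_mul 0 n, ENNReal.mul_rpow_of_nonneg _ _ (by positivity)]
    gcongr
    rw [← ENNReal.rpow_natCast, ← ENNReal.rpow_mul]
    refine (ENNReal.rpow_le_rpow_of_exponent_le (one_le_pow₀ one_le_two) hn2).trans_eq ?_
    rw [ENNReal.rpow_two, ← pow_mul, mul_comm d, pow_mul, ENNReal.ofReal_pow (by norm_num)]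
    norm_num
  have h12 : (ENNReal.ofReal (p / 2)) * (‖v‖ₑ * V)
      ≤ ENNReal.ofReal (β * 4 ^ d) * (‖v‖ₑ * V) := by
    calc _ = ENNReal.ofReal (p / 2) * ‖v‖ₑ * V := (mul_assoc _ _ _).symm
      _ ≤ _ := h10
      _ ≤ ENNReal.ofReal β * (‖v‖ₑ * (ENNReal.ofReal (4 ^ d) * V)) := by gcongr
      _ = _ := by rw [ENNReal.ofReal_mul hβ0]; ring
  have hv0 : ‖v‖ₑ ≠ 0 := by simpa using hv
  rw [ENNReal.mul_le_mul_iff_left (mul_ne_zero hv0 hV0) (ENNReal.mul_ne_top enorm_ne_top hVt),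
    ENNReal.ofReal_le_ofReal_iff (by positivity)] at h12
  linarith

end LowerBound

end DyadicSystem

/-! ### Assembly of the bounds -/

namespace DyadicSystem

section Main

variable {d : ℕ} {D : DyadicSystem d} {𝕜 : Type} [RCLike 𝕜]
  {X : Type*} [NormedAddCommGroup X] [NormedSpace ℝ X] [NormedSpace 𝕜 X] [IsScalarTower ℝ 𝕜 X]
  [CompleteSpace X]
  {Y : Type*} [NormedAddCommGroup Y] [NormedSpace ℝ Y] [NormedSpace 𝕜 Y] [IsScalarTower ℝ 𝕜 Y]
  [CompleteSpace Y] {p q : ℝ}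

omit [IsScalarTower ℝ 𝕜 X] [IsScalarTower ℝ 𝕜 Y] in
-- Here `Y` norms `StrongDual 𝕜 Y`, so the transforms of `g` in `L^q` obey the constant of `Y` for
-- the exponent `p`.
theorem hardyNorm_paraFunctional_le (hd : 0 < d) (hX : IsUMD X) (hY : IsUMD Y)
    (hpq : p.HolderConjugate q) {f : EuclideanSpace ℝ (Fin d) → X}
    {g : EuclideanSpace ℝ (Fin d) → StrongDual 𝕜 Y} {m : ℤ} {n : ℕ} (hf : D.IsStep (m + n) f)
    (hf0 : D.avg m f = 0) (hg : D.IsStep (m + n) g) (hg0 : D.avg m g = 0) :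
    D.hardyNorm (D.paraFunctional m f g n)
      ≤ ENNReal.ofReal (p * q + umdConst (ENNReal.ofReal p) X * umdConst (ENNReal.ofReal p) Y) *
        (eLpNorm f (ENNReal.ofReal p) volume * eLpNorm g (ENNReal.ofReal q) volume) :=
  hardyNorm_paraTensor_le (E := StrongDual 𝕜 (X →L[𝕜] Y)) norm_tensorEval_le hpq
    (umdConst_nonneg _ X) (umdConst_nonneg _ Y) hf hg
    (fun _ hε => eLpNorm_sum_sign_martDiff_le (isUMDBound_umdConst hX hpq.lt) hf hf0 hε)
    (fun _ hε => eLpNorm_sum_sign_martDiff_le_of_dual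
      (isNormingPairing_inclusionInDoubleDual (𝕜 := 𝕜)) hd hpq.symm
      (isUMDBound_umdConst hY hpq.lt) hg hg0 hε) hf0 hg0

omit [IsScalarTower ℝ 𝕜 X] in
theorem isParaproductBound_of_duality (hd : 0 < d) (hX : IsUMD X) (hY : IsUMD Y)
    (hpq : p.HolderConjugate q) {b : EuclideanSpace ℝ (Fin d) → X →L[𝕜] Y} (hb : D.MemBMO b)
    {c : ℝ} (hc : 0 ≤ c)
    (h : ∀ (h : EuclideanSpace ℝ (Fin d) → StrongDual 𝕜 (X →L[𝕜] Y)) (m : ℤ) (n : ℕ),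
      D.IsStep (m + n) h → D.avg m h = 0 → D.hardyNorm h < ∞ →
      ‖∫ x, h x (b x)‖ₑ ≤ ENNReal.ofReal c * D.bmoNorm b * D.hardyNorm h) :
    D.IsParaproductBound b p q
      (c * (p * q + umdConst (ENNReal.ofReal p) X * umdConst (ENNReal.ofReal p) Y)
        * (D.bmoNorm b).toReal) := by
  intro f g m n hf hf0 hg hg0
  have hH := hardyNorm_paraFunctional_le hd hX hY hpq hf hf0 hg hg0
  have h1 : D.hardyNorm (D.paraFunctional m f g n) < ∞ := hH.trans_lt
    (ENNReal.mul_lt_top ENNReal.ofReal_lt_top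
      (ENNReal.mul_lt_top (hf.memLp _).eLpNorm_lt_top (hg.memLp _).eLpNorm_lt_top))
  have hβ : 0 ≤ p * q + umdConst (ENNReal.ofReal p) X * umdConst (ENNReal.ofReal p) Y :=
    add_nonneg (mul_nonneg hpq.nonneg hpq.symm.nonneg)
      (mul_nonneg (umdConst_nonneg _ X) (umdConst_nonneg _ Y))
  calc _ ≤ ENNReal.ofReal c * D.bmoNorm b * D.hardyNorm (D.paraFunctional m f g n) :=
        h _ m n (IsStep.paraTensor hf hg n) (avg_paraTensor_zero hf hg n) h1
    _ ≤ ENNReal.ofReal c * D.bmoNorm b * (ENNReal.ofReal (p * q +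
        umdConst (ENNReal.ofReal p) X * umdConst (ENNReal.ofReal p) Y) *
        (eLpNorm f (ENNReal.ofReal p) volume * eLpNorm g (ENNReal.ofReal q) volume)) := by gcongr
    _ = _ := by
      rw [ENNReal.ofReal_mul (by positivity), ENNReal.ofReal_mul hc,
        ENNReal.ofReal_toReal hb.bmoNorm_lt_top.ne]
      ring

end Main

/-- The bound for `p` tests in `X`. The bound for `q` tests in the real dual of `X` with exponent
`q`, where by duality the transforms have the same bound. -/
theorem max_le_mul_umdConst {d : ℕ} (hd : 0 < d) (D : DyadicSystem d) {X : Type*}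
    [NormedAddCommGroup X] [NormedSpace ℝ X] [CompleteSpace X] [Nontrivial X] {p q : ℝ}
    (hX : IsUMD X) (hpq : p.HolderConjugate q) :
    max p q ≤ 2 * 4 ^ d * umdConst (ENNReal.ofReal p) X := by
  have h := isUMDBound_umdConst hX hpq.lt
  obtain ⟨v, hv⟩ := exists_ne (0 : X)
  obtain ⟨φ, hφ, -⟩ := exists_dual_vector ℝ v (norm_ne_zero_iff.2 hv)
  have : Nontrivial (StrongDual ℝ X) := ⟨φ, 0, fun H => by simp [H] at hφ⟩
  refine max_le ?_ ?_
  · exact le_of_forall_eLpNorm_sum_sign_martDiff_le (F := X) hd D hpq.lt (umdConst_nonneg _ X)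
      fun m n f hf hf0 ε hε => eLpNorm_sum_sign_martDiff_le h hf hf0 hε
  · exact le_of_forall_eLpNorm_sum_sign_martDiff_le (F := StrongDual ℝ X) hd D hpq.symm.lt
      (umdConst_nonneg _ X) fun m n f hf hf0 ε hε => eLpNorm_sum_sign_martDiff_le_of_dual
        (isNormingPairing_inclusionInDoubleDual (𝕜 := ℝ)) hd hpq.symm h hf hf0 hε

theorem enorm_integral_dual_apply_le {d : ℕ} {D : DyadicSystem d} {𝕜 W : Type*} [RCLike 𝕜]
    [NormedAddCommGroup W] [NormedSpace ℝ W] [NormedSpace 𝕜 W] [CompleteSpace W]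
    {b : EuclideanSpace ℝ (Fin d) → W} (hb : LocallyIntegrable b)
    {h : EuclideanSpace ℝ (Fin d) → StrongDual 𝕜 W} {m : ℤ} {n : ℕ} (hh : D.IsStep (m + n) h)
    (h0 : D.avg m h = 0) :
    ‖∫ x, h x (b x)‖ₑ ≤ 6 * 2 ^ d * D.bmoNorm b * D.hardyNorm h :=
  enorm_integral_pairing_le_bmoNorm_mul_hardyNorm
    (B := ContinuousLinearMap.id 𝕜 (StrongDual 𝕜 W))
    isNormingPairing_id.norm_le hb hh h0

end DyadicSystem

theorem norm_eq_zero_of_subsingleton {𝕜 V W : Type*} [NontriviallyNormedField 𝕜]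
    [NormedAddCommGroup V] [NormedSpace 𝕜 V] [NormedAddCommGroup W] [NormedSpace 𝕜 W]
    (h : Subsingleton V ∨ Subsingleton W) (T : V →L[𝕜] W) : ‖T‖ = 0 := by
  rw [norm_eq_zero]
  ext x
  rcases h with h | h
  · rw [Subsingleton.elim x 0, map_zero, map_zero]
  · exact Subsingleton.elim _ _

theorem subsingleton_Lp {α F : Type*} [MeasurableSpace α] {μ : Measure α} [NormedAddCommGroup F]
    [Subsingleton F] (p : ℝ≥0∞) : Subsingleton (Lp F p μ) :=
  ⟨fun _ _ => Lp.ext (Eventually.of_forall fun _ => Subsingleton.elim _ _)⟩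

/-- The constants `C` and `C'` depend only on the dimension `d`. Moreover `C` may be replaced by any
admissible constant in the `H^1`-BMO duality. -/
theorem mainTheorem1 (d : ℕ) (hd : 0 < d) :
    ∃ C C' : ℝ, 0 ≤ C ∧ 0 ≤ C' ∧
    ∀ (𝕜 : Type) [RCLike 𝕜]
      (X : Type u) [NormedAddCommGroup X] [NormedSpace ℝ X] [NormedSpace 𝕜 X] [IsScalarTower ℝ 𝕜 X]
      [CompleteSpace X]
      (Y : Type v) [NormedAddCommGroup Y] [NormedSpace ℝ Y] [NormedSpace 𝕜 Y] [IsScalarTower ℝ 𝕜 Y]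
      [CompleteSpace Y]
      (_ : IsUMD X) (_ : IsUMD Y)
      (D : DyadicSystem d) (b : EuclideanSpace ℝ (Fin d) → X →L[𝕜] Y) (_ : D.MemBMO b)
      (p q : ℝ) (_ : p.HolderConjugate q) [Fact (1 ≤ ENNReal.ofReal p)],
      ∃ T : Lp X (ENNReal.ofReal p) (volume : Measure (EuclideanSpace ℝ (Fin d))) →L[𝕜]
          Lp Y (ENNReal.ofReal p) (volume : Measure (EuclideanSpace ℝ (Fin d))),
        (∀ (f : EuclideanSpace ℝ (Fin d) → X) (g : EuclideanSpace ℝ (Fin d) → StrongDual 𝕜 Y)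
          (hf : D.IsTestFunction (ENNReal.ofReal p) f)
          (_ : D.IsTestFunction (ENNReal.ofReal q) g),
          ∫ x, (g x) (T (hf.memLp.toLp f) x) = D.symParaproduct b f g) ∧
        ‖T‖ ≤ C * (p * q + umdConst (ENNReal.ofReal p) X * umdConst (ENNReal.ofReal p) Y)
            * (D.bmoNorm b).toReal ∧
        ‖T‖ ≤ C' * (umdConst (ENNReal.ofReal p) X * umdConst (ENNReal.ofReal p) Y)
            * (D.bmoNorm b).toReal ∧
        (Nontrivial X → Nontrivial Y →
          C * (p * q + umdConst (ENNReal.ofReal p) X * umdConst (ENNReal.ofReal p) Y)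
              * (D.bmoNorm b).toReal
            ≤ C' * (umdConst (ENNReal.ofReal p) X * umdConst (ENNReal.ofReal p) Y)
              * (D.bmoNorm b).toReal) ∧
        (∀ c : ℝ, DyadicSystem.IsDualityConstant.{max u v} 𝕜 D c →
          ‖T‖ ≤ c * (p * q + umdConst (ENNReal.ofReal p) X * umdConst (ENNReal.ofReal p) Y)
            * (D.bmoNorm b).toReal) := by
  -- The first constant is the one proved for the duality with step functions; the second absorbs `p
  -- q ≤ (2 * 4 ^ d) ^ 2 * βX * βY`.
  refine ⟨6 * 2 ^ d, 6 * 2 ^ d * ((2 * 4 ^ d) ^ 2 + 1), by positivity, by positivity, ?_⟩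
  intro 𝕜 _ X _ _ _ _ _ Y _ _ _ _ _ hX hY D b hb p q hpq _
  set βX := umdConst (ENNReal.ofReal p) X
  set βY := umdConst (ENNReal.ofReal p) Y
  have hβX : 0 ≤ βX := umdConst_nonneg _ X
  have hβY : 0 ≤ βY := umdConst_nonneg _ Y
  have hpq0 : 0 ≤ p * q := mul_nonneg hpq.nonneg hpq.symm.nonneg
  have hA := DyadicSystem.isParaproductBound_of_duality (c := 6 * 2 ^ d) hd hX hY hpq hb
    (by positivity) fun h m n hs h0 _ => by
      have h1 := DyadicSystem.enorm_integral_dual_apply_le hb.locallyIntegrable hs h0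
      have h2 : ENNReal.ofReal (6 * 2 ^ d) = 6 * 2 ^ d := by
        rw [ENNReal.ofReal_mul (by norm_num), ENNReal.ofReal_pow (by norm_num)]
        norm_num
      rw [h2]
      exact h1
  obtain ⟨T, hT, hTn⟩ := DyadicSystem.exists_symParaproduct_operator hd hpq hb.locallyIntegrable
    (by positivity) hA
  have hTC := hTn _ (by positivity) hA
  have hC : Nontrivial X → Nontrivial Y → 6 * 2 ^ d * (p * q + βX * βY) * (D.bmoNorm b).toReal
      ≤ 6 * 2 ^ d * ((2 * 4 ^ d) ^ 2 + 1) * (βX * βY) * (D.bmoNorm b).toReal := by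
    intro _ _
    have h1 := DyadicSystem.max_le_mul_umdConst hd D hX hpq
    have h2 := DyadicSystem.max_le_mul_umdConst hd D hY hpq
    have h3 : p * q ≤ (2 * 4 ^ d * βX) * (2 * 4 ^ d * βY) :=
      mul_le_mul ((le_max_left _ _).trans h1) ((le_max_right _ _).trans h2) hpq.symm.nonneg
        (by positivity)
    rw [mul_assoc (6 * 2 ^ d) ((2 * 4 ^ d) ^ 2 + 1)]
    gcongr
    linarith
  refine ⟨T, hT, hTC, ?_, hC, fun c hc => ?_⟩
  -- For a zero space `p q` cannot be absorbed into the UMD constants, but there the operator is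
  -- zero.
  · rcases subsingleton_or_nontrivial X with h | h
    · rw [norm_eq_zero_of_subsingleton (Or.inl (subsingleton_Lp _)) T]
      positivity
    rcases subsingleton_or_nontrivial Y with h' | h'
    · rw [norm_eq_zero_of_subsingleton (Or.inr (subsingleton_Lp _)) T]
      positivity
    exact hTC.trans (hC h h')
  · have hc0 := hc.1
    refine hTn _ (by positivity) (DyadicSystem.isParaproductBound_of_duality hd hX hY hpq hb hc0
      fun h m n hs _ hh => ?_)
    -- The duality is used with `E` the dual of `X →L[𝕜] Y`, and `b` is embedded isometrically into
    -- the bidual, which is the dual of `E`.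
    exact DyadicSystem.IsDualityConstant.enorm_integral_le hc
      (NormedSpace.inclusionInDoubleDualLi (E := X →L[𝕜] Y) 𝕜) hb hs hh
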